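/- Let $M$ be a quaternionic Kähler manifold of dimension $4n$, $n\ge 2$, i.e. a Riemannian manifold with a reduction of its orthonormal frame bundle to a principal $\mathrm{Sp}(1)\cdot\mathrm{Sp}(n)$-bundle to which the Levi-Civita connection restricts, so that $TM\otimes\mathbb{C}=H\otimes E$ locally, with $H=\mathbb{C}^2$ and $E=\mathbb{C}^{2n}$ the standard representations of $\mathrm{Sp}(1)$ and $\mathrm{Sp}(n)$. Let $R$ be its curvature tensor and $\kappa$ its scalar curvature. For a finite-dimensional complex representation $\pi$ of $\mathrm{Sp}(1)\times\mathrm{Sp}(n)$ for which the associated vector bundle $\pi(M)$ exists put $$\Delta_\pi:=\nabla^*\nabla+2q(R),\qquad q(R):=\tfrac14\sum_{i,j}(E_i\wedge E_j)_\bullet\,R(E_i\wedge E_j)_\bullet ,$$ where $\{E_i\}$ is a local orthonormal frame and $\bullet$ is the action of $\mathfrak{sp}(1)\oplus\mathfrak{sp}(n)$ on the fibres (as $R$ takes values in this algebra, only the component of $E_i\wedge E_j\in\mathfrak{so}(TM)$ in it contributes). Let $\mathbf{S}$ be the spinor representation, let $\mathcal{R}^{l,d}:=\mathrm{Sym}^lH\otimes\Lambda^d_\circ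 E$ with $l\ge 0$ and $0\le d\le n$, where $\Lambda^d_\circ E$ is the kernel of the contraction $\Lambda^dE\to\Lambda^{d-2}E$ with the symplectic form, and suppose that the bundle $(\mathbf{S}\otimes\mathcal{R}^{l,d})(M)$ exists. Let $D_{\mathcal{R}^{l,d}}=\sum_iE_i\star\nabla_{E_i}$ be the twisted Dirac operator on its sections. Then: 1. For every parallel embedding (more generally, every parallel bundle homomorphism) $F:\pi(M)\to(\mathbf{S}\otimes\mathcal{R}^{l,d})(M)$ and every smooth section $\psi$ of $\pi(M)$, $$F(\Delta_\pi\psi)=D^2_{\mathcal{R}^{l,d}}(F\psi)+\frac{\kappa}{8n(n+2)}\,(l+d-n)(l-d+n+2)\,F\psi .$$ 2. The restriction of $D^2_{\mathcal{R}^{l,d}}$ to $\pi(M)$ does not depend on the embedding: if $F,F'$ are two parallel embeddings of $\pi(M)$ into $(\mathbf{S}\otimes\mathcal{R}^{l,d})(M)$ and $\psi,\chi$ are smooth sections of $\pi(M)$, then $D^2_{\mathcal{R}^{l,d}}(F\psi)=F\chi$ if and only if $D^2_{\mathcal{R}^{l,d}}(F'\psi)=F'\chi$. 3. The hyperkähler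 part $R^{hyper}:=R+\frac{\kappa}{8n(n+2)}(R^H+R^E)$ of the curvature acts trivially on the twist: $q(R^{hyper})=0$ on $\mathcal{R}^{l,d}$. Here, with $\sigma$ the symplectic forms of $H$ and $E$, $R^H_{h_1\otimes e_1,h_2\otimes e_2}=\sigma(e_1,e_2)\,(h_1h_2)_\bullet$ and $R^E_{h_1\otimes e_1,h_2\otimes e_2}=\sigma(h_1,h_2)\,(e_1e_2)_\bullet$, where $(v_1v_2)_\bullet v=\sigma(v_1,v)v_2+\sigma(v_2,v)v_1$. -/

import Mathlib

open Bundle Matrix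
open scoped Manifold ContDiff ComplexConjugate

noncomputable section

namespace QK

/-! ## The standard representations `H` and `E` and the Lie algebra `sp(1) ⊕ sp(n)`

`E = ℂ^{2n}` has coordinates indexed by `Idx n`, the symplectic form `σ(e, e') = eᵀ J e'` and the
quaternionic structure `e ↦ -J ē`; the space `H = ℂ²` is the case `n = 1`. Elements of `H ⊗ E` are
matrices with rows indexed by `Idx 1` and columns indexed by `Idx n`; a pair `(g, A)` acts on them
by `Z ↦ g Z Aᵀ`, and the real structure is `Z ↦ J Z̄ Jᵀ`. -/

/-- The index set of a symplectic basis of `ℂ^{2m}`. -/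
abbrev Idx (m : ℕ) : Type := Fin m ⊕ Fin m

/-- The compact group `Sp(m)`: unitary symplectic matrices, i.e. symplectic matrices commuting with
the quaternionic structure. -/
def compactSp (m : ℕ) : Set (Matrix (Idx m) (Idx m) ℂ) :=
  {A | A ∈ Matrix.unitaryGroup (Idx m) ℂ ∧ A ∈ Matrix.symplecticGroup (Fin m) ℂ}

/-- The Lie algebra of `Sp(m)`: skew-Hermitian matrices that are skew for `σ`. -/
def sp (m : ℕ) : Submodule ℝ (Matrix (Idx m) (Idx m) ℂ) where
  carrier := {X | Xᴴ = -X ∧ Xᵀ * J (Fin m) ℂ + J (Fin m) ℂ * X = 0}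
  zero_mem' := by simp
  add_mem' := by
    rintro X Y ⟨h1, h2⟩ ⟨h3, h4⟩
    refine ⟨by rw [conjTranspose_add, h1, h3]; abel, ?_⟩
    rw [transpose_add, add_mul, mul_add, add_add_add_comm, h2, h4, add_zero]
  smul_mem' := by
    rintro c X ⟨h1, h2⟩
    refine ⟨by rw [conjTranspose_smul, h1]; simp, ?_⟩
    rw [transpose_smul, smul_mul_assoc, mul_smul_comm, ← smul_add, h2, smul_zero]

/-- The Lie bracket of `sp(m)`. -/
def spBracket {m : ℕ} (X Y : sp m) : sp m :=
  ⟨X.1 * Y.1 - Y.1 * X.1, by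
    have h1 : X.1ᴴ = -X.1 := X.2.1
    have h3 : Y.1ᴴ = -Y.1 := Y.2.1
    have h2 : X.1ᵀ * J (Fin m) ℂ = -(J (Fin m) ℂ * X.1) := eq_neg_of_add_eq_zero_left X.2.2
    have h4 : Y.1ᵀ * J (Fin m) ℂ = -(J (Fin m) ℂ * Y.1) := eq_neg_of_add_eq_zero_left Y.2.2
    refine ⟨?_, ?_⟩
    · rw [conjTranspose_sub, conjTranspose_mul, conjTranspose_mul, h1, h3]
      noncomm_ring
    · rw [transpose_sub, transpose_mul, transpose_mul, sub_mul, mul_assoc, h2,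
        mul_assoc, h4, mul_neg, ← mul_assoc, h4, mul_neg, ← mul_assoc, h2]
      noncomm_ring⟩

/-- The inclusion of `sp(m)` into the matrices, seen as complex valued functions. -/
def spIncl (m : ℕ) : sp m →ₗ[ℝ] (Idx m → Idx m → ℂ) where
  toFun X := X.1
  map_add' _ _ := rfl
  map_smul' _ _ := rfl

instance spNormedAddCommGroup (m : ℕ) : NormedAddCommGroup (sp m) :=
  NormedAddCommGroup.induced (sp m) (Idx m → Idx m → ℂ) (spIncl m)
    (fun _ _ h => Subtype.ext h)

instance spNormedSpace (m : ℕ) : NormedSpace ℝ (sp m) :=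
  NormedSpace.induced ℝ (sp m) (Idx m → Idx m → ℂ) (spIncl m)

/-- The Lie algebra `sp(1) ⊕ sp(n)` of `Sp(1) × Sp(n)`. -/
abbrev hol (n : ℕ) : Type := sp 1 × sp n

/-- The action of `sp(1) ⊕ sp(n)` on the tangent representation `H ⊗ E`. -/
def tangentAct {n : ℕ} (X : hol n) (Z : Matrix (Idx 1) (Idx n) ℂ) : Matrix (Idx 1) (Idx n) ℂ :=
  X.1.1 * Z + Z * (X.2.1)ᵀ

/-! ## The real tangent representation `ℝ^{4n} ⊂ H ⊗ E` -/

/-- The index set of an orthonormal basis of the real subspace of `H ⊗ E`. -/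
abbrev Fr (n : ℕ) : Type := Idx n × Fin 2

/-- The scalars `1` and `i`. -/
def unitScalar : Fin 2 → ℂ := ![1, Complex.I]

/-- The orthonormal basis of the real subspace of `H ⊗ E`: the vectors
`(h ⊗ e + Jh ⊗ Je) / √2`, where `h` is the first basis vector of `H` and `e` runs through the
basis vectors of `E` and `i` times them. -/
def frameVec {n : ℕ} (p : Fr n) : Matrix (Idx 1) (Idx n) ℂ := fun α ν =>
  ((1 / Real.sqrt 2 : ℝ) : ℂ) *
    Sum.elim (fun _ => if ν = p.1 then unitScalar p.2 else 0)
      (fun _ => conj (unitScalar p.2) * J (Fin n) ℂ ν p.1) α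

/-- The coordinate of `Z` with respect to the basis vector `frameVec p`; on the real subspace of
`H ⊗ E` the form `σ ⊗ σ` is `⟨Z, W⟩ = ∑ Z W̄`. -/
def coord {n : ℕ} (p : Fr n) (Z : Matrix (Idx 1) (Idx n) ℂ) : ℝ :=
  (∑ α, ∑ ν, Z α ν * conj (frameVec p α ν)).re

theorem frameVec_real {n : ℕ} (p : Fr n) :
    (frameVec p).map star = - (J (Fin 1) ℂ * frameVec p * J (Fin n) ℂ) := by
  obtain ⟨μ | μ, c⟩ := p <;> ext (α | α) (ν | ν) <;> fin_cases α <;>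
    simp [frameVec, J, Matrix.mul_apply, Matrix.fromBlocks, Matrix.one_apply]
  all_goals
    by_cases h : ν = μ
    · simp [h]
    · simp [h, Ne.symm h]

theorem mul_J_skew {m : ℕ} {Y : Matrix (Idx m) (Idx m) ℂ} (h : Yᵀ = Y) :
    (Y * J (Fin m) ℂ)ᵀ * J (Fin m) ℂ + J (Fin m) ℂ * (Y * J (Fin m) ℂ) = 0 := by
  rw [transpose_mul, h, J_transpose]
  noncomm_ring

/-- The element `Z ↦ ⟨e_p, Z⟩ e_q - ⟨e_q, Z⟩ e_p` of `so(4n)`, traced over `E`. -/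
def omegaH {n : ℕ} (p q : Fr n) : sp 1 :=
  ⟨frameVec q * (frameVec p)ᴴ - frameVec p * (frameVec q)ᴴ, by
    refine ⟨by simp, ?_⟩
    have hc : ∀ r : Fr n, (frameVec r)ᴴ = -(J (Fin n) ℂ * (frameVec r)ᵀ * J (Fin 1) ℂ) := by
      intro r
      have := congrArg transpose (frameVec_real r)
      rw [transpose_neg, transpose_mul, transpose_mul, J_transpose, J_transpose] at this
      rw [conjTranspose, transpose_map, this]
      simp [Matrix.mul_assoc]
    have : frameVec q * (frameVec p)ᴴ - frameVec p * (frameVec q)ᴴ =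
        (frameVec p * J (Fin n) ℂ * (frameVec q)ᵀ - frameVec q * J (Fin n) ℂ * (frameVec p)ᵀ)
          * J (Fin 1) ℂ := by
      rw [hc, hc]
      simp only [Matrix.mul_neg, Matrix.sub_mul, Matrix.mul_assoc]
      abel
    rw [this]
    apply mul_J_skew
    simp [transpose_mul, J_transpose, Matrix.mul_assoc]
    abel⟩

/-- The element `Z ↦ ⟨e_p, Z⟩ e_q - ⟨e_q, Z⟩ e_p` of `so(4n)`, traced over `H`. -/
def omegaE {n : ℕ} (p q : Fr n) : sp n :=
  ⟨(frameVec q)ᵀ * (frameVec p).map star - (frameVec p)ᵀ * (frameVec q).map star, by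
    have hs : ∀ r : Fr n, ((frameVec r).map star)ᴴ = (frameVec r)ᵀ := by
      intro r; ext; simp
    have hs' : ∀ r : Fr n, ((frameVec r)ᵀ)ᴴ = (frameVec r).map star := by
      intro r; ext; simp
    refine ⟨by rw [conjTranspose_sub, conjTranspose_mul, conjTranspose_mul, hs, hs, hs', hs']; simp,
      ?_⟩
    have : (frameVec q)ᵀ * (frameVec p).map star - (frameVec p)ᵀ * (frameVec q).map star =
        ((frameVec p)ᵀ * J (Fin 1) ℂ * frameVec q - (frameVec q)ᵀ * J (Fin 1) ℂ * frameVec p)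
          * J (Fin n) ℂ := by
      rw [frameVec_real, frameVec_real]
      simp only [Matrix.mul_neg, Matrix.sub_mul, Matrix.mul_assoc]
      abel
    rw [this]
    apply mul_J_skew
    simp [transpose_mul, J_transpose, Matrix.mul_assoc]
    abel⟩

/-- The orthogonal projection to `sp(1) ⊕ sp(n)` of the bivector `e_p ∧ e_q ∈ Λ²ℝ^{4n} = so(4n)`,
which acts by `Z ↦ ⟨e_p, Z⟩ e_q - ⟨e_q, Z⟩ e_p`. The projection of `T ∈ so(4n)` consists of its
partial traces `tr_E T / 2n` and `tr_H T / 2`. -/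
def holProj {n : ℕ} (p q : Fr n) : hol n :=
  ((1 / (2 * n) : ℝ) • omegaH p q, (1 / 2 : ℝ) • omegaE p q)

/-! ## The spinor module and the twist -/

/-- The sign `(-1)^k`, where `k` is the number of elements of `s` before `μ`. -/
def fockSign {n : ℕ} (μ : Idx n) (s : Finset (Idx n)) : ℂ :=
  (-1) ^ (s.filter fun ν => toLex ν < toLex μ).card

section

variable {n : ℕ} {W : Type*} [AddCommGroup W] [Module ℂ W]

/-- Exterior multiplication with the basis vector `e_μ` on `ΛE ⊗ W`, in the basis of `ΛE` given by
the ordered wedge products of basis vectors of `E`, which are indexed by finite sets. -/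
def wedge (μ : Idx n) : (Finset (Idx n) → W) →ₗ[ℂ] (Finset (Idx n) → W) where
  toFun ψ s := if μ ∈ s then fockSign μ s • ψ (s.erase μ) else 0
  map_add' ψ φ := by ext s; by_cases h : μ ∈ s <;> simp [h]
  map_smul' c ψ := by ext s; by_cases h : μ ∈ s <;> simp [h, smul_comm c]

/-- Contraction with the dual basis vector of `e_μ` on `ΛE ⊗ W`. -/
def contract (μ : Idx n) : (Finset (Idx n) → W) →ₗ[ℂ] (Finset (Idx n) → W) where
  toFun ψ s := if μ ∈ s then 0 else fockSign μ s • ψ (insert μ s)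
  map_add' ψ φ := by ext s; by_cases h : μ ∈ s <;> simp [h]
  map_smul' c ψ := by ext s; by_cases h : μ ∈ s <;> simp [h, smul_comm c]

/-- Clifford multiplication with the vector `frameVec p` on `S ⊗ W`, where `S = ΛE` is the complex
spinor module of `ℝ^{4n} ≅ E`: the vector corresponding to `e ∈ E` acts by `e ∧ · - ē ⌟ ·`. -/
def clifford (p : Fr n) : (Finset (Idx n) → W) →ₗ[ℂ] (Finset (Idx n) → W) :=
  unitScalar p.2 • wedge p.1 - conj (unitScalar p.2) • contract p.1

/-- The spin representation of `sp(1) ⊕ sp(n) ⊂ so(4n)` on the first factor of `S ⊗ W`: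
`T ∈ so(4n)` acts by `1/4 ∑ e_p ⋆ (T e_p) ⋆`, so that `X ∧ Y` acts by `1/2 (X ⋆ Y ⋆ + ⟨X, Y⟩)`. -/
def spinAct (X : hol n) : (Finset (Idx n) → W) →ₗ[ℂ] (Finset (Idx n) → W) :=
  (1 / 4 : ℂ) • ∑ p, ∑ q, (coord q (tangentAct X (frameVec p)) : ℂ) • (clifford p ∘ₗ clifford q)

end

/-- Tensors in `H^{⊗l} ⊗ E^{⊗d}`, given by their components. -/
abbrev Tens (n l d : ℕ) : Type := (Fin l → Idx 1) → (Fin d → Idx n) → ℂ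

/-- The twist `Sym^l H ⊗ Λ^d_∘ E`: tensors symmetric in the `H`-indices, skew in the `E`-indices,
and annihilated by the contraction of two `E`-indices with the symplectic form. -/
def twist (n l d : ℕ) : Submodule ℂ (Tens n l d) where
  carrier := {T |
    (∀ (τ : Equiv.Perm (Fin l)) a m, T (a ∘ τ) m = T a m) ∧
    (∀ (τ : Equiv.Perm (Fin d)) a m, T a (m ∘ τ) = ((Equiv.Perm.sign τ : ℤ) : ℂ) * T a m) ∧
    (∀ (r s : Fin d), r ≠ s → ∀ a m, ∑ μ, ∑ ν, J (Fin n) ℂ μ ν *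
      T a (Function.update (Function.update m r μ) s ν) = 0)}
  zero_mem' := by simp
  add_mem' := by
    rintro T U ⟨h1, h2, h3⟩ ⟨k1, k2, k3⟩
    refine ⟨fun τ a m => ?_, fun τ a m => ?_, fun r s hrs a m => ?_⟩
    · simp only [Pi.add_apply, h1, k1]
    · simp only [Pi.add_apply, h2, k2, mul_add]
    · simp only [Pi.add_apply, mul_add, Finset.sum_add_distrib, h3 r s hrs, k3 r s hrs, add_zero]
  smul_mem' := by
    rintro c T ⟨h1, h2, h3⟩
    refine ⟨fun τ a m => ?_, fun τ a m => ?_, fun r s hrs a m => ?_⟩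
    · simp only [Pi.smul_apply, h1]
    · simp only [Pi.smul_apply, h2, smul_eq_mul]; ring
    · simp only [Pi.smul_apply, smul_eq_mul, mul_left_comm _ c, ← Finset.mul_sum, h3 r s hrs,
        mul_zero]

/-- The action of `sp(1) ⊕ sp(n)` on `H^{⊗l} ⊗ E^{⊗d}` by derivations. -/
def tensAct {n l d : ℕ} (X : hol n) : Tens n l d →ₗ[ℂ] Tens n l d where
  toFun T a m :=
    ∑ p, ∑ α, X.1.1 (a p) α * T (Function.update a p α) m +
      ∑ q, ∑ μ, X.2.1 (m q) μ * T a (Function.update m q μ)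
  map_add' T U := by
    ext a m
    simp only [Pi.add_apply, mul_add, Finset.sum_add_distrib]
    ring
  map_smul' c T := by
    ext a m
    simp only [Pi.smul_apply, smul_eq_mul, mul_left_comm _ c, ← Finset.mul_sum, RingHom.id_apply,
      mul_add]

theorem update_comp_perm {κ ι : Type*} [DecidableEq κ] (f : κ → ι) (τ : Equiv.Perm κ) (k : κ)
    (i : ι) : Function.update (f ∘ τ) k i = Function.update f (τ k) i ∘ τ := by
  ext x
  by_cases h : x = k
  · subst h; simp
  · have : τ x ≠ τ k := fun h' => h (τ.injective h')
    simp [Function.update_of_ne, h, this]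

theorem tensAct_mem {n l d : ℕ} (X : hol n) (T : Tens n l d) (hT : T ∈ twist n l d) :
    tensAct X T ∈ twist n l d := by
  obtain ⟨h1, h2, h3⟩ := hT
  refine ⟨fun τ a m => ?_, fun τ a m => ?_, fun r s hrs a m => ?_⟩
  · simp only [tensAct, LinearMap.coe_mk, AddHom.coe_mk, update_comp_perm, h1, Function.comp_apply]
    congr 1
    exact Equiv.sum_comp τ (fun p => ∑ α, X.1.1 (a p) α * T (Function.update a p α) m)
  · simp only [tensAct, LinearMap.coe_mk, AddHom.coe_mk, update_comp_perm, h2, Function.comp_apply,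
      mul_left_comm _ ((Equiv.Perm.sign τ : ℤ) : ℂ), ← Finset.mul_sum, mul_add]
    congr 2
    exact Equiv.sum_comp τ (fun q => ∑ μ, X.2.1 (m q) μ * T a (Function.update m q μ))
  · set U : Idx n → Idx n → Fin d → Idx n := fun μ ν =>
      Function.update (Function.update m r μ) s ν with hU
    have hUr : ∀ μ ν, U μ ν r = μ := fun μ ν => by simp [hU, hrs]
    have hUs : ∀ μ ν, U μ ν s = ν := fun μ ν => by simp [hU]
    have hUq : ∀ μ ν q, q ≠ r → q ≠ s → U μ ν q = m q := fun μ ν q hr hs => by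
      simp [hU, hr, hs]
    have hur : ∀ μ ν κ, Function.update (U μ ν) r κ = U κ ν := fun μ ν κ => by
      simp only [hU]
      rw [Function.update_comm hrs.symm, Function.update_idem]
    have hus : ∀ μ ν κ, Function.update (U μ ν) s κ = U μ κ := fun μ ν κ => by simp [hU]
    have huq : ∀ μ ν q κ, q ≠ r → q ≠ s → Function.update (U μ ν) q κ =
        Function.update (Function.update (Function.update m q κ) r μ) s ν :=
      fun μ ν q κ hr hs => by
        simp only [hU]
        rw [Function.update_comm hs.symm, Function.update_comm hr.symm]
    have hE : ∑ q, ∑ μ, ∑ ν, J (Fin n) ℂ μ ν *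
        ∑ κ, X.2.1 (U μ ν q) κ * T a (Function.update (U μ ν) q κ) = 0 := by
      rw [Fintype.sum_eq_add r s hrs]
      · simp only [hUr, hUs, hur, hus]
        have hJ : ∀ κ ν, ∑ μ, (X.2.1 μ κ * J (Fin n) ℂ μ ν + J (Fin n) ℂ κ μ * X.2.1 μ ν) = 0 := by
          intro κ ν
          have := congrFun (congrFun X.2.2.2 κ) ν
          simpa [Matrix.add_apply, Matrix.mul_apply, Finset.sum_add_distrib] using this
        have e1 : ∑ μ, ∑ ν, J (Fin n) ℂ μ ν * ∑ κ, X.2.1 μ κ * T a (U κ ν) =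
            ∑ κ, ∑ ν, (∑ μ, X.2.1 μ κ * J (Fin n) ℂ μ ν) * T a (U κ ν) := by
          simp only [Finset.mul_sum, Finset.sum_mul]
          rw [Finset.sum_congr rfl (fun μ _ => Finset.sum_comm), Finset.sum_comm]
          refine Finset.sum_congr rfl fun κ _ => ?_
          rw [Finset.sum_comm]
          refine Finset.sum_congr rfl fun ν _ => Finset.sum_congr rfl fun μ _ => ?_
          ring
        have e2 : ∑ μ, ∑ ν, J (Fin n) ℂ μ ν * ∑ κ, X.2.1 ν κ * T a (U μ κ) =
            ∑ κ, ∑ ν, (∑ μ, J (Fin n) ℂ κ μ * X.2.1 μ ν) * T a (U κ ν) := by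
          simp only [Finset.mul_sum, Finset.sum_mul]
          refine Finset.sum_congr rfl fun κ _ => ?_
          rw [Finset.sum_comm]
          refine Finset.sum_congr rfl fun ν _ => Finset.sum_congr rfl fun μ _ => ?_
          ring
        rw [e1, e2, ← Finset.sum_add_distrib]
        refine Finset.sum_eq_zero fun κ _ => ?_
        rw [← Finset.sum_add_distrib]
        refine Finset.sum_eq_zero fun ν _ => ?_
        rw [← add_mul, ← Finset.sum_add_distrib, hJ, zero_mul]
      · rintro q ⟨hqr, hqs⟩
        simp only [hUq _ _ q hqr hqs, huq _ _ q _ hqr hqs]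
        have : ∀ μ ν, J (Fin n) ℂ μ ν * ∑ κ, X.2.1 (m q) κ *
            T a (Function.update (Function.update (Function.update m q κ) r μ) s ν) =
            ∑ κ, X.2.1 (m q) κ * (J (Fin n) ℂ μ ν *
              T a (Function.update (Function.update (Function.update m q κ) r μ) s ν)) := by
          intro μ ν
          rw [Finset.mul_sum]
          refine Finset.sum_congr rfl fun κ _ => ?_
          ring
        simp only [this]
        rw [Finset.sum_congr rfl (fun μ _ => Finset.sum_comm), Finset.sum_comm]
        refine Finset.sum_eq_zero fun κ _ => ?_
        simp only [← Finset.mul_sum, h3 r s hrs, mul_zero]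
    have hH : ∑ μ, ∑ ν, J (Fin n) ℂ μ ν *
        ∑ p, ∑ α, X.1.1 (a p) α * T (Function.update a p α) (U μ ν) = 0 := by
      simp only [Finset.mul_sum, mul_left_comm (J (Fin n) ℂ _ _)]
      rw [Finset.sum_congr rfl (fun μ _ => Finset.sum_comm), Finset.sum_comm]
      refine Finset.sum_eq_zero fun p _ => ?_
      rw [Finset.sum_congr rfl (fun μ _ => Finset.sum_comm), Finset.sum_comm]
      refine Finset.sum_eq_zero fun α _ => ?_
      simp only [← Finset.mul_sum]
      rw [h3 r s hrs, mul_zero]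
    simp only [tensAct, LinearMap.coe_mk, AddHom.coe_mk, mul_add, Finset.sum_add_distrib]
    rw [hH, zero_add]
    simp only [Finset.mul_sum] at hE ⊢
    refine Eq.trans ?_ hE
    conv_rhs => rw [Finset.sum_comm]
    refine Finset.sum_congr rfl fun μ _ => ?_
    rw [Finset.sum_comm]

/-- The representation of `sp(1) ⊕ sp(n)` on the twist `Sym^l H ⊗ Λ^d_∘ E`. -/
def twistAct (n l d : ℕ) (X : hol n) : twist n l d →L[ℂ] twist n l d :=
  LinearMap.toContinuousLinearMap ((tensAct X).restrict (tensAct_mem X))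

/-- The representation space `S ⊗ (Sym^l H ⊗ Λ^d_∘ E)`. -/
abbrev TwSpinor (n l d : ℕ) : Type := Finset (Idx n) → twist n l d

/-- The tensor product representation of `sp(1) ⊕ sp(n)` on `S ⊗ (Sym^l H ⊗ Λ^d_∘ E)`. -/
def twSpinorAct (n l d : ℕ) (X : hol n) : TwSpinor n l d →L[ℂ] TwSpinor n l d :=
  LinearMap.toContinuousLinearMap
    (spinAct X + (twistAct n l d X : twist n l d →ₗ[ℂ] twist n l d).compLeft (Finset (Idx n)))

/-- `act` is a complex representation of the Lie algebra `sp(1) ⊕ sp(n)`. As `Sp(1) × Sp(n)` is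
compact and simply connected, this is the same thing as a complex representation of the group: the
element `exp X` acts by `exp (act X)`. -/
structure IsRep {n : ℕ} {W : Type*} [NormedAddCommGroup W] [NormedSpace ℂ W]
    (act : hol n → W →L[ℂ] W) : Prop where
  map_add : ∀ X Y, act (X + Y) = act X + act Y
  map_smul : ∀ (c : ℝ) X, act (c • X) = (c : ℂ) • act X
  map_lie : ∀ X Y, act (spBracket X.1 Y.1, spBracket X.2 Y.2) =
    act X ∘L act Y - act Y ∘L act X

/-- The endomorphism `q(T) = 1/4 ∑ (e_p ∧ e_q) • T(e_p ∧ e_q) •` of a representation, for an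
`sp(1) ⊕ sp(n)`-valued two-form `T`. For a curvature tensor, which lies in
`Sym² (sp(1) ⊕ sp(n))`, only the projection of `e_p ∧ e_q` to `sp(1) ⊕ sp(n)` contributes. -/
def qCurv {n : ℕ} {W : Type*} [NormedAddCommGroup W] [NormedSpace ℂ W]
    (act : hol n → W →L[ℂ] W) (T : Fr n → Fr n → hol n) : W →L[ℂ] W :=
  (1 / 4 : ℂ) • ∑ p, ∑ q, act (holProj p q) ∘L act (T p q)

/-! ## Quaternionic Kähler manifolds -/

section

variable (n : ℕ) (M : Type*) [TopologicalSpace M] [ChartedSpace (EuclideanSpace ℝ (Fin (4 * n))) M]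
  [IsManifold (𝓡 (4 * n)) ∞ M]

/-- Tangent vector fields on `M`. -/
abbrev VField : Type _ := (x : M) → TangentSpace (𝓡 (4 * n)) x

/-- The directional derivative of a vector valued function. -/
def dirDeriv {n : ℕ} {M : Type*} [TopologicalSpace M]
    [ChartedSpace (EuclideanSpace ℝ (Fin (4 * n))) M]
    {W : Type*} [NormedAddCommGroup W] [NormedSpace ℝ W]
    (f : M → W) (x : M) (v : TangentSpace (𝓡 (4 * n)) x) : W :=
  mfderiv (𝓡 (4 * n)) 𝓘(ℝ, W) f x v

variable [RiemannianBundle (fun x : M => TangentSpace (𝓡 (4 * n)) x)]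

/-- The coefficient `⟨∇_X Y, Z⟩` of the Levi-Civita connection for three vector fields out of an
orthonormal frame, by the Koszul formula. -/
def koszul {n : ℕ} {M : Type*} [TopologicalSpace M]
    [ChartedSpace (EuclideanSpace ℝ (Fin (4 * n))) M]
    [IsManifold (𝓡 (4 * n)) ∞ M] [RiemannianBundle (fun x : M => TangentSpace (𝓡 (4 * n)) x)]
    (X Y Z : VField n M) (x : M) : ℝ :=
  (inner ℝ (VectorField.mlieBracket (𝓡 (4 * n)) X Y x) (Z x)
    - inner ℝ (VectorField.mlieBracket (𝓡 (4 * n)) Y Z x) (X x)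
    + inner ℝ (VectorField.mlieBracket (𝓡 (4 * n)) Z X x) (Y x)) / 2

/-- A quaternionic Kähler structure on the Riemannian manifold `M` of dimension `4n`: a reduction of
the orthonormal frame bundle to a principal `Sp(1)·Sp(n)`-bundle to which the Levi-Civita connection
restricts (i.e. which is stable under parallel transport). It is given by local orthonormal frames
on an open cover which differ by elements of `Sp(1)·Sp(n)` on overlaps, together with the connection
form of the Levi-Civita connection, which takes values in `sp(1) ⊕ sp(n)`. -/
structure QKStructure (ι : Type*) where
  /-- the open cover -/
  U : ι → Set M
  isOpen : ∀ i, IsOpen (U i)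
  cover : ∀ x, ∃ i, x ∈ U i
  /-- the local orthonormal frames -/
  frame : ι → Fr n → VField n M
  smooth : ∀ i p, ContMDiffOn (𝓡 (4 * n)) (𝓡 (4 * n)).tangent ∞
    (fun x => (⟨x, frame i p x⟩ : TangentBundle (𝓡 (4 * n)) M)) (U i)
  orthonormal : ∀ i, ∀ x ∈ U i, ∀ p q, inner ℝ (frame i p x) (frame i q x) = if p = q then 1 else 0
  transition : ∀ i j, ∀ x ∈ U i ∩ U j, ∃ g ∈ compactSp 1, ∃ A ∈ compactSp n, ∀ q,
    frame j q x = ∑ p, coord p (g * frameVec q * Aᵀ) • frame i p x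
  /-- the connection form, evaluated on the frame -/
  conn : ι → Fr n → M → hol n
  leviCivita : ∀ i, ∀ x ∈ U i, ∀ a b c,
    koszul (frame i a) (frame i b) (frame i c) x = coord c (tangentAct (conn i a x) (frameVec b))

end

namespace QKStructure

variable {n : ℕ} {M : Type*} [TopologicalSpace M] [ChartedSpace (EuclideanSpace ℝ (Fin (4 * n))) M]
  [IsManifold (𝓡 (4 * n)) ∞ M] [RiemannianBundle (fun x : M => TangentSpace (𝓡 (4 * n)) x)]
  {ι : Type*} (Q : QKStructure n M ι)
  {W : Type*} [NormedAddCommGroup W] [NormedSpace ℂ W]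

/-! ### Curvature -/

/-- The curvature `R_{X,Y} = [∇_X, ∇_Y] - ∇_{[X,Y]}` of the Levi-Civita connection on the vectors
`X = s_a`, `Y = s_b` of the `i`-th frame, as an element of `sp(1) ⊕ sp(n)`. -/
def curv (i : ι) (x : M) (a b : Fr n) : hol n :=
  dirDeriv (Q.conn i b) x (Q.frame i a x) - dirDeriv (Q.conn i a) x (Q.frame i b x)
    + (spBracket (Q.conn i a x).1 (Q.conn i b x).1, spBracket (Q.conn i a x).2 (Q.conn i b x).2)
    - ∑ c, (inner ℝ (VectorField.mlieBracket (𝓡 (4 * n)) (Q.frame i a) (Q.frame i b) x)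
        (Q.frame i c x) : ℝ) • Q.conn i c x

/-- The scalar curvature `κ = ∑ ⟨R_{s_a, s_b} s_b, s_a⟩`, computed in the `i`-th frame. -/
def scal (i : ι) (x : M) : ℝ :=
  ∑ a, ∑ b, coord a (tangentAct (Q.curv i x a b) (frameVec b))

/-- The hyperkähler part `R^hyper = R + κ / (8n(n+2)) (R^H + R^E)` of the curvature, where
`R^H_{h₁⊗e₁, h₂⊗e₂} = σ(e₁, e₂) h₁h₂ •` and `R^E_{h₁⊗e₁, h₂⊗e₂} = σ(h₁, h₂) e₁e₂ •`; on real vectors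
these are `omegaH` and `omegaE`. -/
def curvHyper (i : ι) (x : M) (a b : Fr n) : hol n :=
  Q.curv i x a b + (Q.scal i x / (8 * n * (n + 2)) : ℝ) • ((omegaH a b, omegaE a b) : hol n)

/-! ### Associated bundles, their sections and parallel homomorphisms -/

/-- `h` is a cocycle of transition functions of a vector bundle associated to the reduced frame
bundle of `M` and to a representation of `Sp(1) × Sp(n)`, given by its differential `act`. If the
representation factors through `Sp(1)·Sp(n)` then `h` exists and is unique; otherwise it exists if
the reduction lifts to `Sp(1) × Sp(n)`. -/
structure IsAssociated (act : hol n → W →L[ℂ] W) (h : ι → ι → M → W →L[ℂ] W) : Prop where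
  smooth : ∀ i j, ContMDiffOn (𝓡 (4 * n)) 𝓘(ℝ, W →L[ℂ] W) ∞ (h i j) (Q.U i ∩ Q.U j)
  cocycle : ∀ i j k, ∀ x ∈ Q.U i ∩ Q.U j ∩ Q.U k, h i j x ∘L h j k x = h i k x
  lift : ∀ i j, ∀ x ∈ Q.U i ∩ Q.U j, ∃ X : hol n,
    (∀ q, Q.frame j q x = ∑ p, coord p (NormedSpace.exp X.1.1 * frameVec q *
      (NormedSpace.exp X.2.1)ᵀ) • Q.frame i p x) ∧ h i j x = NormedSpace.exp (act X)

/-- Smooth sections of the vector bundle with transition functions `h`, in the trivializations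
defined by the local frames. -/
structure IsSection (h : ι → ι → M → W →L[ℂ] W) (ψ : ι → M → W) : Prop where
  smooth : ∀ i, ContMDiffOn (𝓡 (4 * n)) 𝓘(ℝ, W) ∞ (ψ i) (Q.U i)
  compat : ∀ i j, ∀ x ∈ Q.U i ∩ Q.U j, ψ i x = h i j x (ψ j x)

/-- Parallel homomorphisms `F` between the associated bundles with transition functions `h₁` and
`h₂`, in the trivializations defined by the local frames. -/
structure IsParallelHom {W' : Type*} [NormedAddCommGroup W'] [NormedSpace ℂ W']
    (act₁ : hol n → W →L[ℂ] W) (h₁ : ι → ι → M → W →L[ℂ] W)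
    (act₂ : hol n → W' →L[ℂ] W') (h₂ : ι → ι → M → W' →L[ℂ] W')
    (F : ι → M → W →L[ℂ] W') : Prop where
  smooth : ∀ i, ContMDiffOn (𝓡 (4 * n)) 𝓘(ℝ, W →L[ℂ] W') ∞ (F i) (Q.U i)
  compat : ∀ i j, ∀ x ∈ Q.U i ∩ Q.U j, F i x ∘L h₁ i j x = h₂ i j x ∘L F j x
  parallel : ∀ i, ∀ x ∈ Q.U i, ∀ a, dirDeriv (F i) x (Q.frame i a x)
    + act₂ (Q.conn i a x) ∘L F i x - F i x ∘L act₁ (Q.conn i a x) = 0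

/-! ### Differential operators, in the trivialization defined by the `i`-th frame -/

/-- The covariant derivative `∇_{s_a} ψ`. -/
def covDeriv (act : hol n → W →L[ℂ] W) (i : ι) (a : Fr n) (ψ : M → W) (x : M) : W :=
  dirDeriv ψ x (Q.frame i a x) + act (Q.conn i a x) (ψ x)

/-- The operator `∇*∇ ψ = -∑ (∇_{s_a} ∇_{s_a} ψ - ∇_{∇_{s_a} s_a} ψ)`. -/
def roughLaplacian (act : hol n → W →L[ℂ] W) (i : ι) (ψ : M → W) (x : M) : W :=
  -∑ a, (Q.covDeriv act i a (Q.covDeriv act i a ψ) x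
    - ∑ c, koszul (Q.frame i a) (Q.frame i a) (Q.frame i c) x • Q.covDeriv act i c ψ x)

/-- The operator `Δ_π = ∇*∇ + 2 q(R)`. -/
def laplace (act : hol n → W →L[ℂ] W) (i : ι) (ψ : M → W) (x : M) : W :=
  Q.roughLaplacian act i ψ x + (2 : ℂ) • qCurv act (Q.curv i x) (ψ x)

/-- The twisted Dirac operator `D = ∑ s_a ⋆ ∇_{s_a}` on sections of `(S ⊗ Sym^l H ⊗ Λ^d_∘ E)(M)`. -/
def dirac {l d : ℕ} (i : ι) (ψ : M → TwSpinor n l d) (x : M) : TwSpinor n l d :=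
  ∑ a, clifford a (Q.covDeriv (twSpinorAct n l d) i a ψ x)

end QKStructure

end QK

/-!
The proof compares `Δ = ∇*∇ + 2 q(R)` on `π(M)` with `D²` on the twisted spinors, first by moving
`Δ` through the parallel homomorphism `F` and then by computing `Δ - D²` on twisted spinors, where
it turns out to be a scalar function.

*Parallel homomorphisms commute with `Δ`* (`IsParallelHom.laplace_apply`). That `F` commutes with
`∇*∇` is immediate. By the Ricci identity (`secondCovDeriv_sub`), `F` intertwines the actions of the
values `R(e_a ∧ e_b)` of the curvature, although not necessarily of all of
`sp(1) ⊕ sp(n)`. This is enough for `F` to intertwine `q(R) = 1/4 ∑ (e_a ∧ e_b) R(e_a ∧ e_b)`,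
because `R` is symmetric on `sp(1) ⊕ sp(n)` (`IsAlgCurv.sum_bilin_symm`), so that either of the two
factors may be taken to be the one that is a value of `R`.

*The scalar* (`laplace_twSpinorAct`). The Weitzenböck formula (`sum_clifford_covDeriv_sum`) gives
`D² = ∇*∇ + 1/2 ∑ e_a ⋆ e_b ⋆ R(e_a ∧ e_b)`. On `S ⊗ 𝓡`, where `𝓡` is the twist and the action of
the Lie algebra is a sum of two commuting ones, `2 q(R)` has a spin-spin, a mixed and a twist-twist
part. The mixed part is the corresponding part of the Weitzenböck term; the spin-spin part is one
half of it, and both are scalar by the algebraic Lichnerowicz formula (`sum_clifford_curvature`),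
so that they differ by `κ/8`. The twist-twist part is `2 q(R)` on `𝓡`. Together this is
`IsAlgCurv.qCurv_twSpinorAct`.

*The twist.* The tensor `R^hyper = R + κ / (8n(n+2)) (R^H + R^E)` is an algebraic curvature tensor
with vanishing scalar curvature. Contracting the Bianchi identity with the symplectic forms shows
that such a tensor has only a component in `Sym² sp(n)`, which is totally symmetric in four indices
of `E` (`bianchi_decomposition`, `IsAlgCurv.curvPairing_of_scal_eq_zero`); such a component
annihilates skew tensors (`IsAlgCurv.sum_tensAct_holProj_eq_zero`), and so `q(R^hyper) = 0` on
`𝓡`. What is left of `R` is a multiple of `R^H + R^E`, which acts by the Casimir operator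
(`sum_tensAct_holProj_omega`), with eigenvalue a multiple of `l(l+2) + d(2n+2-d)`. Finally
`l(l+2) + d(2n+2-d) - n(n+2) = (l+d-n)(l-d+n+2)`.

Independence of the embedding follows, since for injective `F` the equation `D²(Fψ) = Fχ` is
equivalent to an equation between `Δψ`, `ψ` and `χ` that does not involve `F`.
-/

namespace QK

/-! ### The frame of `H ⊗ E` and the Lie algebra `sp(1) ⊕ sp(n)` -/

section
variable {n : ℕ}

theorem sum_J_mul_J (a b : Idx n) :
    ∑ x, J (Fin n) ℂ a x * J (Fin n) ℂ b x = if a = b then 1 else 0 := by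
  have h := congrFun (congrFun (J_squared (Fin n) ℂ) a) b
  have h' : ∀ x, J (Fin n) ℂ b x = - J (Fin n) ℂ x b := fun x => by
    have := congrFun (congrFun (J_transpose (Fin n) ℂ) x) b
    simpa using this
  simp only [h', mul_neg, Finset.sum_neg_distrib]
  rw [Matrix.mul_apply] at h
  rw [h]
  simp [Matrix.one_apply]

theorem J_swap (a b : Idx n) : J (Fin n) ℂ a b = - J (Fin n) ℂ b a := by
  have := congrFun (congrFun (J_transpose (Fin n) ℂ) b) a
  simpa using this

theorem sum_J_mul_J' (a b : Idx n) :
    ∑ x, J (Fin n) ℂ x a * J (Fin n) ℂ x b = if a = b then 1 else 0 := by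
  rw [← sum_J_mul_J a b]
  exact Finset.sum_congr rfl fun x _ => by rw [J_swap a x, J_swap b x]; ring

theorem conj_J (a b : Idx n) : conj (J (Fin n) ℂ a b) = J (Fin n) ℂ a b := by
  obtain a | a := a <;> obtain b | b := b <;>
    simp [J, Matrix.fromBlocks, Matrix.one_apply, apply_ite]

/-- The frame vectors form a unitary basis of `H ⊗ E`. -/
theorem sum_frameVec_mul_conj (α β : Idx 1) (μ ν : Idx n) :
    ∑ p, frameVec p α μ * conj (frameVec p β ν) = if α = β ∧ μ = ν then 1 else 0 := by
  have h2 : ((Real.sqrt 2 : ℝ) : ℂ)⁻¹ * ((Real.sqrt 2 : ℝ) : ℂ)⁻¹ = 1 / 2 := by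
    rw [← mul_inv, ← Complex.ofReal_mul, Real.mul_self_sqrt (by norm_num)]; norm_num
  have hI := Complex.I_mul_I
  have e1 : ∀ x, (if μ = x then (1 : ℂ) else 0) * (if ν = x then 1 else 0) =
      if x = μ then (if μ = ν then 1 else 0) else 0 := fun x => by
    by_cases h : x = μ
    · subst h; simp [eq_comm]
    · simp [h, Ne.symm h]
  rw [Fintype.sum_prod_type]
  simp only [Fin.sum_univ_two]
  obtain α | α := α <;> obtain β | β := β <;> fin_cases α <;> fin_cases β
  · trans ∑ x, (if μ = x then (1 : ℂ) else 0) * (if ν = x then 1 else 0)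
    · refine Finset.sum_congr rfl fun x _ => ?_
      by_cases h : μ = x <;> by_cases h' : ν = x <;> simp [frameVec, unitScalar, h, h']
      linear_combination (1 - Complex.I * Complex.I) * h2 - (1 / 2) * hI
    · simp [e1]
  · simp only [reduceCtorEq, false_and, if_false]
    refine Finset.sum_eq_zero fun x _ => ?_
    by_cases h : μ = x <;> simp [frameVec, unitScalar, h, conj_J]
    linear_combination (((Real.sqrt 2 : ℝ) : ℂ)⁻¹ * ((Real.sqrt 2 : ℝ) : ℂ)⁻¹ *
      J (Fin n) ℂ ν x) * hI
  · simp only [reduceCtorEq, false_and, if_false]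
    refine Finset.sum_eq_zero fun x _ => ?_
    by_cases h : ν = x <;> simp [frameVec, unitScalar, h]
    linear_combination (((Real.sqrt 2 : ℝ) : ℂ)⁻¹ * ((Real.sqrt 2 : ℝ) : ℂ)⁻¹ *
      J (Fin n) ℂ μ x) * hI
  · simp only [true_and]
    rw [← sum_J_mul_J μ ν]
    refine Finset.sum_congr rfl fun x _ => ?_
    simp [frameVec, unitScalar, conj_J]
    linear_combination (1 - Complex.I * Complex.I) * J (Fin n) ℂ μ x * J (Fin n) ℂ ν x * h2 -
      (1 / 2) * J (Fin n) ℂ μ x * J (Fin n) ℂ ν x * hI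

theorem conj_frameVec (p : Fr n) (α : Idx 1) (μ : Idx n) :
    conj (frameVec p α μ) =
      -∑ β, ∑ ν, J (Fin 1) ℂ α β * frameVec p β ν * J (Fin n) ℂ ν μ := by
  have h := congrFun (congrFun (frameVec_real p) α) μ
  simp only [Matrix.map_apply, Matrix.neg_apply, Matrix.mul_apply, Finset.sum_mul] at h
  rw [Finset.sum_comm] at h
  exact h

/-- The frame vectors are fixed by the real structure of `H ⊗ E`. -/
theorem frameVec_eq_conj (p : Fr n) (α : Idx 1) (μ : Idx n) :
    frameVec p α μ =
      -∑ β, ∑ ν, J (Fin 1) ℂ α β * conj (frameVec p β ν) * J (Fin n) ℂ ν μ := by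
  have h := congrArg conj (conj_frameVec p α μ)
  simpa [map_sum, conj_J] using h

/-- The inverse metric `∑ e_p ⊗ e_p` is `σ ⊗ σ` in complex indices. -/
theorem sum_frameVec_mul (α β : Idx 1) (μ ν : Idx n) :
    ∑ p, frameVec p α μ * frameVec p β ν = J (Fin 1) ℂ α β * J (Fin n) ℂ μ ν := by
  have h : ∀ p, frameVec p α μ * frameVec p β ν = -∑ γ, ∑ κ, J (Fin 1) ℂ β γ * J (Fin n) ℂ κ ν *
      (frameVec p α μ * conj (frameVec p γ κ)) := fun p => by
    rw [frameVec_eq_conj p β ν, mul_neg, Finset.mul_sum]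
    simp only [Finset.mul_sum]
    congr 1
    exact Finset.sum_congr rfl fun γ _ => Finset.sum_congr rfl fun κ _ => by ring
  simp only [h, Finset.sum_neg_distrib]
  rw [Finset.sum_comm]
  rw [Finset.sum_congr rfl (fun γ _ => Finset.sum_comm)]
  simp only [← Finset.mul_sum, sum_frameVec_mul_conj, ite_and, mul_ite, mul_one, mul_zero]
  simp [Finset.sum_ite_eq, J_swap α β]

/-- Elements of `H ⊗ E` fixed by the real structure. -/
def IsRealTensor (Z : Matrix (Idx 1) (Idx n) ℂ) : Prop :=
  Z.map star = -(J (Fin 1) ℂ * Z * J (Fin n) ℂ)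

theorem isRealTensor_frameVec (p : Fr n) : IsRealTensor (frameVec p) := frameVec_real p

theorem IsRealTensor.coord_eq {Z : Matrix (Idx 1) (Idx n) ℂ} (hZ : IsRealTensor Z) (p : Fr n) :
    (coord p Z : ℂ) = ∑ α, ∑ ν, Z α ν * conj (frameVec p α ν) := by
  refine Complex.conj_eq_iff_re.1 ?_
  have h2 : ∀ W : Matrix (Idx 1) (Idx n) ℂ, ∑ α, ∑ ν, W α ν * conj (frameVec p α ν) =
      (W * (frameVec p)ᴴ).trace := fun W => by
    simp [Matrix.trace, Matrix.mul_apply]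
  rw [h2, starRingEnd_apply, ← Matrix.trace_conjTranspose, conjTranspose_mul,
    conjTranspose_conjTranspose]
  have h4 : Zᴴ = -(J (Fin n) ℂ * Zᵀ * J (Fin 1) ℂ) := by
    have : (Z.map star)ᵀ = Zᴴ := rfl
    rw [← this, show Z.map star = _ from hZ]
    simp [Matrix.mul_assoc, J_transpose]
  have h5 : ((frameVec p).map star)ᵀ = (frameVec p)ᴴ := rfl
  have h6 : (frameVec p)ᴴ = -(J (Fin n) ℂ * (frameVec p)ᵀ * J (Fin 1) ℂ) := by
    rw [← h5, frameVec_real]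
    simp [Matrix.mul_assoc, J_transpose]
  have h7 : (Z * (frameVec p)ᴴ).trace = (Z * (frameVec p)ᴴ)ᵀ.trace := (trace_transpose _).symm
  rw [h4, h7, h6]
  simp only [transpose_mul, transpose_neg, J_transpose, transpose_transpose, Matrix.mul_neg,
    Matrix.neg_mul, trace_neg, neg_neg, Matrix.mul_assoc]
  rw [← Matrix.mul_assoc, ← Matrix.mul_assoc, Matrix.trace_mul_comm]
  simp only [Matrix.mul_assoc]

theorem eq_sum_frameVec (Z : Matrix (Idx 1) (Idx n) ℂ) :
    Z = ∑ p, (∑ α, ∑ ν, Z α ν * conj (frameVec p α ν)) • frameVec p := by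
  ext β μ
  simp only [Matrix.sum_apply, Matrix.smul_apply, smul_eq_mul, Finset.sum_mul]
  rw [Finset.sum_comm, Finset.sum_congr rfl (fun _ _ => Finset.sum_comm)]
  have : ∀ α ν p, Z α ν * conj (frameVec p α ν) * frameVec p β μ =
      Z α ν * (frameVec p β μ * conj (frameVec p α ν)) := fun α ν p => by ring
  simp only [this, ← Finset.mul_sum, sum_frameVec_mul_conj]
  simp only [ite_and, mul_ite, mul_one, mul_zero]
  simp

theorem IsRealTensor.eq_sum_coord {Z : Matrix (Idx 1) (Idx n) ℂ} (hZ : IsRealTensor Z) :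
    Z = ∑ p, (coord p Z : ℂ) • frameVec p := by
  simp only [hZ.coord_eq]
  exact eq_sum_frameVec Z

theorem sp_conj {m : ℕ} (X : sp m) : X.1.map star = -(J (Fin m) ℂ * X.1 * J (Fin m) ℂ) := by
  have h1 : X.1ᴴ = -X.1 := X.2.1
  have h2 : X.1ᵀ * J (Fin m) ℂ = -(J (Fin m) ℂ * X.1) := eq_neg_of_add_eq_zero_left X.2.2
  have h3 : X.1.map star = -X.1ᵀ := by
    rw [← transpose_neg, ← h1]; rfl
  have h4 : X.1ᵀ * (J (Fin m) ℂ * J (Fin m) ℂ) = -X.1ᵀ := by rw [J_squared]; simp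
  rw [h3, ← h4, ← Matrix.mul_assoc, h2]
  simp

theorem isRealTensor_tangentAct (X : hol n) {Z : Matrix (Idx 1) (Idx n) ℂ} (hZ : IsRealTensor Z) :
    IsRealTensor (tangentAct X Z) := by
  have hJ : ∀ (m : ℕ), J (Fin m) ℂ * J (Fin m) ℂ = -1 := fun m => J_squared (Fin m) ℂ
  have e : (tangentAct X Z).map star = X.1.1.map star * Z.map star +
      Z.map star * (X.2.1.map star)ᵀ := by
    ext α μ
    simp [tangentAct, Matrix.mul_apply]
  rw [IsRealTensor, e, sp_conj, sp_conj, hZ, tangentAct]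
  have e1 : J (Fin 1) ℂ * X.1.1 * J (Fin 1) ℂ * (J (Fin 1) ℂ * Z * J (Fin n) ℂ) =
      -(J (Fin 1) ℂ * X.1.1 * Z * J (Fin n) ℂ) := by
    have : J (Fin 1) ℂ * X.1.1 * J (Fin 1) ℂ * (J (Fin 1) ℂ * Z * J (Fin n) ℂ) =
      J (Fin 1) ℂ * X.1.1 * (J (Fin 1) ℂ * J (Fin 1) ℂ) * Z * J (Fin n) ℂ := by
      simp only [Matrix.mul_assoc]
    rw [this, hJ]; simp
  have e2 : J (Fin 1) ℂ * Z * J (Fin n) ℂ * (J (Fin n) ℂ * X.2.1 * J (Fin n) ℂ)ᵀ =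
      -(J (Fin 1) ℂ * Z * (X.2.1)ᵀ * J (Fin n) ℂ) := by
    have : J (Fin 1) ℂ * Z * J (Fin n) ℂ * (J (Fin n) ℂ * X.2.1 * J (Fin n) ℂ)ᵀ =
      J (Fin 1) ℂ * Z * (J (Fin n) ℂ * J (Fin n) ℂ) * (X.2.1)ᵀ * J (Fin n) ℂ := by
      simp [Matrix.mul_assoc, J_transpose]
    rw [this, hJ]; simp
  simp only [transpose_neg, Matrix.neg_mul, Matrix.mul_neg, neg_neg, e1, e2]
  simp only [Matrix.mul_add, Matrix.add_mul, ← Matrix.mul_assoc]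
  abel

/-- The action of `sp(1) ⊕ sp(n)` on the tangent representation is skew. -/
theorem coord_tangentAct_skew (X : hol n) (p q : Fr n) :
    coord q (tangentAct X (frameVec p)) = -coord p (tangentAct X (frameVec q)) := by
  have h2 : ∀ (W : Matrix (Idx 1) (Idx n) ℂ) (p), coord p W = (W * (frameVec p)ᴴ).trace.re :=
    fun W p => by simp [coord, Matrix.trace, Matrix.mul_apply]
  have hA : X.1.1ᴴ = -X.1.1 := X.1.2.1
  have hB : (X.2.1ᵀ)ᴴ = -X.2.1ᵀ := by
    have : X.2.1ᴴ = -X.2.1 := X.2.2.1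
    rw [← transpose_neg, ← this]; rfl
  rw [h2, h2, ← Complex.conj_re, starRingEnd_apply, ← Matrix.trace_conjTranspose, ← Complex.neg_re,
    ← trace_neg]
  congr 1
  simp only [tangentAct, conjTranspose_mul, conjTranspose_add, conjTranspose_conjTranspose, hA, hB]
  simp only [Matrix.mul_add, Matrix.add_mul, trace_add, Matrix.mul_neg, Matrix.neg_mul, trace_neg,
    neg_add]
  rw [Matrix.mul_assoc, Matrix.trace_mul_comm X.1.1]
  simp only [Matrix.mul_assoc]

theorem tangentAct_frameVec (X : hol n) (p : Fr n) :
    tangentAct X (frameVec p) = ∑ q, (coord q (tangentAct X (frameVec p)) : ℂ) • frameVec q :=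
  (isRealTensor_tangentAct X (isRealTensor_frameVec p)).eq_sum_coord

theorem trace_sp {m : ℕ} (X : sp m) : X.1.trace = 0 := by
  have h2 : X.1ᵀ * J (Fin m) ℂ = -(J (Fin m) ℂ * X.1) := eq_neg_of_add_eq_zero_left X.2.2
  have h : X.1ᵀ = J (Fin m) ℂ * X.1 * J (Fin m) ℂ := by
    have h4 : X.1ᵀ * (J (Fin m) ℂ * J (Fin m) ℂ) = -X.1ᵀ := by rw [J_squared]; simp
    rw [← Matrix.mul_assoc, h2] at h4
    simpa using h4.symm
  have h3 : X.1.trace = -X.1.trace := by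
    conv_lhs => rw [← trace_transpose, h, Matrix.mul_assoc, Matrix.trace_mul_comm, Matrix.mul_assoc,
      J_squared]
    simp
  exact self_eq_neg.1 h3

/-- The symmetric matrix `X J` representing an element of `sp(m)` in `Sym² ℂ^{2m}`. -/
def spSym {m : ℕ} (X : sp m) (a b : Idx m) : ℂ := (X.1 * J (Fin m) ℂ) a b

theorem spSym_comm {m : ℕ} (X : sp m) (a b : Idx m) : spSym X a b = spSym X b a := by
  have h2 : X.1ᵀ * J (Fin m) ℂ = -(J (Fin m) ℂ * X.1) := eq_neg_of_add_eq_zero_left X.2.2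
  have : (X.1 * J (Fin m) ℂ)ᵀ = X.1 * J (Fin m) ℂ := by
    have h4 : J (Fin m) ℂ * (X.1ᵀ * J (Fin m) ℂ) = X.1 := by
      rw [h2, Matrix.mul_neg, ← Matrix.mul_assoc, J_squared]; simp
    rw [transpose_mul, J_transpose]
    conv_rhs => rw [← h4, Matrix.mul_assoc, Matrix.mul_assoc, J_squared]
    simp
  exact congrFun (congrFun this b) a

theorem sp_apply_eq_sum_spSym {m : ℕ} (X : sp m) (a b : Idx m) :
    X.1 a b = -∑ c, spSym X a c * J (Fin m) ℂ c b := by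
  have : X.1 = -(X.1 * J (Fin m) ℂ * J (Fin m) ℂ) := by
    rw [Matrix.mul_assoc, J_squared]; simp
  conv_lhs => rw [this]
  rfl

/-- Completeness of the frame, contracted with a matrix in the middle. -/
theorem sum_frameVec_mul_mul_conjTranspose (Y : Matrix (Idx n) (Idx n) ℂ) :
    ∑ p : Fr n, frameVec p * Y * (frameVec p)ᴴ = Y.trace • (1 : Matrix (Idx 1) (Idx 1) ℂ) := by
  ext α β
  have : ∀ p (μ ν : Idx n), frameVec p α μ * Y μ ν * conj (frameVec p β ν) =
      Y μ ν * (frameVec p α μ * conj (frameVec p β ν)) := fun _ _ _ => by ring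
  simp only [Matrix.sum_apply, Matrix.mul_apply, conjTranspose_apply, Finset.sum_mul,
    ← starRingEnd_apply, this]
  rw [Finset.sum_comm, Finset.sum_congr rfl (fun _ _ => Finset.sum_comm)]
  simp only [← Finset.mul_sum, sum_frameVec_mul_conj, Matrix.smul_apply, Matrix.one_apply,
    smul_eq_mul, Matrix.trace, Matrix.diag, ite_and]
  by_cases h : α = β <;> simp [h]

theorem sum_transpose_frameVec_mul_mul_conj (Y : Matrix (Idx 1) (Idx 1) ℂ) :
    ∑ p : Fr n, (frameVec p)ᵀ * Y * ((frameVec p).map star) =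
      Y.trace • (1 : Matrix (Idx n) (Idx n) ℂ) := by
  ext μ ν
  have : ∀ p (α β : Idx 1), frameVec p α μ * Y α β * conj (frameVec p β ν) =
      Y α β * (frameVec p α μ * conj (frameVec p β ν)) := fun _ _ _ => by ring
  simp only [Matrix.sum_apply, Matrix.mul_apply, transpose_apply, Matrix.map_apply, Finset.sum_mul,
    ← starRingEnd_apply, this]
  rw [Finset.sum_comm, Finset.sum_congr rfl (fun _ _ => Finset.sum_comm)]
  simp only [← Finset.mul_sum, sum_frameVec_mul_conj, Matrix.smul_apply, Matrix.one_apply,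
    smul_eq_mul, Matrix.trace, Matrix.diag, ite_and]
  by_cases h : μ = ν <;> simp [h]

/-- The `sp(1)`-component of an element of `sp(1) ⊕ sp(n)`, as a matrix. -/
def matH (n : ℕ) : hol n →ₗ[ℝ] Matrix (Idx 1) (Idx 1) ℂ where
  toFun X := X.1.1
  map_add' _ _ := rfl
  map_smul' _ _ := rfl

/-- The `sp(n)`-component of an element of `sp(1) ⊕ sp(n)`, as a matrix. -/
def matE (n : ℕ) : hol n →ₗ[ℝ] Matrix (Idx n) (Idx n) ℂ where
  toFun X := X.2.1
  map_add' _ _ := rfl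
  map_smul' _ _ := rfl

theorem matH_apply (X : hol n) : matH n X = X.1.1 := rfl

theorem matE_apply (X : hol n) : matE n X = X.2.1 := rfl

theorem sp_coe_smul {m : ℕ} (c : ℝ) (X : sp m) : (c • X).1 = c • X.1 := rfl

/-- An element of `sp(1) ⊕ sp(n)`, viewed in `so(4n)`, is its own projection. For `n = 0` this
fails, as `sp(1)` then acts trivially on the tangent representation. -/
theorem eq_sum_coord_smul_holProj (hn : n ≠ 0) (X : hol n) :
    X = (1 / 2 : ℝ) • ∑ p, ∑ q, coord q (tangentAct X (frameVec p)) • holProj p q := by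
  have hskew : ∀ {A : Type} [AddCommGroup A] [Module ℂ A] (f : Fr n → Fr n → A),
      ∑ p, ∑ q, (coord q (tangentAct X (frameVec p)) : ℂ) • (f q p - f p q) =
      (2 : ℂ) • ∑ p, ∑ q, (coord q (tangentAct X (frameVec p)) : ℂ) • f q p := by
    intro A _ _ f
    simp only [smul_sub, Finset.sum_sub_distrib, two_smul]
    rw [sub_eq_add_neg]
    congr 1
    rw [Finset.sum_comm, ← Finset.sum_neg_distrib]
    refine Finset.sum_congr rfl fun p _ => ?_
    rw [← Finset.sum_neg_distrib]
    refine Finset.sum_congr rfl fun q _ => ?_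
    rw [coord_tangentAct_skew]
    simp
  have hn' : (n : ℂ) ≠ 0 := Nat.cast_ne_zero.2 hn
  have htr1 : (1 : Matrix (Idx n) (Idx n) ℂ).trace = 2 * n := by
    simp [Matrix.trace_one]; ring
  have htr2 : (1 : Matrix (Idx 1) (Idx 1) ℂ).trace = 2 := by
    simp [Matrix.trace_one]
  refine Prod.ext (Subtype.ext ?_) (Subtype.ext ?_)
  · have e1 : ((((1 / 2 : ℝ) • ∑ p, ∑ q, coord q (tangentAct X (frameVec p)) • holProj p q) :
        hol n).1 : Matrix (Idx 1) (Idx 1) ℂ) = (1 / 2 : ℂ) • (1 / (2 * n) : ℂ) •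
          ∑ p, ∑ q, (coord q (tangentAct X (frameVec p)) : ℂ) •
          (frameVec q * (frameVec p)ᴴ - frameVec p * (frameVec q)ᴴ) := by
      change matH n ((1 / 2 : ℝ) • ∑ p, ∑ q, coord q (tangentAct X (frameVec p)) • holProj p q) = _
      simp only [map_sum, map_smul]
      simp only [← Complex.coe_smul, Finset.smul_sum, holProj, matH_apply]
      refine Finset.sum_congr rfl fun p _ => Finset.sum_congr rfl fun q _ => ?_
      rw [sp_coe_smul, omegaH]
      simp only [← Complex.coe_smul, smul_smul]
      congr 1
      push_cast
      ring
    rw [e1, hskew (fun q p => frameVec q * (frameVec p)ᴴ)]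
    simp only [← Matrix.smul_mul, ← Matrix.sum_mul, ← tangentAct_frameVec]
    have e2 := sum_frameVec_mul_mul_conjTranspose (1 : Matrix (Idx n) (Idx n) ℂ)
    have e3 := sum_frameVec_mul_mul_conjTranspose (X.2.1)ᵀ
    simp only [tangentAct, Matrix.add_mul, Finset.sum_add_distrib, e3, trace_transpose, trace_sp]
    simp only [Matrix.mul_one] at e2
    simp only [Matrix.mul_assoc, ← Matrix.mul_sum, e2, htr1]
    simp [smul_smul]
    field_simp
    simp
  · have e1 : ((((1 / 2 : ℝ) • ∑ p, ∑ q, coord q (tangentAct X (frameVec p)) • holProj p q) :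
        hol n).2 : Matrix (Idx n) (Idx n) ℂ) = (1 / 2 : ℂ) • (1 / 2 : ℂ) •
          ∑ p, ∑ q, (coord q (tangentAct X (frameVec p)) : ℂ) •
          ((frameVec q)ᵀ * (frameVec p).map star - (frameVec p)ᵀ * (frameVec q).map star) := by
      change matE n ((1 / 2 : ℝ) • ∑ p, ∑ q, coord q (tangentAct X (frameVec p)) • holProj p q) = _
      simp only [map_sum, map_smul]
      simp only [← Complex.coe_smul, Finset.smul_sum, holProj, matE_apply]
      refine Finset.sum_congr rfl fun p _ => Finset.sum_congr rfl fun q _ => ?_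
      rw [sp_coe_smul, omegaE]
      simp only [← Complex.coe_smul, smul_smul]
      congr 1
      push_cast
      ring
    rw [e1, hskew (fun q p => (frameVec q)ᵀ * (frameVec p).map star)]
    have e0 : ∀ p, ∑ q, (coord q (tangentAct X (frameVec p)) : ℂ) • (frameVec q)ᵀ =
        (tangentAct X (frameVec p))ᵀ := fun p => by
      conv_rhs => rw [tangentAct_frameVec]
      simp [Matrix.transpose_sum]
    simp only [← Matrix.smul_mul, ← Matrix.sum_mul, e0]
    have e2 := sum_transpose_frameVec_mul_mul_conj (n := n) (1 : Matrix (Idx 1) (Idx 1) ℂ)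
    have e3 := sum_transpose_frameVec_mul_mul_conj (n := n) (X.1.1)ᵀ
    simp only [tangentAct, transpose_add, transpose_mul, Matrix.add_mul, Finset.sum_add_distrib, e3,
      trace_transpose, trace_sp]
    simp only [Matrix.mul_one] at e2
    simp only [Matrix.mul_assoc, transpose_transpose, ← Matrix.mul_sum, e2, htr2]
    simp [smul_smul]
end

/-! ### Algebraic curvature tensors -/

section
variable {n : ℕ}

theorem sum_pair_comm {ι₁ ι₂ κ₁ κ₂ V : Type*} [Fintype ι₁] [Fintype ι₂] [Fintype κ₁] [Fintype κ₂]
    [AddCommMonoid V] (f : ι₁ → ι₂ → κ₁ → κ₂ → V) :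
    ∑ p, ∑ q, ∑ r, ∑ s, f p q r s = ∑ r, ∑ s, ∑ p, ∑ q, f p q r s := by
  rw [Finset.sum_congr rfl (fun p _ => Finset.sum_comm), Finset.sum_comm]
  refine Finset.sum_congr rfl fun r _ => ?_
  rw [Finset.sum_congr rfl (fun p _ => Finset.sum_comm), Finset.sum_comm]

theorem sum_rotate {ι V : Type*} [Fintype ι] [AddCommMonoid V] (f : ι → ι → ι → V) :
    ∑ p, ∑ q, ∑ r, f p q r = ∑ p, ∑ q, ∑ r, f q r p := by
  rw [Finset.sum_comm]
  conv_rhs => rw [Finset.sum_congr rfl (fun p _ => Finset.sum_comm)]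
  rw [Finset.sum_congr rfl (fun p _ => Finset.sum_comm), Finset.sum_comm]

/-- The matrix coefficient `⟨X e_p, e_q⟩` of the action of `sp(1) ⊕ sp(n)` on the tangent
representation, as a linear function of `X`. -/
def tangentCoeff (p q : Fr n) : hol n →ₗ[ℝ] ℝ where
  toFun X := coord q (tangentAct X (frameVec p))
  map_add' X Y := by
    have : tangentAct (X + Y) (frameVec p) =
        tangentAct X (frameVec p) + tangentAct Y (frameVec p) := by
      simp only [tangentAct]
      have e1 : (X + Y).1.1 = X.1.1 + Y.1.1 := rfl
      have e2 : (X + Y).2.1 = X.2.1 + Y.2.1 := rfl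
      rw [e1, e2, transpose_add, Matrix.add_mul, Matrix.mul_add]
      abel
    rw [this]
    simp [coord, add_mul, Finset.sum_add_distrib]
  map_smul' c X := by
    have : tangentAct (c • X) (frameVec p) = (c : ℂ) • tangentAct X (frameVec p) := by
      simp only [tangentAct]
      have e1 : (c • X).1.1 = c • X.1.1 := rfl
      have e2 : (c • X).2.1 = c • X.2.1 := rfl
      rw [e1, e2, ← Complex.coe_smul, ← Complex.coe_smul]
      simp [transpose_smul]
    rw [this]
    simp [coord, mul_assoc, ← Finset.mul_sum]

theorem tangentCoeff_apply (p q : Fr n) (X : hol n) :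
    tangentCoeff p q X = coord q (tangentAct X (frameVec p)) := rfl

theorem tangentCoeff_skew (X : hol n) (p q : Fr n) : tangentCoeff p q X = -tangentCoeff q p X :=
  coord_tangentAct_skew X p q

/-- Algebraic curvature tensors with values in `sp(1) ⊕ sp(n)`: two-forms on `ℝ^{4n}` satisfying the
first Bianchi identity, with `tangentCoeff c d (R a b) = ⟨R(e_a, e_b) e_c, e_d⟩`. -/
structure IsAlgCurv (R : Fr n → Fr n → hol n) : Prop where
  skew : ∀ a b, R b a = -R a b
  bianchi : ∀ a b c d, tangentCoeff c d (R a b) + tangentCoeff a d (R b c) +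
    tangentCoeff b d (R c a) = 0

namespace IsAlgCurv
variable {R : Fr n → Fr n → hol n}

theorem coeff_skew (hR : IsAlgCurv R) (a b c d : Fr n) :
    tangentCoeff c d (R a b) = -tangentCoeff c d (R b a) := by
  rw [hR.skew b a, map_neg]

/-- The pair symmetry of a curvature tensor, from the Bianchi identity. -/
theorem pair_symm (hR : IsAlgCurv R) (a b c d : Fr n) :
    tangentCoeff c d (R a b) = tangentCoeff a b (R c d) := by
  have h1 := hR.bianchi a b c d
  have h2 := hR.bianchi b c d a
  have h3 := hR.bianchi c d a b
  have h4 := hR.bianchi d a b c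
  have s := fun a b c d => hR.coeff_skew a b c d
  have t := fun a b c d => tangentCoeff_skew (R a b) c d
  linarith [s a b c d, s b c a d, s c a b d, s c d b a, s d b c a, s d a c b, s a c d b, s b d a c,
    t a b c d, t b c a d, t c a b d, t c d a b, t b d c a, t d a b c, t a c d b, t a c b d,
    t a b d c, t b c d a, t c d b a, t d a c b, t b d a c]

variable {V V₁ : Type*} [AddCommGroup V] [Module ℝ V] [AddCommGroup V₁] [Module ℝ V₁]

/-- As `R` is symmetric, evaluating `R` on bivectors and projecting bivectors to `sp(1) ⊕ sp(n)` can
be exchanged: `∑ B(f_pq, R_pq) = ∑ B(f(R_rs), pr(e_r ∧ e_s))`, where `f` is extended linearly from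
bivectors to `so(4n)` and then restricted to the values of `R`. -/
theorem sum_bilin (hR : IsAlgCurv R) (hn : n ≠ 0) (B : V₁ →ₗ[ℝ] hol n →ₗ[ℝ] V)
    (f : Fr n → Fr n → V₁) :
    ∑ p, ∑ q, B (f p q) (R p q) =
      ∑ r, ∑ s, B ((1 / 2 : ℝ) • ∑ p, ∑ q, tangentCoeff p q (R r s) • f p q) (holProj r s) := by
  have e : ∀ p q, B (f p q) (R p q) =
      ∑ r, ∑ s, ((1 / 2 : ℝ) * tangentCoeff r s (R p q)) • B (f p q) (holProj r s) := fun p q => by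
    conv_lhs => rw [eq_sum_coord_smul_holProj hn (R p q)]
    simp only [map_smul, map_sum, Finset.smul_sum, smul_smul, tangentCoeff_apply]
  simp only [e]
  have e' : ∀ r s, B ((1 / 2 : ℝ) • ∑ p, ∑ q, tangentCoeff p q (R r s) • f p q) (holProj r s) =
      ∑ p, ∑ q, ((1 / 2 : ℝ) * tangentCoeff r s (R p q)) • B (f p q) (holProj r s) := fun r s => by
    simp only [map_smul, map_sum, Finset.smul_sum, smul_smul, LinearMap.sum_apply,
      LinearMap.smul_apply, hR.pair_symm r s]
  simp only [e']
  exact sum_pair_comm _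

/-- A curvature tensor lies in `Sym² (sp(1) ⊕ sp(n))`. -/
theorem sum_bilin_symm (hR : IsAlgCurv R) (hn : n ≠ 0) (B : hol n →ₗ[ℝ] hol n →ₗ[ℝ] V) :
    ∑ p, ∑ q, B (holProj p q) (R p q) = ∑ p, ∑ q, B (R p q) (holProj p q) := by
  rw [hR.sum_bilin hn]
  refine Finset.sum_congr rfl fun p _ => Finset.sum_congr rfl fun q _ => ?_
  congr 2
  exact (eq_sum_coord_smul_holProj hn (R p q)).symm

end IsAlgCurv

/-- The algebraic part of the Lichnerowicz formula: by the first Bianchi identity, the Clifford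
product of a curvature tensor is a multiple of its scalar curvature. -/
theorem sum_clifford_curvature {ι A : Type*} [Fintype ι] [DecidableEq ι] [Ring A] [Algebra ℝ A]
    (c : ι → A) (hc : ∀ p q, c p * c q + c q * c p = (if p = q then (-2 : ℝ) else 0) • (1 : A))
    (T : ι → ι → ι → ι → ℝ) (h1 : ∀ a b c d, T b a c d = -T a b c d)
    (h2 : ∀ a b c d, T a b c d = T c d a b)
    (h3 : ∀ a b c d, T a b c d + T b c a d + T c a b d = 0) :
    ∑ p, ∑ q, ∑ r, ∑ s, T p q r s • (c p * c q * (c r * c s)) =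
      (2 * ∑ a, ∑ b, T a b b a) • (1 : A) := by
  have hc' : ∀ p q, c p * c q = (if p = q then (-2 : ℝ) else 0) • (1 : A) - c q * c p := fun p q =>
    eq_sub_of_add_eq (hc p q)
  have e1 : ∀ p q r, c q * c r * c p = c p * c q * c r - (if q = p then (-2 : ℝ) else 0) • c r +
      (if r = p then (-2 : ℝ) else 0) • c q := fun p q r => by
    rw [mul_assoc, hc' r p, mul_sub, ← mul_assoc, hc' q p, sub_mul]
    simp only [smul_mul_assoc, mul_smul_comm, one_mul, mul_one]
    abel
  have e2 : ∀ p q r, c r * c p * c q = c p * c q * c r + (if r = p then (-2 : ℝ) else 0) • c q -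
      (if r = q then (-2 : ℝ) else 0) • c p := fun p q r => by
    rw [hc' r p, sub_mul, mul_assoc (c p), hc' r q, mul_sub, ← mul_assoc]
    simp only [smul_mul_assoc, mul_smul_comm, one_mul, mul_one]
    abel
  have hT0 : ∀ p r s, T p p r s = 0 := fun p r s => by linarith [h1 p p r s]
  -- the cyclic identity, moved from the tensor to the Clifford product
  have key : ∀ s, ∑ p, ∑ q, ∑ r, T p q r s • (c p * c q * c r) =
      (2 : ℝ) • ∑ q, ∑ p, T p q p s • c q := by
    intro s
    have hb : ∑ p, ∑ q, ∑ r, T p q r s • (c p * c q * c r + c r * c p * c q + c q * c r * c p) =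
        0 := by
      have r1 : ∑ p, ∑ q, ∑ r, T p q r s • (c r * c p * c q) =
          ∑ p, ∑ q, ∑ r, T q r p s • (c p * c q * c r) :=
        sum_rotate (fun p q r => T p q r s • (c r * c p * c q))
      have r2 : ∑ p, ∑ q, ∑ r, T p q r s • (c q * c r * c p) =
          ∑ p, ∑ q, ∑ r, T r p q s • (c p * c q * c r) :=
        (sum_rotate (fun p q r => T r p q s • (c p * c q * c r))).symm
      simp only [smul_add, Finset.sum_add_distrib]
      rw [r1, r2]
      simp only [← Finset.sum_add_distrib, ← add_smul, h3, zero_smul, Finset.sum_const_zero]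
    have hb' : ∑ p, ∑ q, ∑ r, (T p q r s • (c p * c q * c r) +
        (T p q r s • (c p * c q * c r) + T p q r s • (if r = p then (-2 : ℝ) else 0) • c q -
          T p q r s • (if r = q then (-2 : ℝ) else 0) • c p) +
        (T p q r s • (c p * c q * c r) - T p q r s • (if q = p then (-2 : ℝ) else 0) • c r +
          T p q r s • (if r = p then (-2 : ℝ) else 0) • c q)) = 0 := by
      rw [← hb]
      refine Finset.sum_congr rfl fun p _ => Finset.sum_congr rfl fun q _ => Finset.sum_congr rfl
        fun r _ => ?_
      rw [e1 p q r, e2 p q r]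
      simp only [smul_add, smul_sub]
    simp only [Finset.sum_add_distrib, Finset.sum_sub_distrib] at hb'
    have t1 : ∑ p, ∑ q, ∑ r, T p q r s • (if q = p then (-2 : ℝ) else 0) • c r = 0 := by
      refine Finset.sum_eq_zero fun p _ => Finset.sum_eq_zero fun q _ => Finset.sum_eq_zero
        fun r _ => ?_
      by_cases h : q = p
      · rw [h, hT0, zero_smul]
      · simp [h]
    have t2 : ∑ p, ∑ q, ∑ r, T p q r s • (if r = p then (-2 : ℝ) else 0) • c q =
        (-2 : ℝ) • ∑ q, ∑ p, T p q p s • c q := by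
      rw [Finset.sum_comm, Finset.smul_sum]
      refine Finset.sum_congr rfl fun q _ => ?_
      rw [Finset.smul_sum]
      refine Finset.sum_congr rfl fun p _ => ?_
      simp only [ite_smul, zero_smul, smul_ite, smul_zero, Finset.sum_ite_eq', Finset.mem_univ,
        if_true]
      rw [smul_comm]
    have t3 : ∑ p, ∑ q, ∑ r, T p q r s • (if r = q then (-2 : ℝ) else 0) • c p =
        (2 : ℝ) • ∑ q, ∑ p, T p q p s • c q := by
      rw [Finset.smul_sum]
      refine Finset.sum_congr rfl fun p _ => ?_
      rw [Finset.smul_sum]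
      refine Finset.sum_congr rfl fun q _ => ?_
      simp only [ite_smul, zero_smul, smul_ite, smul_zero, Finset.sum_ite_eq', Finset.mem_univ,
        if_true]
      rw [h1 q p, neg_smul, smul_comm, neg_smul, neg_neg]
    rw [t1, t2, t3] at hb'
    have h3' : (3 : ℝ) • (∑ p, ∑ q, ∑ r, T p q r s • (c p * c q * c r)) =
        (3 : ℝ) • ((2 : ℝ) • ∑ q, ∑ p, T p q p s • c q) := by
      rw [← sub_eq_zero, ← hb']
      module
    exact smul_right_injective A (by norm_num : (3 : ℝ) ≠ 0) h3'
  have l1 : ∑ p, ∑ q, ∑ r, ∑ s, T p q r s • (c p * c q * (c r * c s)) =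
      ∑ s, (∑ p, ∑ q, ∑ r, T p q r s • (c p * c q * c r)) * c s := by
    simp only [Finset.sum_mul, smul_mul_assoc, mul_assoc]
    rw [Finset.sum_congr rfl (fun p _ => Finset.sum_congr rfl (fun q _ => Finset.sum_comm)),
      Finset.sum_congr rfl (fun p _ => Finset.sum_comm), Finset.sum_comm]
  rw [l1]
  simp only [key]
  have hsym : ∀ q s, ∑ p, T p q p s = ∑ p, T p s p q := fun q s =>
    Finset.sum_congr rfl fun p _ => h2 _ _ _ _
  have l2 : ∑ s, ((2 : ℝ) • ∑ q, ∑ p, T p q p s • c q) * c s =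
      ∑ s, ∑ q, (∑ p, T p q p s) • (c q * c s + c s * c q) := by
    have l3 : ∑ s, ∑ q, (∑ p, T p q p s) • (c s * c q) =
        ∑ s, ∑ q, (∑ p, T p q p s) • (c q * c s) := by
      rw [Finset.sum_comm]
      exact Finset.sum_congr rfl fun q _ => Finset.sum_congr rfl fun s _ => by rw [hsym]
    simp only [smul_add, Finset.sum_add_distrib]
    rw [l3, ← two_smul ℝ, Finset.smul_sum]
    refine Finset.sum_congr rfl fun s _ => ?_
    simp only [smul_mul_assoc, Finset.sum_mul, Finset.sum_smul]
  rw [l2]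
  simp only [hc, smul_smul, ← Finset.sum_smul]
  congr 1
  simp only [mul_ite, mul_zero, Finset.sum_ite_eq', Finset.mem_univ, if_true, ← Finset.sum_mul]
  rw [mul_comm, Finset.sum_comm, neg_mul, ← mul_neg, ← Finset.sum_neg_distrib]
  congr 1
  refine Finset.sum_congr rfl fun p _ => ?_
  rw [← Finset.sum_neg_distrib]
  exact Finset.sum_congr rfl fun q _ => by rw [h1 q p, neg_neg, h2]

end

/-! ### Clifford multiplication and the spin representation -/

section

variable {n : ℕ} {W : Type*} [AddCommGroup W] [Module ℂ W]

theorem fockSign_mul_self (μ : Idx n) (s : Finset (Idx n)) : fockSign μ s * fockSign μ s = 1 := by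
  rw [fockSign, ← mul_pow]; simp

theorem fockSign_erase_self (μ : Idx n) (s : Finset (Idx n)) :
    fockSign μ (s.erase μ) = fockSign μ s := by
  unfold fockSign
  congr 2
  ext ν
  simp only [Finset.mem_filter, Finset.mem_erase]
  constructor
  · rintro ⟨⟨_, h⟩, h'⟩; exact ⟨h, h'⟩
  · rintro ⟨h, h'⟩
    refine ⟨⟨?_, h⟩, h'⟩
    rintro rfl
    exact lt_irrefl _ h'

/-- Removing an element flips the signs of the later ones. -/
theorem fockSign_erase {μ ν : Idx n} {s : Finset (Idx n)} (hν : ν ∈ s) :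
    fockSign μ (s.erase ν) = (if toLex ν < toLex μ then -1 else 1) * fockSign μ s := by
  unfold fockSign
  rw [Finset.filter_erase]
  split_ifs with h
  · have hm : ν ∈ s.filter fun κ => toLex κ < toLex μ := Finset.mem_filter.2 ⟨hν, h⟩
    rw [← Finset.card_erase_add_one hm, pow_succ]
    ring
  · rw [Finset.erase_eq_of_notMem]
    · simp
    · exact fun hm => h (Finset.mem_filter.1 hm).2

theorem fockSign_insert {μ ν : Idx n} {s : Finset (Idx n)} (hν : ν ∉ s) :
    fockSign μ (insert ν s) = (if toLex ν < toLex μ then -1 else 1) * fockSign μ s := by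
  have h := fockSign_erase (μ := μ) (Finset.mem_insert_self ν s)
  rw [Finset.erase_insert hν] at h
  rw [h]
  split_ifs <;> simp

theorem wedge_apply (μ : Idx n) (ψ : Finset (Idx n) → W) (s : Finset (Idx n)) :
    wedge μ ψ s = if μ ∈ s then fockSign μ s • ψ (s.erase μ) else 0 := rfl

theorem contract_apply (μ : Idx n) (ψ : Finset (Idx n) → W) (s : Finset (Idx n)) :
    contract μ ψ s = if μ ∈ s then 0 else fockSign μ s • ψ (insert μ s) := rfl

theorem lex_sign {μ ν : Idx n} (h : μ ≠ ν) :
    (if toLex μ < toLex ν then (-1 : ℂ) else 1) = -(if toLex ν < toLex μ then -1 else 1) := by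
  rcases lt_trichotomy (toLex μ) (toLex ν) with h1 | h1 | h1
  · simp [h1, h1.not_gt]
  · exact absurd (toLex.injective h1) h
  · simp [h1, h1.not_gt]

theorem wedge_wedge (μ ν : Idx n) (ψ : Finset (Idx n) → W) :
    wedge μ (wedge ν ψ) = -wedge ν (wedge μ ψ) := by
  ext s
  simp only [Pi.neg_apply, wedge_apply, Finset.mem_erase]
  by_cases h : μ = ν
  · subst h; simp
  by_cases hμ : μ ∈ s <;> by_cases hν : ν ∈ s <;> simp [hμ, hν, h, Ne.symm h]
  rw [fockSign_erase hμ, fockSign_erase hν, lex_sign h, Finset.erase_right_comm, smul_smul,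
    smul_smul, ← neg_smul]
  congr 1
  ring

theorem contract_contract (μ ν : Idx n) (ψ : Finset (Idx n) → W) :
    contract μ (contract ν ψ) = -contract ν (contract μ ψ) := by
  ext s
  simp only [Pi.neg_apply, contract_apply, Finset.mem_insert]
  by_cases h : μ = ν
  · subst h; simp
  by_cases hμ : μ ∈ s <;> by_cases hν : ν ∈ s <;> simp [hμ, hν, h, Ne.symm h]
  rw [fockSign_insert hμ, fockSign_insert hν, lex_sign h, Finset.insert_comm, smul_smul,
    smul_smul, ← neg_smul]
  congr 1
  ring

theorem wedge_contract (μ ν : Idx n) (ψ : Finset (Idx n) → W) :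
    wedge μ (contract ν ψ) = -contract ν (wedge μ ψ) + if μ = ν then ψ else 0 := by
  ext s
  simp only [Pi.neg_apply, Pi.add_apply, contract_apply, wedge_apply, Finset.mem_insert,
    Finset.mem_erase]
  by_cases h : μ = ν
  · subst h
    by_cases hμ : μ ∈ s
    · simp [hμ, fockSign_erase_self, smul_smul, fockSign_mul_self]
    · have : fockSign μ (insert μ s) = fockSign μ s := by
        rw [← fockSign_erase_self, Finset.erase_insert hμ]
      simp [hμ, smul_smul, this, fockSign_mul_self]
  by_cases hμ : μ ∈ s <;> by_cases hν : ν ∈ s <;> simp [hμ, hν, h, Ne.symm h]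
  rw [fockSign_erase hμ, fockSign_insert hν, lex_sign h, smul_smul, smul_smul, ← neg_smul,
    Finset.erase_insert_of_ne (Ne.symm h)]
  congr 1
  ring

/-- The Clifford relations. -/
theorem clifford_anticomm (p q : Fr n) (ψ : Finset (Idx n) → W) :
    clifford p (clifford q ψ) + clifford q (clifford p ψ) =
      (if p = q then (-2 : ℂ) else 0) • ψ := by
  obtain ⟨μ, a⟩ := p
  obtain ⟨ν, b⟩ := q
  have e : ∀ (μ : Idx n) (a : Fin 2) (φ : Finset (Idx n) → W), clifford (μ, a) φ =
      unitScalar a • wedge μ φ - conj (unitScalar a) • contract μ φ := fun _ _ _ => rfl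
  simp only [e, map_sub, map_smul, smul_sub]
  rw [wedge_wedge μ ν, contract_contract μ ν, wedge_contract μ ν, wedge_contract ν μ]
  have hu : conj (unitScalar a) * unitScalar b + unitScalar a * conj (unitScalar b) =
      if a = b then 2 else 0 := by
    fin_cases a <;> fin_cases b <;> simp [unitScalar] <;> norm_num
  have h2 : (if (μ, a) = (ν, b) then (-2 : ℂ) else 0) • ψ =
      -(conj (unitScalar a) * unitScalar b + unitScalar a * conj (unitScalar b)) •
        (if μ = ν then ψ else 0) := by
    rw [hu]
    by_cases h : μ = ν <;> by_cases h' : a = b <;> simp [h, h', Prod.ext_iff]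
  rw [h2]
  simp only [eq_comm (a := ν)]
  module

theorem spinAct_apply (X : hol n) (ψ : Finset (Idx n) → W) :
    spinAct X ψ = (1 / 4 : ℂ) • ∑ p, ∑ q, (tangentCoeff p q X : ℂ) • clifford p (clifford q ψ) := by
  simp [spinAct, LinearMap.sum_apply, tangentCoeff_apply]

/-- Clifford multiplication is equivariant: `[X, v ⋆] = (X v) ⋆`. -/
theorem spinAct_clifford (X : hol n) (r : Fr n) (ψ : Finset (Idx n) → W) :
    spinAct X (clifford r ψ) = clifford r (spinAct X ψ) +
      ∑ q, (tangentCoeff r q X : ℂ) • clifford q ψ := by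
  have hc : ∀ p q (φ : Finset (Idx n) → W), clifford p (clifford q φ) =
      (if p = q then (-2 : ℂ) else 0) • φ - clifford q (clifford p φ) := fun p q φ =>
    eq_sub_of_add_eq (clifford_anticomm p q φ)
  have h1 : ∀ p q, clifford p (clifford q (clifford r ψ)) = clifford r (clifford p (clifford q ψ)) +
      (if q = r then (-2 : ℂ) else 0) • clifford p ψ -
      (if p = r then (-2 : ℂ) else 0) • clifford q ψ := by
    intro p q
    rw [hc q r, map_sub, map_smul, hc p r]
    module
  rw [spinAct_apply, spinAct_apply]
  simp only [h1, map_smul, map_sum, smul_add, smul_sub, Finset.sum_add_distrib,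
    Finset.sum_sub_distrib]
  have t1 : ∑ p, ∑ q, (tangentCoeff p q X : ℂ) • (if q = r then (-2 : ℂ) else 0) • clifford p ψ =
      (2 : ℂ) • ∑ q, (tangentCoeff r q X : ℂ) • clifford q ψ := by
    rw [Finset.smul_sum]
    refine Finset.sum_congr rfl fun p _ => ?_
    simp only [ite_smul, zero_smul, smul_ite, smul_zero, Finset.sum_ite_eq', Finset.mem_univ,
        if_true]
    rw [tangentCoeff_skew X p r]
    push_cast
    module
  have t2 : ∑ p, ∑ q, (tangentCoeff p q X : ℂ) • (if p = r then (-2 : ℂ) else 0) • clifford q ψ =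
      (-2 : ℂ) • ∑ q, (tangentCoeff r q X : ℂ) • clifford q ψ := by
    rw [Finset.sum_comm, Finset.smul_sum]
    refine Finset.sum_congr rfl fun p _ => ?_
    simp only [ite_smul, zero_smul, smul_ite, smul_zero, Finset.sum_ite_eq', Finset.mem_univ,
        if_true]
    module
  rw [t1, t2]
  module

theorem coord_add (p : Fr n) (Z Z' : Matrix (Idx 1) (Idx n) ℂ) :
    coord p (Z + Z') = coord p Z + coord p Z' := by
  simp [coord, add_mul, Finset.sum_add_distrib]

theorem coord_smul (p : Fr n) (c : ℝ) (Z : Matrix (Idx 1) (Idx n) ℂ) :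
    coord p ((c : ℂ) • Z) = c * coord p Z := by
  simp [coord, mul_assoc, ← Finset.mul_sum]

/-- The coordinate function as a linear map. -/
def coordLin (p : Fr n) : Matrix (Idx 1) (Idx n) ℂ →ₗ[ℝ] ℝ where
  toFun := coord p
  map_add' := coord_add p
  map_smul' c Z := by
    have := coord_smul p c Z
    rwa [Complex.coe_smul] at this

theorem coord_tangentAct_tangentAct (X Y : hol n) (p q : Fr n) :
    coord q (tangentAct X (tangentAct Y (frameVec p))) =
      ∑ r, tangentCoeff p r Y * tangentCoeff r q X := by
  have h : tangentAct X (tangentAct Y (frameVec p)) =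
      ∑ r, tangentCoeff p r Y • tangentAct X (frameVec r) := by
    conv_lhs => rw [tangentAct_frameVec Y p]
    simp only [tangentAct, Matrix.mul_sum, Matrix.sum_mul, ← Finset.sum_add_distrib]
    refine Finset.sum_congr rfl fun r _ => ?_
    rw [Matrix.mul_smul, Matrix.smul_mul, ← smul_add, ← Complex.coe_smul]
    rfl
  rw [h]
  change coordLin q _ = _
  rw [map_sum]
  simp only [map_smul]
  rfl

theorem tangentCoeff_bracket (X Y : hol n) (p q : Fr n) :
    tangentCoeff p q ((spBracket X.1 Y.1, spBracket X.2 Y.2) : hol n) =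
      ∑ r, (tangentCoeff p r Y * tangentCoeff r q X - tangentCoeff p r X * tangentCoeff r q Y) := by
  have h : tangentAct ((spBracket X.1 Y.1, spBracket X.2 Y.2) : hol n) (frameVec p) =
      tangentAct X (tangentAct Y (frameVec p)) - tangentAct Y (tangentAct X (frameVec p)) := by
    simp only [tangentAct, spBracket, transpose_sub, transpose_mul, Matrix.mul_add, Matrix.add_mul,
      Matrix.sub_mul, Matrix.mul_sub, Matrix.mul_assoc]
    abel
  rw [Finset.sum_sub_distrib, ← coord_tangentAct_tangentAct, ← coord_tangentAct_tangentAct,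
    tangentCoeff_apply, h]
  exact map_sub (coordLin q) _ _

theorem spinAct_bracket (X Y : hol n) (ψ : Finset (Idx n) → W) :
    spinAct ((spBracket X.1 Y.1, spBracket X.2 Y.2) : hol n) ψ =
      spinAct X (spinAct Y ψ) - spinAct Y (spinAct X ψ) := by
  rw [spinAct_apply Y, map_smul, map_sum]
  simp only [map_sum, map_smul]
  simp only [spinAct_clifford, map_add, map_sum, map_smul, smul_add, Finset.sum_add_distrib]
  rw [spinAct_apply Y (spinAct X ψ), spinAct_apply]
  simp only [tangentCoeff_bracket, Complex.ofReal_sum, Complex.ofReal_sub, Complex.ofReal_mul,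
    Finset.sum_smul, sub_smul, Finset.sum_sub_distrib, Finset.smul_sum]
  have t1 : ∑ p, ∑ q, ∑ r, ((tangentCoeff p r Y : ℂ) * (tangentCoeff r q X : ℂ)) •
      clifford p (clifford q ψ) = ∑ p, ∑ q, ∑ r, (tangentCoeff p q Y : ℂ) •
      (tangentCoeff q r X : ℂ) • clifford p (clifford r ψ) := by
    refine Finset.sum_congr rfl fun p _ => ?_
    rw [Finset.sum_comm]
    simp only [smul_smul]
  have t2 : ∑ p, ∑ q, ∑ r, ((tangentCoeff p r X : ℂ) * (tangentCoeff r q Y : ℂ)) •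
      clifford p (clifford q ψ) = -∑ p, ∑ q, ∑ r, (tangentCoeff p q Y : ℂ) •
      (tangentCoeff p r X : ℂ) • clifford r (clifford q ψ) := by
    rw [Finset.sum_comm]
    simp only [← Finset.sum_neg_distrib]
    rw [Finset.sum_congr rfl (fun q _ => Finset.sum_comm), Finset.sum_comm]
    refine Finset.sum_congr rfl fun r _ => Finset.sum_congr rfl fun q _ =>
      Finset.sum_congr rfl fun p _ => ?_
    rw [tangentCoeff_skew X p r, smul_smul, mul_comm]
    push_cast
    rw [mul_neg, neg_smul]
  simp only [← Finset.smul_sum] at t1 t2 ⊢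
  rw [t1, t2]
  module

end

/-! ### Second order elements acting on tensors -/

section
variable {κ I : Type*} [DecidableEq κ]

theorem update_update_swap (a : κ → I) {p p' : κ} (h : p' ≠ p) :
    Function.update (Function.update a p (a p')) p' (a p) = a ∘ Equiv.swap p p' := by
  ext x
  by_cases h1 : x = p'
  · subst h1; simp
  by_cases h2 : x = p
  · subst h2; simp [h.symm]
  · simp [h1, h2, Equiv.swap_apply_of_ne_of_ne]

theorem update_update_comp_swap (a : κ → I) {p p' : κ} (h : p' ≠ p) (α β : I) :
    Function.update (Function.update a p α) p' β ∘ Equiv.swap p p' =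
      Function.update (Function.update a p β) p' α := by
  ext x
  by_cases h1 : x = p'
  · subst h1; simp [h.symm]
  by_cases h2 : x = p
  · subst h2; simp [h.symm]
  · simp [h1, h2, Equiv.swap_apply_of_ne_of_ne]

end

section
variable {κ I : Type*} [Fintype κ] [DecidableEq κ] [Fintype I]

/-- The action of a matrix on tensors with slots `κ`, as a derivation. -/
def slotAct (A : Matrix I I ℂ) (f : (κ → I) → ℂ) (a : κ → I) : ℂ :=
  ∑ p, ∑ α, A (a p) α * f (Function.update a p α)

/-- The action of an element of `End ⊗ End` on tensors with slots `κ`, as a second order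
differential operator: `A ⊗ B` acts as the composition of the derivations `A` and `B`. -/
def slotAct₂ (G : I → I → I → I → ℂ) (f : (κ → I) → ℂ) (a : κ → I) : ℂ :=
  ∑ p, ∑ β, (∑ γ, G (a p) γ γ β) * f (Function.update a p β) +
    ∑ p, ∑ p' ∈ Finset.univ.erase p, ∑ α, ∑ β, G (a p) α (a p') β *
      f (Function.update (Function.update a p α) p' β)

theorem slotAct_slotAct (A B : Matrix I I ℂ) (f : (κ → I) → ℂ) (a : κ → I) :
    slotAct A (slotAct B f) a = slotAct₂ (fun α β γ δ => A α β * B γ δ) f a := by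
  unfold slotAct slotAct₂
  rw [← Finset.sum_add_distrib]
  refine Finset.sum_congr rfl fun p _ => ?_
  have h : ∀ α, A (a p) α * ∑ p', ∑ β, B (Function.update a p α p') β *
        f (Function.update (Function.update a p α) p' β) =
      ∑ β, A (a p) α * B α β * f (Function.update a p β) +
      ∑ p' ∈ Finset.univ.erase p, ∑ β, A (a p) α * B (a p') β *
        f (Function.update (Function.update a p α) p' β) := by
    intro α
    rw [← Finset.add_sum_erase _ _ (Finset.mem_univ p), mul_add, Finset.mul_sum, Finset.mul_sum]
    congr 1
    · refine Finset.sum_congr rfl fun β _ => ?_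
      rw [Function.update_self, Function.update_idem, mul_assoc]
    · refine Finset.sum_congr rfl fun p' hp' => ?_
      rw [Finset.mul_sum]
      refine Finset.sum_congr rfl fun β _ => ?_
      rw [Function.update_of_ne (Finset.ne_of_mem_erase hp'), mul_assoc]
  simp only [h, Finset.sum_add_distrib, Finset.sum_mul]
  congr 1
  · rw [Finset.sum_comm]
  · rw [Finset.sum_comm]

theorem slotAct₂_sum {K : Type*} (s : Finset K) (G : K → I → I → I → I → ℂ) (f : (κ → I) → ℂ)
    (a : κ → I) :
    slotAct₂ (fun α β γ δ => ∑ k ∈ s, G k α β γ δ) f a = ∑ k ∈ s, slotAct₂ (G k) f a := by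
  classical
  induction s using Finset.induction_on with
  | empty => simp [slotAct₂]
  | insert k s hk ih =>
    simp only [Finset.sum_insert hk, ← ih]
    simp only [slotAct₂, add_mul, Finset.sum_add_distrib]
    ring

theorem slotAct_commutator (A B : Matrix I I ℂ) (f : (κ → I) → ℂ) (a : κ → I) :
    slotAct A (slotAct B f) a - slotAct B (slotAct A f) a = slotAct (A * B - B * A) f a := by
  rw [slotAct_slotAct, slotAct_slotAct]
  have h : ∑ p, ∑ p' ∈ Finset.univ.erase p, ∑ α, ∑ β, A (a p) α * B (a p') β *
      f (Function.update (Function.update a p α) p' β) =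
      ∑ p, ∑ p' ∈ Finset.univ.erase p, ∑ α, ∑ β, B (a p) α * A (a p') β *
      f (Function.update (Function.update a p α) p' β) := by
    rw [Finset.sum_comm' (s' := fun p => Finset.univ.erase p) (t' := Finset.univ)
      (by intro x y; simp [ne_comm])]
    refine Finset.sum_congr rfl fun p _ => Finset.sum_congr rfl fun p' hp' => ?_
    rw [Finset.sum_comm]
    refine Finset.sum_congr rfl fun α _ => Finset.sum_congr rfl fun β _ => ?_
    rw [Function.update_comm (Finset.ne_of_mem_erase hp')]
    ring
  unfold slotAct₂
  rw [h, add_sub_add_right_eq_sub, ← Finset.sum_sub_distrib]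
  refine Finset.sum_congr rfl fun p _ => ?_
  rw [← Finset.sum_sub_distrib]
  refine Finset.sum_congr rfl fun β _ => ?_
  rw [← sub_mul]
  rfl

theorem sum_sum_eq_zero_of_skew {g : I → I → ℂ} (h : ∀ α β, g β α = -g α β) :
    ∑ α, ∑ β, g α β = 0 := by
  have : ∑ α, ∑ β, g α β = -∑ α, ∑ β, g α β := by
    conv_lhs => rw [Finset.sum_comm]
    simp only [← Finset.sum_neg_distrib, ← h]
  exact self_eq_neg.1 this

end

section
variable {m : ℕ} {κ : Type*} [Fintype κ] [DecidableEq κ]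

/-- The invariant element of `sp(m) ⊗ sp(m)`, in `End ⊗ End`, whose image in any representation is
the Casimir operator (up to normalization). -/
def casimirTensor (m : ℕ) (α β γ δ : Idx m) : ℂ :=
  2 * (J (Fin m) ℂ α γ * J (Fin m) ℂ β δ - (if α = δ then 1 else 0) * (if β = γ then 1 else 0))

/-- The Casimir operator of `sp(m)` on tensors of degree `k` which are symmetric (`ε = 1`) or skew
(`ε = -1`) and annihilated by contractions with the symplectic form: the `k` diagonal terms each
contribute `-2(2m+1)` and the `k(k-1)` pairs of different slots `-2ε`. -/
theorem slotAct₂_casimir (ε : ℂ) (f : (κ → Idx m) → ℂ) (a : κ → Idx m)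
    (h1 : ∀ p p', p ≠ p' → f (a ∘ Equiv.swap p p') = ε * f a)
    (h2 : ∀ p p', p ≠ p' → ∑ α, ∑ β, J (Fin m) ℂ α β *
      f (Function.update (Function.update a p α) p' β) = 0) :
    slotAct₂ (casimirTensor m) f a =
      -2 * Fintype.card κ * ((2 * m + 1) + ε * (Fintype.card κ - 1)) * f a := by
  have d1 : ∀ α β : Idx m, ∑ γ, casimirTensor m α γ γ β =
      if α = β then -2 * (2 * (m : ℂ) + 1) else 0 := by
    intro α β
    have e : ∀ γ, J (Fin m) ℂ γ β = -J (Fin m) ℂ β γ := fun γ => J_swap γ β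
    simp only [casimirTensor, ← Finset.mul_sum, Finset.sum_sub_distrib, e, mul_neg,
      Finset.sum_neg_distrib, sum_J_mul_J]
    by_cases h : α = β <;> simp [h]
    ring
  have d2 : ∀ p, ∀ p' ∈ Finset.univ.erase p, ∑ α, ∑ β, casimirTensor m (a p) α (a p') β *
      f (Function.update (Function.update a p α) p' β) = -2 * ε * f a := by
    intro p p' hp'
    have hne := Finset.ne_of_mem_erase hp'
    have e : ∀ α β, casimirTensor m (a p) α (a p') β *
      f (Function.update (Function.update a p α) p' β) =
      2 * J (Fin m) ℂ (a p) (a p') * (J (Fin m) ℂ α β *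
        f (Function.update (Function.update a p α) p' β)) -
      2 * (if a p = β then (if α = a p' then
        f (Function.update (Function.update a p α) p' β) else 0) else 0) := by
      intro α β
      unfold casimirTensor
      by_cases h : a p = β <;> by_cases h' : α = a p' <;> simp [h, h'] <;> ring
    simp only [e, Finset.sum_sub_distrib, ← Finset.mul_sum, h2 p p' hne.symm]
    simp only [Finset.sum_ite_eq, Finset.sum_ite_eq', Finset.mem_univ, if_true]
    rw [update_update_swap a hne, h1 p p' hne.symm]
    ring
  unfold slotAct₂
  rw [Finset.sum_congr rfl (fun p _ => Finset.sum_congr rfl (d2 p))]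
  simp only [d1, ite_mul, zero_mul, Finset.sum_ite_eq, Finset.mem_univ, if_true,
    Function.update_eq_self, Finset.sum_const, Finset.card_univ, Finset.card_erase_of_mem,
    nsmul_eq_mul]
  rcases Nat.eq_zero_or_pos (Fintype.card κ) with h | h
  · simp [h]
  · rw [Nat.cast_sub h]
    push_cast
    ring

/-- A totally symmetric element `c` of `E^{⊗4}`, viewed in `End ⊗ End` by lowering two indices with
the symplectic form, annihilates skew tensors: in the diagonal terms two indices of `c` are
contracted with `σ`, in the others two indices of `c` are paired with two skew slots. -/
theorem slotAct₂_symm {c : Idx m → Idx m → Idx m → Idx m → ℂ}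
    (hc : ∀ κ μ l ν, c κ μ l ν = c κ ν l μ) (hc' : ∀ κ μ l ν, c κ μ l ν = c κ l μ ν)
    {G : Idx m → Idx m → Idx m → Idx m → ℂ}
    (hG : ∀ κ κ' l l', G κ κ' l l' =
      ∑ μ, ∑ ν, c κ μ l ν * (J (Fin m) ℂ μ κ' * J (Fin m) ℂ ν l'))
    (f : (κ → Idx m) → ℂ) (a : κ → Idx m)
    (h1 : ∀ p p', p ≠ p' → ∀ b, f (b ∘ Equiv.swap p p') = -f b) :
    slotAct₂ G f a = 0 := by
  have d1 : ∀ α β : Idx m, ∑ γ, G α γ γ β = 0 := by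
    intro α β
    simp only [hG]
    rw [Finset.sum_congr rfl (fun γ _ => Finset.sum_comm), Finset.sum_comm]
    refine Finset.sum_eq_zero fun ν _ => ?_
    refine sum_sum_eq_zero_of_skew fun γ μ => ?_
    rw [hc' α γ μ, J_swap γ μ]
    ring
  have d2 : ∀ p, ∀ p' ∈ Finset.univ.erase p, ∑ α, ∑ β, G (a p) α (a p') β *
      f (Function.update (Function.update a p α) p' β) = 0 := by
    intro p p' hp'
    have hne := Finset.ne_of_mem_erase hp'
    simp only [hG, Finset.sum_mul]
    rw [sum_pair_comm (fun α β μ ν => c (a p) μ (a p') ν * (J (Fin m) ℂ μ α * J (Fin m) ℂ ν β) *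
      f (Function.update (Function.update a p α) p' β))]
    refine sum_sum_eq_zero_of_skew fun μ ν => ?_
    rw [Finset.sum_comm, ← Finset.sum_neg_distrib]
    refine Finset.sum_congr rfl fun α _ => ?_
    rw [← Finset.sum_neg_distrib]
    refine Finset.sum_congr rfl fun β _ => ?_
    rw [← update_update_comp_swap a hne, h1 p p' hne.symm, hc (a p) ν]
    ring
  unfold slotAct₂
  rw [Finset.sum_congr rfl (fun p _ => Finset.sum_congr rfl (d2 p))]
  simp [d1]

end

section
variable {n l d : ℕ}

theorem tensAct_apply (X : hol n) (T : Tens n l d) (a : Fin l → Idx 1) (m : Fin d → Idx n) :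
    tensAct X T a m = slotAct X.1.1 (fun a => T a m) a + slotAct X.2.1 (T a) m := rfl

theorem slotAct_add {κ I : Type*} [Fintype κ] [DecidableEq κ] [Fintype I] (A : Matrix I I ℂ)
    (f g : (κ → I) → ℂ) (a : κ → I) :
    slotAct A (fun a => f a + g a) a = slotAct A f a + slotAct A g a := by
  simp only [slotAct, mul_add, Finset.sum_add_distrib]

theorem slotAct_comm (A : Matrix (Idx 1) (Idx 1) ℂ) (B : Matrix (Idx n) (Idx n) ℂ)
    (T : Tens n l d) (a : Fin l → Idx 1) (m : Fin d → Idx n) :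
    slotAct B (fun m => slotAct A (fun a => T a m) a) m =
      slotAct A (fun a => slotAct B (T a) m) a := by
  simp only [slotAct, Finset.mul_sum]
  rw [sum_pair_comm (fun q μ p α => B (m q) μ * (A (a p) α *
    T (Function.update a p α) (Function.update m q μ)))]
  simp only [mul_left_comm]

theorem tensAct_tensAct (X Y : hol n) (T : Tens n l d) (a : Fin l → Idx 1) (m : Fin d → Idx n) :
    tensAct X (tensAct Y T) a m =
      slotAct₂ (fun α β γ δ => X.1.1 α β * Y.1.1 γ δ) (fun a => T a m) a +
      slotAct₂ (fun α β γ δ => X.2.1 α β * Y.2.1 γ δ) (T a) m +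
      slotAct X.1.1 (fun a => slotAct Y.2.1 (T a) m) a +
      slotAct Y.1.1 (fun a => slotAct X.2.1 (T a) m) a := by
  rw [tensAct_apply]
  have e1 : (fun a => tensAct Y T a m) = fun a =>
      slotAct Y.1.1 (fun a => T a m) a + slotAct Y.2.1 (T a) m := rfl
  have e2 : tensAct Y T a = fun m =>
      slotAct Y.1.1 (fun a => T a m) a + slotAct Y.2.1 (T a) m := rfl
  rw [e1, e2, slotAct_add, slotAct_add, slotAct_comm, ← slotAct_slotAct, ← slotAct_slotAct]
  ring

theorem tensAct_bracket (X Y : hol n) (T : Tens n l d) :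
    tensAct ((spBracket X.1 Y.1, spBracket X.2 Y.2) : hol n) T =
      tensAct X (tensAct Y T) - tensAct Y (tensAct X T) := by
  ext a m
  rw [Pi.sub_apply, Pi.sub_apply, tensAct_tensAct, tensAct_tensAct, tensAct_apply,
    ← slotAct_slotAct, ← slotAct_slotAct, ← slotAct_slotAct, ← slotAct_slotAct]
  have e1 := slotAct_commutator X.1.1 Y.1.1 (fun a => T a m) a
  have e2 := slotAct_commutator X.2.1 Y.2.1 (T a) m
  change slotAct (X.1.1 * Y.1.1 - Y.1.1 * X.1.1) _ _ +
    slotAct (X.2.1 * Y.2.1 - Y.2.1 * X.2.1) _ _ = _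
  rw [← e1, ← e2]
  ring

theorem sum_slotAct_slotAct_eq_zero {K : Type*} (s : Finset K) (A : K → Matrix (Idx 1) (Idx 1) ℂ)
    (B : K → Matrix (Idx n) (Idx n) ℂ) (h : ∀ α β μ ν, ∑ k ∈ s, A k α β * B k μ ν = 0)
    (T : Tens n l d) (a : Fin l → Idx 1) (m : Fin d → Idx n) :
    ∑ k ∈ s, slotAct (A k) (fun a => slotAct (B k) (T a) m) a = 0 := by
  simp only [slotAct, Finset.mul_sum]
  rw [Finset.sum_comm]
  refine Finset.sum_eq_zero fun p _ => ?_
  rw [Finset.sum_comm]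
  refine Finset.sum_eq_zero fun α _ => ?_
  rw [Finset.sum_comm]
  refine Finset.sum_eq_zero fun q _ => ?_
  rw [Finset.sum_comm]
  refine Finset.sum_eq_zero fun μ _ => ?_
  simp only [← mul_assoc, ← Finset.sum_mul, h, zero_mul]

/-- A second order expression in the action on `H^{⊗l} ⊗ E^{⊗d}`, in terms of the element of
`(sp(1) ⊕ sp(n)) ⊗ (sp(1) ⊕ sp(n))` defining it, when the latter has no mixed components. -/
theorem sum_tensAct_tensAct {K : Type*} (s : Finset K) (X Y : K → hol n)
    {GH : Idx 1 → Idx 1 → Idx 1 → Idx 1 → ℂ} {GE : Idx n → Idx n → Idx n → Idx n → ℂ}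
    (hH : ∀ α β γ δ, ∑ k ∈ s, (X k).1.1 α β * (Y k).1.1 γ δ = GH α β γ δ)
    (hE : ∀ α β γ δ, ∑ k ∈ s, (X k).2.1 α β * (Y k).2.1 γ δ = GE α β γ δ)
    (hHE : ∀ α β μ ν, ∑ k ∈ s, (X k).1.1 α β * (Y k).2.1 μ ν = 0)
    (hEH : ∀ α β μ ν, ∑ k ∈ s, (Y k).1.1 α β * (X k).2.1 μ ν = 0)
    (T : Tens n l d) (a : Fin l → Idx 1) (m : Fin d → Idx n) :
    ∑ k ∈ s, tensAct (X k) (tensAct (Y k) T) a m =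
      slotAct₂ GH (fun a => T a m) a + slotAct₂ GE (T a) m := by
  have e1 : GH = fun α β γ δ => ∑ k ∈ s, (X k).1.1 α β * (Y k).1.1 γ δ := by
    ext; rw [hH]
  have e2 : GE = fun α β γ δ => ∑ k ∈ s, (X k).2.1 α β * (Y k).2.1 γ δ := by
    ext; rw [hE]
  rw [e1, e2, slotAct₂_sum, slotAct₂_sum]
  simp only [tensAct_tensAct, Finset.sum_add_distrib]
  rw [sum_slotAct_slotAct_eq_zero s _ _ hHE, sum_slotAct_slotAct_eq_zero s _ _ hEH]
  ring

theorem twist_swap_left {T : Tens n l d} (hT : T ∈ twist n l d) (p p' : Fin l)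
    (a : Fin l → Idx 1) (m : Fin d → Idx n) : T (a ∘ Equiv.swap p p') m = T a m :=
  hT.1 _ a m

theorem twist_swap_right {T : Tens n l d} (hT : T ∈ twist n l d) {p p' : Fin d} (h : p ≠ p')
    (a : Fin l → Idx 1) (m : Fin d → Idx n) : T a (m ∘ Equiv.swap p p') = -T a m := by
  rw [hT.2.1, Equiv.Perm.sign_swap h]
  simp

/-- A second order expression in the action on the twist vanishes if its only component is the one
in `Sym² sp(n)` and that component is totally symmetric in four indices of `E`. The factor `Sym^l H`
sees nothing of it, the factor `Λ^d_∘ E` is killed because it is skew. -/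
theorem sum_tensAct_eq_zero {K : Type*} (s : Finset K) (X Y : K → hol n)
    {c : Idx n → Idx n → Idx n → Idx n → ℂ}
    (hc : ∀ κ μ l ν, c κ μ l ν = c κ ν l μ) (hc' : ∀ κ μ l ν, c κ μ l ν = c κ l μ ν)
    (hH : ∀ α β γ δ, ∑ k ∈ s, (X k).1.1 α β * (Y k).1.1 γ δ = 0)
    (hE : ∀ κ κ' l l', ∑ k ∈ s, (X k).2.1 κ κ' * (Y k).2.1 l l' =
      ∑ μ, ∑ ν, c κ μ l ν * (J (Fin n) ℂ μ κ' * J (Fin n) ℂ ν l'))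
    (hHE : ∀ α β μ ν, ∑ k ∈ s, (X k).1.1 α β * (Y k).2.1 μ ν = 0)
    (hEH : ∀ α β μ ν, ∑ k ∈ s, (Y k).1.1 α β * (X k).2.1 μ ν = 0)
    {T : Tens n l d} (hT : T ∈ twist n l d) :
    ∑ k ∈ s, tensAct (X k) (tensAct (Y k) T) = 0 := by
  ext a m
  rw [Finset.sum_apply, Finset.sum_apply, sum_tensAct_tensAct s X Y hH hE hHE hEH,
    slotAct₂_symm hc hc' (fun _ _ _ _ => rfl) (T a) m
      (fun p p' h b => twist_swap_right hT h a b)]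
  simp [slotAct₂]

/-- The Casimir operator on the twist: `Sym^l H` contributes `l(l+2)` and `Λ^d_∘ E` contributes
`d(2n+2-d)`. -/
theorem sum_tensAct_casimir {K : Type*} (s : Finset K) (X Y : K → hol n)
    (hH : ∀ α β γ δ, ∑ k ∈ s, (X k).1.1 α β * (Y k).1.1 γ δ = casimirTensor 1 α β γ δ)
    (hE : ∀ α β γ δ, ∑ k ∈ s, (X k).2.1 α β * (Y k).2.1 γ δ = casimirTensor n α β γ δ)
    (hHE : ∀ α β μ ν, ∑ k ∈ s, (X k).1.1 α β * (Y k).2.1 μ ν = 0)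
    (hEH : ∀ α β μ ν, ∑ k ∈ s, (Y k).1.1 α β * (X k).2.1 μ ν = 0)
    {T : Tens n l d} (hT : T ∈ twist n l d) :
    ∑ k ∈ s, tensAct (X k) (tensAct (Y k) T) =
      (-2 * (l * (l + 2) + d * (2 * n + 2 - d)) : ℂ) • T := by
  ext a m
  rw [Finset.sum_apply, Finset.sum_apply, sum_tensAct_tensAct s X Y hH hE hHE hEH,
    slotAct₂_casimir 1 (fun a => T a m) a
      (fun p p' _ => by rw [one_mul]; exact twist_swap_left hT p p' a m)
      (fun p p' h => sum_sum_eq_zero_of_skew fun α β => by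
        rw [← update_update_comp_swap a h.symm, twist_swap_left hT, J_swap β α]; ring),
    slotAct₂_casimir (-1) (T a) m
      (fun p p' h => by rw [neg_one_mul]; exact twist_swap_right hT h a m)
      (fun p p' h => hT.2.2 p p' h a m)]
  simp only [Fintype.card_fin, Pi.smul_apply, smul_eq_mul]
  push_cast
  ring

end

/-! ### Curvature tensors with vanishing scalar curvature -/

section
variable {m : ℕ}

/-- Contraction of two indices with the symplectic form. -/
def contr (f : Idx m → Idx m → ℂ) : ℂ := ∑ x, ∑ y, J (Fin m) ℂ x y * f x y

theorem contr_add (f g : Idx m → Idx m → ℂ) :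
    contr (fun x y => f x y + g x y) = contr f + contr g := by
  simp only [contr, mul_add, Finset.sum_add_distrib]

theorem contr_mul_left (k : ℂ) (f : Idx m → Idx m → ℂ) :
    contr (fun x y => k * f x y) = k * contr f := by
  simp only [contr, Finset.mul_sum, mul_left_comm k]

theorem contr_mul_right (k : ℂ) (f : Idx m → Idx m → ℂ) :
    contr (fun x y => f x y * k) = contr f * k := by
  simp only [contr, Finset.sum_mul, mul_assoc]

theorem contr_zero : contr (fun _ _ : Idx m => 0) = 0 := by simp [contr]

theorem contr_swap (f : Idx m → Idx m → ℂ) : contr (fun x y => f y x) = -contr f := by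
  unfold contr
  rw [Finset.sum_comm]
  simp only [← Finset.sum_neg_distrib]
  exact Finset.sum_congr rfl fun x _ => Finset.sum_congr rfl fun y _ => by rw [J_swap]; ring

theorem contr_eq_zero {f : Idx m → Idx m → ℂ} (h : ∀ x y, f x y = f y x) : contr f = 0 :=
  sum_sum_eq_zero_of_skew fun x y => by rw [h y x, J_swap]; ring

theorem contr_J : contr (J (Fin m) ℂ) = 2 * m := by
  simp only [contr, sum_J_mul_J, if_true]
  simp; ring

theorem contr_J_mul (k : ℂ) : contr (fun x y => J (Fin m) ℂ x y * k) = 2 * m * k := by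
  have h := contr_mul_right k (J (Fin m) ℂ)
  rw [contr_J] at h
  exact h

theorem contr_J_right (f : Idx m → ℂ) (a : Idx m) :
    contr (fun x y => J (Fin m) ℂ a y * f x) = f a := by
  unfold contr
  have : ∀ x, ∑ y, J (Fin m) ℂ x y * (J (Fin m) ℂ a y * f x) = if x = a then f x else 0 := by
    intro x
    simp only [← mul_assoc, ← Finset.sum_mul, sum_J_mul_J]
    split_ifs <;> simp
  simp [this]

theorem contr_J_right' (f : Idx m → ℂ) (a : Idx m) :
    contr (fun x y => J (Fin m) ℂ y a * f x) = -f a := by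
  have : ∀ x y, J (Fin m) ℂ y a * f x = (-1) * (J (Fin m) ℂ a y * f x) := fun x y => by
    rw [J_swap y a]; ring
  simp only [this]
  rw [contr_mul_left, contr_J_right]
  ring

theorem contr_J_left (f : Idx m → ℂ) (a : Idx m) :
    contr (fun x y => J (Fin m) ℂ x a * f y) = f a := by
  rw [contr_swap (fun y x => J (Fin m) ℂ x a * f y), contr_J_right', neg_neg]

theorem contr_J_left' (f : Idx m → ℂ) (a : Idx m) :
    contr (fun x y => J (Fin m) ℂ a x * f y) = -f a := by
  rw [contr_swap (fun y x => J (Fin m) ℂ a x * f y), contr_J_right]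

end

section
variable {n : ℕ}

/-- Curvature tensors with values in `sp(1) ⊕ sp(n)`, `n ≥ 2`, and vanishing scalar curvature. Here
`a`, `b` and `c` are the components in `Sym² sp(1)`, `sp(n) ⊗ sp(1)` and `Sym² sp(n)`, with
`sp(1) = Sym² H` and `sp(n) = Sym² E`; `hB` is the first Bianchi identity in complex indices and
`hs` says that the scalar curvature is zero. Then `a` and `b` vanish and `c` is totally symmetric.
All conclusions are obtained by contracting `hB` with the symplectic forms. -/
theorem bianchi_decomposition (hn : 2 ≤ n)
    (a : Idx 1 → Idx 1 → Idx 1 → Idx 1 → ℂ) (b : Idx n → Idx n → Idx 1 → Idx 1 → ℂ)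
    (c : Idx n → Idx n → Idx n → Idx n → ℂ)
    (a₁ : ∀ α β γ δ, a α β γ δ = a β α γ δ) (a₂ : ∀ α β γ δ, a α β γ δ = a γ δ α β)
    (b₁ : ∀ μ ν α β, b μ ν α β = b ν μ α β) (b₂ : ∀ μ ν α β, b μ ν α β = b μ ν β α)
    (c₁ : ∀ κ μ l ν, c κ μ l ν = c μ κ l ν) (c₂ : ∀ κ μ l ν, c κ μ l ν = c l ν κ μ)
    (hB : ∀ α β γ δ (μ ν κ l : Idx n),
      (J (Fin n) ℂ μ ν * J (Fin n) ℂ κ l * a α β γ δ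
        + J (Fin n) ℂ μ ν * J (Fin 1) ℂ γ δ * b κ l α β
        + J (Fin 1) ℂ α β * J (Fin n) ℂ κ l * b μ ν γ δ
        + J (Fin 1) ℂ α β * J (Fin 1) ℂ γ δ * c μ ν κ l)
      + (J (Fin n) ℂ ν κ * J (Fin n) ℂ μ l * a β γ α δ
        + J (Fin n) ℂ ν κ * J (Fin 1) ℂ α δ * b μ l β γ
        + J (Fin 1) ℂ β γ * J (Fin n) ℂ μ l * b ν κ α δ
        + J (Fin 1) ℂ β γ * J (Fin 1) ℂ α δ * c ν κ μ l)
      + (J (Fin n) ℂ κ μ * J (Fin n) ℂ ν l * a γ α β δ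
        + J (Fin n) ℂ κ μ * J (Fin 1) ℂ β δ * b ν l γ α
        + J (Fin 1) ℂ γ α * J (Fin n) ℂ ν l * b κ μ β δ
        + J (Fin 1) ℂ γ α * J (Fin 1) ℂ β δ * c κ μ ν l) = 0)
    (hs : n * contr (fun α γ => contr (fun β δ => a α β γ δ)) +
      contr (fun μ κ => contr (fun ν l => c μ ν κ l)) = 0) :
    (∀ α β γ δ, a α β γ δ = 0) ∧ (∀ μ ν α β, b μ ν α β = 0) ∧
      (∀ μ ν κ l, c μ ν κ l = c ν κ μ l) := by
  have hn0 : (n : ℂ) ≠ 0 := by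
    have : n ≠ 0 := by omega
    exact_mod_cast this
  have hn1 : (n : ℂ) - 1 ≠ 0 := by
    have : (n : ℂ) ≠ 1 := by
      have : n ≠ 1 := by omega
      exact_mod_cast this
    exact sub_ne_zero.2 this
  set t : Idx 1 → Idx 1 → ℂ := fun α β => contr (fun γ δ => a α γ β δ) with ht
  have tskew : ∀ α β, t α β = -t β α := by
    intro α β
    simp only [ht]
    rw [← contr_swap]
    congr 1; ext γ δ
    rw [a₂]
  -- contraction of the last two `H`-indices
  have s1 : ∀ α β (μ ν κ l : Idx n), 2 * (J (Fin n) ℂ μ ν * b κ l α β)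
      + 2 * (J (Fin 1) ℂ α β * c μ ν κ l)
      + (J (Fin n) ℂ ν κ * J (Fin n) ℂ μ l * t β α + J (Fin n) ℂ ν κ * b μ l β α
        - J (Fin n) ℂ μ l * b ν κ α β - J (Fin 1) ℂ α β * c ν κ μ l)
      + (J (Fin n) ℂ κ μ * J (Fin n) ℂ ν l * t α β + J (Fin n) ℂ κ μ * b ν l β α
        + J (Fin n) ℂ ν l * b κ μ β α - J (Fin 1) ℂ α β * c κ μ ν l) = 0 := by
    intro α β μ ν κ l
    have h := congrArg (contr (m := 1)) (funext fun γ => funext fun δ => hB α β γ δ μ ν κ l)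
    simp only [contr_add, contr_zero] at h
    have e1 : contr (fun γ δ => J (Fin n) ℂ μ ν * J (Fin n) ℂ κ l * a α β γ δ) = 0 :=
      contr_eq_zero fun γ δ => by rw [a₂, a₁, a₂]
    have e2 : contr (fun γ δ => J (Fin n) ℂ μ ν * J (Fin 1) ℂ γ δ * b κ l α β) =
        2 * (J (Fin n) ℂ μ ν * b κ l α β) := by
      simp only [mul_assoc]
      rw [contr_mul_left, contr_J_mul]; push_cast; ring
    have e3 : contr (fun γ δ => J (Fin 1) ℂ α β * J (Fin n) ℂ κ l * b μ ν γ δ) = 0 :=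
      contr_eq_zero fun γ δ => by rw [b₂]
    have e4 : contr (fun γ δ => J (Fin 1) ℂ α β * J (Fin 1) ℂ γ δ * c μ ν κ l) =
        2 * (J (Fin 1) ℂ α β * c μ ν κ l) := by
      simp only [mul_assoc]
      rw [contr_mul_left, contr_J_mul]; push_cast; ring
    have e5 : contr (fun γ δ => J (Fin n) ℂ ν κ * J (Fin n) ℂ μ l * a β γ α δ) =
        J (Fin n) ℂ ν κ * J (Fin n) ℂ μ l * t β α := contr_mul_left _ _
    have e6 : contr (fun γ δ => J (Fin n) ℂ ν κ * J (Fin 1) ℂ α δ * b μ l β γ) =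
        J (Fin n) ℂ ν κ * b μ l β α := by
      simp only [mul_assoc]
      rw [contr_mul_left, contr_J_right]
    have e7 : contr (fun γ δ => J (Fin 1) ℂ β γ * J (Fin n) ℂ μ l * b ν κ α δ) =
        -(J (Fin n) ℂ μ l * b ν κ α β) := by
      simp only [mul_assoc]
      rw [contr_J_left' (fun δ => J (Fin n) ℂ μ l * b ν κ α δ)]
    have e8 : contr (fun γ δ => J (Fin 1) ℂ β γ * J (Fin 1) ℂ α δ * c ν κ μ l) =
        -(J (Fin 1) ℂ α β * c ν κ μ l) := by
      simp only [mul_assoc]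
      rw [contr_J_left' (fun δ => J (Fin 1) ℂ α δ * c ν κ μ l)]
    have e9 : contr (fun γ δ => J (Fin n) ℂ κ μ * J (Fin n) ℂ ν l * a γ α β δ) =
        J (Fin n) ℂ κ μ * J (Fin n) ℂ ν l * t α β := by
      simp only [a₁ _ α]
      exact contr_mul_left _ _
    have e10 : contr (fun γ δ => J (Fin n) ℂ κ μ * J (Fin 1) ℂ β δ * b ν l γ α) =
        J (Fin n) ℂ κ μ * b ν l β α := by
      simp only [mul_assoc]
      rw [contr_mul_left, contr_J_right (fun γ => b ν l γ α)]
    have e11 : contr (fun γ δ => J (Fin 1) ℂ γ α * J (Fin n) ℂ ν l * b κ μ β δ) =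
        J (Fin n) ℂ ν l * b κ μ β α := by
      simp only [mul_assoc]
      rw [contr_J_left (fun δ => J (Fin n) ℂ ν l * b κ μ β δ)]
    have e12 : contr (fun γ δ => J (Fin 1) ℂ γ α * J (Fin 1) ℂ β δ * c κ μ ν l) =
        -(J (Fin 1) ℂ α β * c κ μ ν l) := by
      simp only [mul_assoc]
      rw [contr_J_left (fun δ => J (Fin 1) ℂ β δ * c κ μ ν l), J_swap β α]
      ring
    rw [e1, e2, e3, e4, e5, e6, e7, e8, e9, e10, e11, e12] at h
    linear_combination h
  -- its symmetric part
  have s2 : ∀ α β (μ ν κ l : Idx n), 2 * (J (Fin n) ℂ μ ν * b κ l α β)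
      + J (Fin n) ℂ ν κ * b μ l α β - J (Fin n) ℂ μ l * b ν κ α β
      + J (Fin n) ℂ κ μ * b ν l α β + J (Fin n) ℂ ν l * b κ μ α β = 0 := by
    intro α β μ ν κ l
    have h1 := s1 α β μ ν κ l
    have h2 := s1 β α μ ν κ l
    rw [J_swap β α, tskew β α] at h2
    rw [tskew β α] at h1
    simp only [b₂ _ _ β α] at h1 h2
    linear_combination (1 / 2) * h1 + (1 / 2) * h2
  -- contraction of the first two `E`-indices; this is where `n ≠ 1` is needed
  have hb : ∀ μ ν α β, b μ ν α β = 0 := by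
    intro κ l α β
    have h := congrArg (contr (m := n)) (funext fun μ => funext fun ν => s2 α β μ ν κ l)
    simp only [sub_eq_add_neg, contr_add, contr_zero] at h
    have e1 : contr (fun μ ν => 2 * (J (Fin n) ℂ μ ν * b κ l α β)) = 4 * n * b κ l α β := by
      rw [contr_mul_left, contr_J_mul]; ring
    have e2 := contr_J_right' (fun μ => b μ l α β) κ
    have e3 : contr (fun μ ν => -(J (Fin n) ℂ μ l * b ν κ α β)) = -b l κ α β := by
      simp only [neg_eq_neg_one_mul (J (Fin n) ℂ _ l * _)]
      rw [contr_mul_left, contr_J_left (fun ν => b ν κ α β)]; ring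
    have e4 := contr_J_left' (fun ν => b ν l α β) κ
    have e5 := contr_J_right' (fun μ => b κ μ α β) l
    rw [e1, e2, e3, e4, e5, b₁ l κ] at h
    have h' : (4 * ((n : ℂ) - 1)) * b κ l α β = 0 := by linear_combination h
    exact (mul_eq_zero.1 h').resolve_left (mul_ne_zero (by norm_num) hn1)
  -- the part of `s1` that is skew in the two `H`-indices
  set τ : ℂ := contr t with hτ
  have s4 : ∀ μ ν κ l : Idx n, 2 * (2 * c μ ν κ l - c ν κ μ l - c κ μ ν l) =
      τ * (J (Fin n) ℂ ν κ * J (Fin n) ℂ μ l - J (Fin n) ℂ κ μ * J (Fin n) ℂ ν l) := by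
    intro μ ν κ l
    have h := congrArg (contr (m := 1)) (funext fun α => funext fun β => s1 α β μ ν κ l)
    have e : ∀ α β, 2 * (J (Fin n) ℂ μ ν * b κ l α β)
      + 2 * (J (Fin 1) ℂ α β * c μ ν κ l)
      + (J (Fin n) ℂ ν κ * J (Fin n) ℂ μ l * t β α + J (Fin n) ℂ ν κ * b μ l β α
        - J (Fin n) ℂ μ l * b ν κ α β - J (Fin 1) ℂ α β * c ν κ μ l)
      + (J (Fin n) ℂ κ μ * J (Fin n) ℂ ν l * t α β + J (Fin n) ℂ κ μ * b ν l β α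
        + J (Fin n) ℂ ν l * b κ μ β α - J (Fin 1) ℂ α β * c κ μ ν l) =
      J (Fin 1) ℂ α β * (2 * c μ ν κ l - c ν κ μ l - c κ μ ν l) +
      (J (Fin n) ℂ κ μ * J (Fin n) ℂ ν l - J (Fin n) ℂ ν κ * J (Fin n) ℂ μ l) * t α β := by
      intro α β
      simp only [hb]
      rw [tskew β α]
      ring
    simp only [e, contr_add, contr_zero, contr_mul_left, contr_J_mul] at h
    push_cast at h
    linear_combination h
  -- contraction of the last two, and then of the first two `E`-indices
  set σ : ℂ := contr (fun μ κ => contr (fun ν l => c μ ν κ l)) with hσ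
  have s5 : ∀ α β γ δ, 2 * n * (2 * n * a α β γ δ - a β γ α δ - a γ α β δ) =
      σ * (J (Fin 1) ℂ β γ * J (Fin 1) ℂ α δ - J (Fin 1) ℂ γ α * J (Fin 1) ℂ β δ) := by
    intro α β γ δ
    set u : Idx n → Idx n → ℂ := fun μ ν => contr (fun κ l => c μ κ ν l) with hu
    have h1 : ∀ μ ν, J (Fin n) ℂ μ ν * (2 * n * a α β γ δ - a β γ α δ - a γ α β δ) +
        (J (Fin 1) ℂ β γ * J (Fin 1) ℂ α δ) * u ν μ +
        (J (Fin 1) ℂ γ α * J (Fin 1) ℂ β δ) * u μ ν = 0 := by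
      intro μ ν
      have h := congrArg (contr (m := n)) (funext fun κ => funext fun l => hB α β γ δ μ ν κ l)
      simp only [hb, mul_zero, add_zero, contr_add, contr_zero] at h
      have e1 : contr (fun κ l => J (Fin n) ℂ μ ν * J (Fin n) ℂ κ l * a α β γ δ) =
          J (Fin n) ℂ μ ν * (2 * n * a α β γ δ) := by
        simp only [mul_assoc]
        rw [contr_mul_left, contr_J_mul]; ring
      have e2 : contr (fun κ l => J (Fin 1) ℂ α β * J (Fin 1) ℂ γ δ * c μ ν κ l) = 0 :=
        contr_eq_zero fun κ l => by rw [c₂, c₁, c₂]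
      have e3 : contr (fun κ l => J (Fin n) ℂ ν κ * J (Fin n) ℂ μ l * a β γ α δ) =
          -(J (Fin n) ℂ μ ν * a β γ α δ) := by
        simp only [mul_right_comm _ (J (Fin n) ℂ μ _)]
        simp only [mul_comm _ (J (Fin n) ℂ μ _)]
        rw [contr_J_right (fun κ => J (Fin n) ℂ ν κ * a β γ α δ), J_swap ν μ]; ring
      have e4 : contr (fun κ l => J (Fin 1) ℂ β γ * J (Fin 1) ℂ α δ * c ν κ μ l) =
          (J (Fin 1) ℂ β γ * J (Fin 1) ℂ α δ) * u ν μ := contr_mul_left _ _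
      have e5 : contr (fun κ l => J (Fin n) ℂ κ μ * J (Fin n) ℂ ν l * a γ α β δ) =
          -(J (Fin n) ℂ μ ν * a γ α β δ) := by
        simp only [mul_right_comm _ (J (Fin n) ℂ ν _)]
        simp only [mul_comm _ (J (Fin n) ℂ ν _)]
        rw [contr_J_right (fun κ => J (Fin n) ℂ κ μ * a γ α β δ), J_swap ν μ]; ring
      have e6 : contr (fun κ l => J (Fin 1) ℂ γ α * J (Fin 1) ℂ β δ * c κ μ ν l) =
          (J (Fin 1) ℂ γ α * J (Fin 1) ℂ β δ) * u μ ν := by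
        simp only [c₁ _ μ]
        exact contr_mul_left _ _
      rw [e1, e2, e3, e4, e5, e6] at h
      linear_combination h
    have h := congrArg (contr (m := n)) (funext fun μ => funext fun ν => h1 μ ν)
    simp only [contr_add, contr_zero, contr_J_mul, contr_mul_left] at h
    rw [contr_swap u] at h
    have hσu : contr u = σ := rfl
    rw [hσu] at h
    linear_combination h
  -- a full contraction gives a second linear relation between `τ` and `σ`, next to `hs`
  have hτ0 : τ = 0 := by
    have h := congrArg (contr (m := 1)) (funext fun α => funext fun γ =>
      congrArg (contr (m := 1)) (funext fun β => funext fun δ => s5 α β γ δ))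
    simp only [contr_mul_left, sub_eq_add_neg, neg_eq_neg_one_mul (a _ _ _ _), contr_add,
      neg_eq_neg_one_mul (J (Fin 1) ℂ _ _ * _)] at h
    have e1 : contr (fun α γ => contr (fun β δ => a α β γ δ)) = τ := rfl
    have e2 : contr (fun α γ => contr (fun β δ => a β γ α δ)) = -τ := by
      rw [← e1, ← contr_swap]
      congr 1; ext α γ; congr 1; ext β δ
      rw [a₁]
    have e3 : contr (fun α γ => contr (fun β δ => a γ α β δ)) = 0 :=
      contr_eq_zero fun α γ => by simp only [a₁ α γ]
    have e4 : contr (fun α γ => contr (fun β δ => J (Fin 1) ℂ β γ * J (Fin 1) ℂ α δ)) = 2 := by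
      have : ∀ α γ, contr (fun β δ => J (Fin 1) ℂ β γ * J (Fin 1) ℂ α δ) = J (Fin 1) ℂ α γ :=
        fun α γ => by
          simp only [mul_comm (J (Fin 1) ℂ _ γ)]
          exact contr_J_right (fun β => J (Fin 1) ℂ β γ) α
      simp only [this]
      exact contr_J.trans (by norm_num)
    have e5 : contr (fun α γ => contr (fun β δ => J (Fin 1) ℂ γ α * J (Fin 1) ℂ β δ)) = -4 := by
      have : ∀ α γ, contr (fun β δ => J (Fin 1) ℂ γ α * J (Fin 1) ℂ β δ) =
          J (Fin 1) ℂ γ α * (2 * (1 : ℕ)) := fun α γ => by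
        simp only [mul_comm (J (Fin 1) ℂ γ α)]
        exact contr_J_mul _
      simp only [this]
      rw [contr_swap (fun γ α => J (Fin 1) ℂ γ α * (2 * (1 : ℕ))), contr_J_mul]
      norm_num
    rw [e1, e2, e3, e4, e5] at h
    have hs' : n * τ + σ = 0 := hs
    have h4 : (2 * n * (2 * (n : ℂ) + 4)) * τ = 0 := by linear_combination h + 6 * hs'
    refine (mul_eq_zero.1 h4).resolve_left ?_
    have : 2 * n * (2 * n + 4) ≠ 0 := by positivity
    exact_mod_cast this
  have hσ0 : σ = 0 := by
    have hs' : n * τ + σ = 0 := hs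
    rw [hτ0] at hs'
    linear_combination hs'
  refine ⟨fun α β γ δ => ?_, hb, fun μ ν κ l => ?_⟩
  · have h2n : 2 * (n : ℂ) ≠ 0 := mul_ne_zero two_ne_zero hn0
    have h1 := s5 α β γ δ
    have h2 := s5 β γ α δ
    have h3 := s5 γ α β δ
    rw [hσ0, zero_mul] at h1 h2 h3
    have h1' := (mul_eq_zero.1 h1).resolve_left h2n
    have h2' := (mul_eq_zero.1 h2).resolve_left h2n
    have h3' := (mul_eq_zero.1 h3).resolve_left h2n
    have h : (2 * (n : ℂ) + 1) * (2 * ((n : ℂ) - 1)) * a α β γ δ = 0 := by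
      linear_combination (2 * (n : ℂ) - 1) * h1' + h2' + h3'
    refine (mul_eq_zero.1 h).resolve_left (mul_ne_zero ?_ (mul_ne_zero two_ne_zero hn1))
    exact_mod_cast Nat.succ_ne_zero (2 * n)
  · have h1 := s4 μ ν κ l
    have h2 := s4 ν κ μ l
    rw [hτ0, zero_mul] at h1 h2
    linear_combination (1 / 6) * h1 - (1 / 6) * h2

end

/-! ### Components of the curvature in complex indices -/

section
variable {n : ℕ}

/-- The symmetric bilinear form on `H` belonging to the `sp(1)`-part of an element of
`sp(1) ⊕ sp(n)`. -/
def symH (α β : Idx 1) : hol n →ₗ[ℝ] ℂ where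
  toFun X := spSym X.1 α β
  map_add' X Y := by simp [spSym, Matrix.add_mul]
  map_smul' c X := by simp [spSym]

/-- The symmetric bilinear form on `E` belonging to the `sp(n)`-part of an element of
`sp(1) ⊕ sp(n)`. -/
def symE (μ ν : Idx n) : hol n →ₗ[ℝ] ℂ where
  toFun X := spSym X.2 μ ν
  map_add' X Y := by simp [spSym, Matrix.add_mul]
  map_smul' c X := by simp [spSym]

theorem symH_apply (α β : Idx 1) (X : hol n) : symH α β X = spSym X.1 α β := rfl

theorem symE_apply (μ ν : Idx n) (X : hol n) : symE μ ν X = spSym X.2 μ ν := rfl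

theorem symH_comm (α β : Idx 1) (X : hol n) : symH α β X = symH β α X := spSym_comm _ _ _

theorem symE_comm (μ ν : Idx n) (X : hol n) : symE μ ν X = symE ν μ X := spSym_comm _ _ _

/-- The matrix coefficients of `X ∈ sp(1) ⊕ sp(n)` in complex indices. -/
theorem sum_tangentCoeff_mul_frameVec (X : hol n) (α β : Idx 1) (μ ν : Idx n) :
    ∑ p, ∑ q, (tangentCoeff p q X : ℂ) * (frameVec p α μ * frameVec q β ν) =
      -(J (Fin n) ℂ μ ν * symH α β X + J (Fin 1) ℂ α β * symE μ ν X) := by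
  have h : ∀ p, ∑ q, (tangentCoeff p q X : ℂ) * (frameVec p α μ * frameVec q β ν) =
      ∑ β', X.1.1 β β' * (frameVec p α μ * frameVec p β' ν) +
        ∑ ν', X.2.1 ν ν' * (frameVec p α μ * frameVec p β ν') := by
    intro p
    have h1 := congrFun (congrFun (tangentAct_frameVec X p) β) ν
    simp only [tangentAct, Matrix.add_apply, Matrix.mul_apply, Matrix.sum_apply, Matrix.smul_apply,
      Matrix.transpose_apply, smul_eq_mul] at h1
    simp only [tangentCoeff_apply, tangentAct]
    rw [Finset.sum_congr rfl (fun q _ => mul_left_comm _ (frameVec p α μ) _), ← Finset.mul_sum,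
      ← h1, mul_add, Finset.mul_sum, Finset.mul_sum]
    congr 1 <;> exact Finset.sum_congr rfl fun _ _ => by ring
  simp only [h, Finset.sum_add_distrib]
  rw [Finset.sum_comm, Finset.sum_comm (s := Finset.univ (α := Fr n))]
  simp only [← Finset.mul_sum, sum_frameVec_mul]
  rw [neg_add, symH_comm, symE_comm]
  simp only [symH_apply, symE_apply, spSym, Matrix.mul_apply, Finset.mul_sum,
    ← Finset.sum_neg_distrib]
  congr 1
  · exact Finset.sum_congr rfl fun _ _ => by rw [J_swap α]; ring
  · exact Finset.sum_congr rfl fun _ _ => by rw [J_swap μ]; ring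

/-- The component `-1/2 ∑ φ(R(e_p ∧ e_q)) χ(e_p ∧ e_q)` of an element `R` of
`Sym² (sp(1) ⊕ sp(n))` with respect to two complex valued linear forms. -/
def curvPairing (R : Fr n → Fr n → hol n) (φ χ : hol n →ₗ[ℝ] ℂ) : ℂ :=
  -(1 / 2) * ∑ p, ∑ q, φ (R p q) * χ (holProj p q)

namespace IsAlgCurv
variable {R : Fr n → Fr n → hol n}

theorem curvPairing_comm (hR : IsAlgCurv R) (hn : n ≠ 0) (φ χ : hol n →ₗ[ℝ] ℂ) :
    curvPairing R φ χ = curvPairing R χ φ := by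
  unfold curvPairing
  congr 1
  have h := hR.sum_bilin_symm hn ((LinearMap.mul ℝ ℂ).compl₁₂ φ χ)
  simp only [LinearMap.compl₁₂_apply, LinearMap.mul_apply'] at h
  rw [← h]
  exact Finset.sum_congr rfl fun _ _ => Finset.sum_congr rfl fun _ _ => mul_comm _ _

/-- The curvature, composed with a linear form `χ`, in complex indices. This fixes the normalization
of `curvPairing`. -/
theorem sum_frameVec_mul_curv (hR : IsAlgCurv R) (hn : n ≠ 0) (χ : hol n →ₗ[ℝ] ℂ) (α β : Idx 1)
    (μ ν : Idx n) :
    ∑ p, ∑ q, (frameVec p α μ * frameVec q β ν) * χ (R p q) =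
      J (Fin n) ℂ μ ν * curvPairing R (symH α β) χ +
        J (Fin 1) ℂ α β * curvPairing R (symE μ ν) χ := by
  have h := hR.sum_bilin hn ((LinearMap.mul ℝ ℂ).compl₁₂ LinearMap.id χ)
    (fun p q => frameVec p α μ * frameVec q β ν)
  simp only [LinearMap.compl₁₂_apply, LinearMap.mul_apply', LinearMap.id_apply,
    Complex.real_smul, sum_tangentCoeff_mul_frameVec] at h
  rw [h]
  simp only [curvPairing, Finset.mul_sum, ← Finset.sum_add_distrib]
  refine Finset.sum_congr rfl fun _ _ => Finset.sum_congr rfl fun _ _ => ?_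
  push_cast
  ring

/-- The curvature tensor in complex indices, in terms of its components in `Sym² sp(1)`,
`sp(n) ⊗ sp(1)` and `Sym² sp(n)`. -/
theorem sum_frameVec_mul_tangentCoeff (hR : IsAlgCurv R) (hn : n ≠ 0) (α β γ δ : Idx 1)
    (μ ν κ l : Idx n) :
    ∑ p, ∑ q, ∑ r, ∑ s, (frameVec p α μ * frameVec q β ν * (frameVec r γ κ * frameVec s δ l)) *
      (tangentCoeff r s (R p q) : ℂ) =
    -(J (Fin n) ℂ μ ν * J (Fin n) ℂ κ l * curvPairing R (symH α β) (symH γ δ) +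
      J (Fin n) ℂ μ ν * J (Fin 1) ℂ γ δ * curvPairing R (symE κ l) (symH α β) +
      J (Fin 1) ℂ α β * J (Fin n) ℂ κ l * curvPairing R (symE μ ν) (symH γ δ) +
      J (Fin 1) ℂ α β * J (Fin 1) ℂ γ δ * curvPairing R (symE μ ν) (symE κ l)) := by
  have e : ∀ p q, ∑ r, ∑ s, (frameVec p α μ * frameVec q β ν *
      (frameVec r γ κ * frameVec s δ l)) * (tangentCoeff r s (R p q) : ℂ) =
      -(J (Fin n) ℂ κ l) * ((frameVec p α μ * frameVec q β ν) * symH γ δ (R p q)) -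
        J (Fin 1) ℂ γ δ * ((frameVec p α μ * frameVec q β ν) * symE κ l (R p q)) := by
    intro p q
    have h := sum_tangentCoeff_mul_frameVec (R p q) γ δ κ l
    simp only [mul_comm _ ((tangentCoeff _ _ (R p q) : ℝ) : ℂ),
      mul_left_comm _ (frameVec p α μ * frameVec q β ν), ← Finset.mul_sum, h]
    ring
  simp only [e, Finset.sum_sub_distrib, ← Finset.mul_sum, hR.sum_frameVec_mul_curv hn]
  rw [hR.curvPairing_comm hn (symH α β) (symE κ l)]
  ring

/-- The first Bianchi identity in complex indices. -/
theorem bianchi_complex (hR : IsAlgCurv R) (u v w z : Fr n → ℂ) :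
    ∑ p, ∑ q, ∑ r, ∑ s, (u p * v q * (w r * z s)) * (tangentCoeff r s (R p q) : ℂ) +
    ∑ p, ∑ q, ∑ r, ∑ s, (v p * w q * (u r * z s)) * (tangentCoeff r s (R p q) : ℂ) +
    ∑ p, ∑ q, ∑ r, ∑ s, (w p * u q * (v r * z s)) * (tangentCoeff r s (R p q) : ℂ) = 0 := by
  rw [sum_rotate (fun p q r => ∑ s, (v p * w q * (u r * z s)) * (tangentCoeff r s (R p q) : ℂ)),
    sum_rotate (fun p q r => ∑ s, (w p * u q * (v r * z s)) * (tangentCoeff r s (R p q) : ℂ)),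
    sum_rotate (fun p q r => ∑ s, (w q * u r * (v p * z s)) * (tangentCoeff p s (R q r) : ℂ))]
  simp only [← Finset.sum_add_distrib]
  refine Finset.sum_eq_zero fun p _ => Finset.sum_eq_zero fun q _ => Finset.sum_eq_zero fun r _ =>
    Finset.sum_eq_zero fun s _ => ?_
  have h : (tangentCoeff r s (R p q) : ℂ) + tangentCoeff p s (R q r) +
      tangentCoeff q s (R r p) = 0 := by
    exact_mod_cast hR.bianchi p q r s
  linear_combination (u p * v q * (w r * z s)) * h

end IsAlgCurv

theorem sum_trace_frameVec (A : Matrix (Idx 1) (Idx 1) ℂ) (B : Matrix (Idx n) (Idx n) ℂ) :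
    ∑ p : Fr n, ∑ α, ∑ ν, (A * frameVec p * B) α ν * conj (frameVec p α ν) = A.trace * B.trace := by
  rw [Finset.sum_comm, Finset.sum_congr rfl (fun α _ => Finset.sum_comm)]
  have e : ∀ α ν, ∑ p : Fr n, (A * frameVec p * B) α ν * conj (frameVec p α ν) = A α α * B ν ν := by
    intro α ν
    simp only [Matrix.mul_apply, Finset.sum_mul]
    rw [Finset.sum_comm, Finset.sum_congr rfl (fun μ _ => Finset.sum_comm)]
    have e' : ∀ μ β, ∑ p : Fr n, A α β * frameVec p β μ * B μ ν * conj (frameVec p α ν) =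
        if β = α ∧ μ = ν then A α α * B ν ν else 0 := by
      intro μ β
      have := sum_frameVec_mul_conj β α μ ν
      rw [Finset.sum_congr rfl (fun p _ => show A α β * frameVec p β μ * B μ ν *
        conj (frameVec p α ν) = (A α β * B μ ν) * (frameVec p β μ * conj (frameVec p α ν)) by ring),
        ← Finset.mul_sum, this]
      by_cases h1 : β = α <;> by_cases h2 : μ = ν <;> simp [h1, h2]
    simp only [e', ite_and]
    simp
  simp only [e, Matrix.trace, Matrix.diag, Finset.sum_mul_sum]

/-- The inner product of `so(4n)`, minus the trace form, restricted to `sp(1) ⊕ sp(n)`. -/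
theorem sum_tangentCoeff_mul (X Y : hol n) :
    ∑ p, ∑ q, ((tangentCoeff p q X * tangentCoeff p q Y : ℝ) : ℂ) =
      -(2 * n * (X.1.1 * Y.1.1).trace + 2 * (X.2.1 * Y.2.1).trace) := by
  have h1 : ∀ p, ∑ q, ((tangentCoeff p q X * tangentCoeff p q Y : ℝ) : ℂ) =
      -∑ α, ∑ ν, tangentAct Y (tangentAct X (frameVec p)) α ν * conj (frameVec p α ν) := by
    intro p
    rw [← (isRealTensor_tangentAct Y
        (isRealTensor_tangentAct X (isRealTensor_frameVec p))).coord_eq,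
      coord_tangentAct_tangentAct]
    push_cast
    rw [← Finset.sum_neg_distrib]
    refine Finset.sum_congr rfl fun q _ => ?_
    rw [tangentCoeff_skew Y p q]
    push_cast
    ring
  have h2 : ∀ p : Fr n, tangentAct Y (tangentAct X (frameVec p)) =
      (Y.1.1 * X.1.1) * frameVec p * (1 : Matrix (Idx n) (Idx n) ℂ) +
        Y.1.1 * frameVec p * X.2.1ᵀ + X.1.1 * frameVec p * Y.2.1ᵀ +
        (1 : Matrix (Idx 1) (Idx 1) ℂ) * frameVec p * (X.2.1ᵀ * Y.2.1ᵀ) := by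
    intro p
    simp only [tangentAct, Matrix.mul_add, Matrix.add_mul, Matrix.mul_assoc, Matrix.mul_one,
      Matrix.one_mul]
    abel
  simp only [h1, h2, Matrix.add_apply, add_mul, Finset.sum_add_distrib, Finset.sum_neg_distrib,
    sum_trace_frameVec, trace_sp, Matrix.trace_one, ← Matrix.transpose_mul, Matrix.trace_transpose]
  rw [Matrix.trace_mul_comm Y.1.1, Matrix.trace_mul_comm Y.2.1]
  simp
  ring

theorem trace_mul_eq_contr {m : ℕ} (X Y : sp m) :
    (X.1 * Y.1).trace = -contr (fun a d => contr (fun c b => spSym X a c * spSym Y d b)) := by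
  simp only [Matrix.trace, Matrix.diag, Matrix.mul_apply]
  have e : ∀ a b, X.1 a b * Y.1 b a =
      -∑ d, ∑ c, J (Fin m) ℂ a d * (J (Fin m) ℂ c b * (spSym X a c * spSym Y d b)) := by
    intro a b
    rw [sp_apply_eq_sum_spSym X a b, sp_apply_eq_sum_spSym Y b a, neg_mul_neg, Finset.sum_mul_sum,
      Finset.sum_comm, ← Finset.sum_neg_distrib]
    refine Finset.sum_congr rfl fun d _ => ?_
    rw [← Finset.sum_neg_distrib]
    refine Finset.sum_congr rfl fun c _ => ?_
    rw [J_swap d a, spSym_comm Y]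
    ring
  simp only [e, contr, Finset.mul_sum, Finset.sum_neg_distrib]
  refine congrArg _ (Finset.sum_congr rfl fun a _ => Finset.sum_comm.trans ?_)
  exact Finset.sum_congr rfl fun d _ => Finset.sum_comm

theorem contr_sum {m : ℕ} {K : Type*} (s : Finset K) (f : K → Idx m → Idx m → ℂ) :
    contr (fun x y => ∑ k ∈ s, f k x y) = ∑ k ∈ s, contr (f k) := by
  simp only [contr, Finset.mul_sum]
  rw [Finset.sum_congr rfl (fun x _ => Finset.sum_comm), Finset.sum_comm]

namespace IsAlgCurv
variable {R : Fr n → Fr n → hol n}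

theorem sum_tangentCoeff_eq_sum_trace (hR : IsAlgCurv R) (hn : n ≠ 0) :
    ((∑ p, ∑ q, tangentCoeff q p (R p q) : ℝ) : ℂ) =
      ∑ p, ∑ q, (n * ((R p q).1.1 * (holProj p q).1.1).trace +
        ((R p q).2.1 * (holProj p q).2.1).trace) := by
  have h := hR.sum_bilin hn (LinearMap.id : (hol n →ₗ[ℝ] ℝ) →ₗ[ℝ] hol n →ₗ[ℝ] ℝ)
    (fun p q => tangentCoeff p q)
  simp only [LinearMap.id_apply, LinearMap.smul_apply, LinearMap.sum_apply, smul_eq_mul] at h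
  have e : ∀ p q, tangentCoeff q p (R p q) = -tangentCoeff p q (R p q) := fun p q =>
    tangentCoeff_skew _ _ _
  have h2 := fun r s => sum_tangentCoeff_mul (R r s) (holProj r s)
  simp only [e, Finset.sum_neg_distrib]
  rw [h]
  push_cast
  push_cast at h2
  simp only [h2, ← Finset.sum_neg_distrib]
  exact Finset.sum_congr rfl fun p _ => Finset.sum_congr rfl fun q _ => by ring

/-- The scalar curvature in terms of the components of the curvature in `Sym² sp(1)` and
`Sym² sp(n)`. -/
theorem sum_tangentCoeff_eq_contr (hR : IsAlgCurv R) (hn : n ≠ 0) :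
    ((∑ p, ∑ q, tangentCoeff q p (R p q) : ℝ) : ℂ) =
      2 * (n * contr (fun α γ => contr (fun β δ => curvPairing R (symH α β) (symH γ δ))) +
        contr (fun μ κ => contr (fun ν l => curvPairing R (symE μ ν) (symE κ l)))) := by
  rw [hR.sum_tangentCoeff_eq_sum_trace hn]
  simp only [trace_mul_eq_contr, curvPairing, contr_mul_left, contr_sum, symH_apply, symE_apply,
    Finset.sum_add_distrib, Finset.sum_neg_distrib, mul_neg, ← Finset.mul_sum]
  ring

/-- A curvature tensor with vanishing scalar curvature has no component in `sp(1)`, and its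
component in `Sym² sp(n) ⊂ Sym² E ⊗ Sym² E` is totally symmetric. -/
theorem curvPairing_of_scal_eq_zero (hR : IsAlgCurv R) (hn : 2 ≤ n)
    (hs : ∑ p, ∑ q, tangentCoeff q p (R p q) = 0) :
    (∀ α β γ δ, curvPairing R (symH α β) (symH γ δ) = 0) ∧
    (∀ μ ν α β, curvPairing R (symE μ ν) (symH α β) = 0) ∧
    (∀ μ ν κ l, curvPairing R (symE μ ν) (symE κ l) = curvPairing R (symE ν κ) (symE μ l)) := by
  have hn0 : n ≠ 0 := by omega
  have cH : ∀ α β, (symH α β : hol n →ₗ[ℝ] ℂ) = symH β α := fun α β =>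
    LinearMap.ext fun X => symH_comm α β X
  have cE : ∀ α β, (symE α β : hol n →ₗ[ℝ] ℂ) = symE β α := fun α β =>
    LinearMap.ext fun X => symE_comm α β X
  refine bianchi_decomposition hn (fun α β γ δ => curvPairing R (symH α β) (symH γ δ))
    (fun μ ν α β => curvPairing R (symE μ ν) (symH α β))
    (fun μ ν κ l => curvPairing R (symE μ ν) (symE κ l)) ?_ ?_ ?_ ?_ ?_ ?_ ?_ ?_
  · intro α β γ δ; simp only [cH α β]
  · intro α β γ δ; exact hR.curvPairing_comm hn0 _ _
  · intro μ ν α β; simp only [cE μ ν]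
  · intro μ ν α β; simp only [cH α β]
  · intro κ μ l ν; simp only [cE κ μ]
  · intro α β γ δ; exact hR.curvPairing_comm hn0 _ _
  · intro α β γ δ μ ν κ l
    have h := hR.bianchi_complex (fun p => frameVec p α μ) (fun p => frameVec p β ν)
      (fun p => frameVec p γ κ) (fun p => frameVec p δ l)
    simp only [hR.sum_frameVec_mul_tangentCoeff hn0] at h
    linear_combination -h
  · have h := hR.sum_tangentCoeff_eq_contr hn0
    rw [hs] at h
    push_cast at h
    linear_combination -(1 / 2) * h

/-- A curvature tensor with vanishing scalar curvature acts trivially on the twist, since its only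
component is totally symmetric in four indices of `E`. -/
theorem sum_tensAct_holProj_eq_zero (hR : IsAlgCurv R) (hn : 2 ≤ n)
    (hs : ∑ p, ∑ q, tangentCoeff q p (R p q) = 0) {l d : ℕ} {T : Tens n l d}
    (hT : T ∈ twist n l d) :
    ∑ p, ∑ q, tensAct (holProj p q) (tensAct (R p q) T) = 0 := by
  obtain ⟨hA, hB, hC⟩ := hR.curvPairing_of_scal_eq_zero hn hs
  have hn0 : n ≠ 0 := by omega
  have cE : ∀ α β, (symE α β : hol n →ₗ[ℝ] ℂ) = symE β α := fun α β =>
    LinearMap.ext fun X => symE_comm α β X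
  have key : ∀ φ χ : hol n →ₗ[ℝ] ℂ, ∑ k : Fr n × Fr n, φ (holProj k.1 k.2) * χ (R k.1 k.2) =
      -2 * curvPairing R φ χ := fun φ χ => by
    rw [hR.curvPairing_comm hn0, curvPairing, Fintype.sum_prod_type, ← mul_assoc]
    norm_num
    exact Finset.sum_congr rfl fun _ _ => Finset.sum_congr rfl fun _ _ => mul_comm _ _
  have prodSum : ∀ {a b : ℕ} (X : Fr n × Fr n → sp a) (Y : Fr n × Fr n → sp b) (i j k l),
      ∑ x, (X x).1 i j * (Y x).1 k l = ∑ r, ∑ s, (∑ x, spSym (X x) i r * spSym (Y x) k s) *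
        (J (Fin a) ℂ r j * J (Fin b) ℂ s l) := by
    intro a b X Y i j k l
    have e : ∀ x, (X x).1 i j * (Y x).1 k l = ∑ r, ∑ s, (spSym (X x) i r * spSym (Y x) k s) *
        (J (Fin a) ℂ r j * J (Fin b) ℂ s l) := fun x => by
      rw [sp_apply_eq_sum_spSym (X x) i, sp_apply_eq_sum_spSym (Y x) k, neg_mul_neg,
        Finset.sum_mul_sum]
      exact Finset.sum_congr rfl fun r _ => Finset.sum_congr rfl fun s _ => by ring
    simp only [e, Finset.sum_mul]
    refine Finset.sum_comm.trans (Finset.sum_congr rfl fun r _ => Finset.sum_comm)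
  have h := sum_tensAct_eq_zero (Finset.univ : Finset (Fr n × Fr n))
    (fun k => holProj k.1 k.2) (fun k => R k.1 k.2)
    (c := fun κ μ l ν => -2 * curvPairing R (symE κ μ) (symE l ν)) ?_ ?_ ?_ ?_ ?_ ?_ hT
  · rw [Fintype.sum_prod_type] at h
    exact h
  · intro κ μ l ν
    rw [cE κ μ, hR.curvPairing_comm hn0 (symE κ ν), hC l μ κ ν]
  · intro κ μ l ν
    rw [cE κ μ, hC μ κ l ν]
  · intro α β γ δ
    rw [prodSum]
    exact Finset.sum_eq_zero fun r _ => Finset.sum_eq_zero fun s _ =>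
      mul_eq_zero_of_left ((key (symH α r) (symH γ s)).trans (by rw [hA, mul_zero])) _
  · intro κ κ' l l'
    rw [prodSum]
    exact Finset.sum_congr rfl fun r _ => Finset.sum_congr rfl fun s _ =>
      congrArg (· * _) (key (symE κ r) (symE l s))
  · intro α β μ ν
    rw [prodSum]
    exact Finset.sum_eq_zero fun r _ => Finset.sum_eq_zero fun s _ =>
      mul_eq_zero_of_left ((key (symH α r) (symE μ s)).trans
        (by rw [hR.curvPairing_comm hn0, hB, mul_zero])) _
  · intro α β μ ν
    simp only [mul_comm ((R _ _).1.1 α β)]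
    rw [prodSum]
    exact Finset.sum_eq_zero fun r _ => Finset.sum_eq_zero fun s _ =>
      mul_eq_zero_of_left ((key (symE μ r) (symH α s)).trans (by rw [hB, mul_zero])) _

end IsAlgCurv

end

/-! ### The curvature of quaternionic projective space -/

section
variable {n : ℕ}

theorem omegaH_apply (p q : Fr n) (α β : Idx 1) : (omegaH p q).1 α β =
    ∑ μ, (frameVec q α μ * conj (frameVec p β μ) - frameVec p α μ * conj (frameVec q β μ)) := by
  simp [omegaH, Matrix.mul_apply, Finset.sum_sub_distrib]

theorem omegaE_apply (p q : Fr n) (μ ν : Idx n) : (omegaE p q).1 μ ν =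
    ∑ α, (frameVec q α μ * conj (frameVec p α ν) - frameVec p α μ * conj (frameVec q α ν)) := by
  simp [omegaE, Matrix.mul_apply, Finset.sum_sub_distrib]

/-- The tensor `R^H + R^E` is, up to a factor, the curvature of quaternionic projective space. -/
theorem isAlgCurv_omega : IsAlgCurv (fun p q : Fr n => ((omegaH p q, omegaE p q) : hol n)) where
  skew a b := by
    refine Prod.ext (Subtype.ext ?_) (Subtype.ext ?_)
    · change (omegaH b a).1 = -(omegaH a b).1
      simp [omegaH]
    · change (omegaE b a).1 = -(omegaE a b).1
      simp [omegaE]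
  bianchi a b c d := by
    have e : ∀ r s : Fr n, ((frameVec r)ᵀ * (frameVec s).map star)ᵀ =
        (frameVec s)ᴴ * frameVec r := fun r s => by
      rw [Matrix.transpose_mul, Matrix.transpose_transpose]
      rfl
    have h : tangentAct ((omegaH a b, omegaE a b) : hol n) (frameVec c) +
        tangentAct ((omegaH b c, omegaE b c) : hol n) (frameVec a) +
        tangentAct ((omegaH c a, omegaE c a) : hol n) (frameVec b) = 0 := by
      simp only [tangentAct, omegaH, omegaE, Matrix.transpose_sub, e, Matrix.sub_mul,
        Matrix.mul_sub, Matrix.mul_assoc]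
      abel
    have h' := congrArg (coordLin d) h
    rw [map_add, map_add, map_zero] at h'
    exact h'

/-- The inner product on `so(4n)` in complex indices, obtained by summing over the bivectors
`e_p ∧ e_q`. -/
theorem sum_frameVec_wedge (α β γ δ : Idx 1) (μ ν κ l : Idx n) :
    ∑ p : Fr n, ∑ q : Fr n,
      (frameVec q α μ * conj (frameVec p β ν) - frameVec p α μ * conj (frameVec q β ν)) *
      (frameVec q γ κ * conj (frameVec p δ l) - frameVec p γ κ * conj (frameVec q δ l)) =
    2 * (J (Fin 1) ℂ α γ * J (Fin n) ℂ μ κ * (J (Fin 1) ℂ β δ * J (Fin n) ℂ ν l) -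
      (if α = δ ∧ μ = l then 1 else 0) * (if γ = β ∧ κ = ν then 1 else 0)) := by
  have hc : ∑ p : Fr n, conj (frameVec p β ν) * conj (frameVec p δ l) =
      J (Fin 1) ℂ β δ * J (Fin n) ℂ ν l := by
    have h := congrArg conj (sum_frameVec_mul (n := n) β δ ν l)
    simpa only [map_sum, map_mul, conj_J] using h
  have e : ∀ f g : Fr n → ℂ, ∑ p, ∑ q, f p * g q = (∑ p, f p) * ∑ q, g q := fun f g =>
    (Finset.sum_mul_sum _ _ _ _).symm
  have e1 := e (fun p => conj (frameVec p β ν) * conj (frameVec p δ l))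
    (fun q => frameVec q α μ * frameVec q γ κ)
  have e2 := e (fun p => frameVec p γ κ * conj (frameVec p β ν))
    (fun q => frameVec q α μ * conj (frameVec q δ l))
  have e3 := e (fun p => frameVec p α μ * conj (frameVec p δ l))
    (fun q => frameVec q γ κ * conj (frameVec q β ν))
  have e4 := e (fun p => frameVec p α μ * frameVec p γ κ)
    (fun q => conj (frameVec q β ν) * conj (frameVec q δ l))
  rw [hc, sum_frameVec_mul] at e1 e4
  rw [sum_frameVec_mul_conj, sum_frameVec_mul_conj] at e2 e3
  have : ∀ p q : Fr n,
      (frameVec q α μ * conj (frameVec p β ν) - frameVec p α μ * conj (frameVec q β ν)) *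
      (frameVec q γ κ * conj (frameVec p δ l) - frameVec p γ κ * conj (frameVec q δ l)) =
      conj (frameVec p β ν) * conj (frameVec p δ l) * (frameVec q α μ * frameVec q γ κ) -
      frameVec p γ κ * conj (frameVec p β ν) * (frameVec q α μ * conj (frameVec q δ l)) -
      frameVec p α μ * conj (frameVec p δ l) * (frameVec q γ κ * conj (frameVec q β ν)) +
      frameVec p α μ * frameVec p γ κ * (conj (frameVec q β ν) * conj (frameVec q δ l)) :=
    fun p q => by ring
  simp only [this, Finset.sum_add_distrib, Finset.sum_sub_distrib, e1, e2, e3, e4]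
  ring

theorem sum_sum_J_sq (m : ℕ) : ∑ a : Idx m, ∑ b, J (Fin m) ℂ a b * J (Fin m) ℂ a b = 2 * m := by
  simp only [sum_J_mul_J, if_true]
  simp
  ring

theorem sum_sum_delta (m : ℕ) :
    ∑ a : Idx m, ∑ b : Idx m, (if a = b then (1 : ℂ) else 0) * (if b = a then 1 else 0) =
      2 * m := by
  simp
  ring

theorem sum_omegaH_mul_omegaH (α β γ δ : Idx 1) :
    ∑ p : Fr n, ∑ q, (omegaH p q).1 α β * (omegaH p q).1 γ δ =
      2 * n * casimirTensor 1 α β γ δ := by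
  simp only [omegaH_apply, Finset.sum_mul_sum]
  rw [sum_pair_comm]
  simp only [sum_frameVec_wedge]
  have e : ∀ μ κ : Idx n, 2 * (J (Fin 1) ℂ α γ * J (Fin n) ℂ μ κ *
      (J (Fin 1) ℂ β δ * J (Fin n) ℂ μ κ) -
      (if α = δ ∧ μ = κ then 1 else 0) * (if γ = β ∧ κ = μ then 1 else 0)) =
      2 * (J (Fin 1) ℂ α γ * J (Fin 1) ℂ β δ) * (J (Fin n) ℂ μ κ * J (Fin n) ℂ μ κ) -
      2 * ((if α = δ then 1 else 0) * (if β = γ then 1 else 0)) *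
        ((if μ = κ then 1 else 0) * (if κ = μ then 1 else 0)) := fun μ κ => by
    simp only [ite_and, eq_comm (a := γ)]
    split_ifs <;> ring
  simp only [e, Finset.sum_sub_distrib, ← Finset.mul_sum, sum_sum_J_sq, sum_sum_delta,
    casimirTensor]
  ring

theorem sum_omegaE_mul_omegaE (μ ν κ l : Idx n) :
    ∑ p : Fr n, ∑ q, (omegaE p q).1 μ ν * (omegaE p q).1 κ l =
      2 * casimirTensor n μ ν κ l := by
  simp only [omegaE_apply, Finset.sum_mul_sum]
  rw [sum_pair_comm]
  simp only [sum_frameVec_wedge]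
  have e : ∀ α γ : Idx 1, 2 * (J (Fin 1) ℂ α γ * J (Fin n) ℂ μ κ *
      (J (Fin 1) ℂ α γ * J (Fin n) ℂ ν l) -
      (if α = γ ∧ μ = l then 1 else 0) * (if γ = α ∧ κ = ν then 1 else 0)) =
      2 * (J (Fin n) ℂ μ κ * J (Fin n) ℂ ν l) * (J (Fin 1) ℂ α γ * J (Fin 1) ℂ α γ) -
      2 * ((if μ = l then 1 else 0) * (if ν = κ then 1 else 0)) *
        ((if α = γ then 1 else 0) * (if γ = α then 1 else 0)) := fun α γ => by
    simp only [ite_and, eq_comm (a := κ)]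
    split_ifs <;> ring
  simp only [e, Finset.sum_sub_distrib, ← Finset.mul_sum, sum_sum_J_sq, sum_sum_delta,
    casimirTensor]
  push_cast
  ring

theorem sum_omegaH_mul_omegaE (α β : Idx 1) (μ ν : Idx n) :
    ∑ p : Fr n, ∑ q, (omegaH p q).1 α β * (omegaE p q).1 μ ν = 0 := by
  simp only [omegaH_apply, omegaE_apply, Finset.sum_mul_sum]
  rw [sum_pair_comm]
  simp only [sum_frameVec_wedge]
  have e : ∀ (κ : Idx n) (γ : Idx 1), 2 * (J (Fin 1) ℂ α γ * J (Fin n) ℂ κ μ *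
      (J (Fin 1) ℂ β γ * J (Fin n) ℂ κ ν) -
      (if α = γ ∧ κ = ν then 1 else 0) * (if γ = β ∧ μ = κ then 1 else 0)) =
      2 * ((J (Fin n) ℂ κ μ * J (Fin n) ℂ κ ν) * (J (Fin 1) ℂ α γ * J (Fin 1) ℂ β γ)) -
      2 * (((if μ = κ then 1 else 0) * (if κ = ν then 1 else 0)) *
        ((if α = γ then 1 else 0) * (if γ = β then 1 else 0))) := fun κ γ => by
    simp only [ite_and]
    split_ifs <;> ring
  simp only [e, Finset.sum_sub_distrib, ← Finset.mul_sum, ← Finset.sum_mul, sum_J_mul_J,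
    sum_J_mul_J']
  simp

theorem matH_holProj (p q : Fr n) (α β : Idx 1) :
    (holProj p q).1.1 α β = 1 / (2 * n) * (omegaH p q).1 α β := by
  simp [holProj]

theorem matE_holProj (p q : Fr n) (μ ν : Idx n) :
    (holProj p q).2.1 μ ν = 1 / 2 * (omegaE p q).1 μ ν := by
  simp [holProj]

theorem sum_holProj_mul_omegaH (hn : n ≠ 0) (α β γ δ : Idx 1) :
    ∑ p : Fr n, ∑ q, (holProj p q).1.1 α β * (omegaH p q).1 γ δ = casimirTensor 1 α β γ δ := by
  have hn' : (n : ℂ) ≠ 0 := Nat.cast_ne_zero.2 hn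
  simp only [matH_holProj, mul_assoc, ← Finset.mul_sum, sum_omegaH_mul_omegaH]
  field_simp

theorem sum_holProj_mul_omegaE (μ ν κ l : Idx n) :
    ∑ p : Fr n, ∑ q, (holProj p q).2.1 μ ν * (omegaE p q).1 κ l = casimirTensor n μ ν κ l := by
  simp only [matE_holProj, mul_assoc, ← Finset.mul_sum, sum_omegaE_mul_omegaE]
  ring

/-- Up to a factor, `R^H + R^E` acts on the twist as the Casimir operator. -/
theorem sum_tensAct_holProj_omega (hn : n ≠ 0) {l d : ℕ} {T : Tens n l d} (hT : T ∈ twist n l d) :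
    ∑ p, ∑ q, tensAct (holProj p q) (tensAct ((omegaH p q, omegaE p q) : hol n) T) =
      (-2 * (l * (l + 2) + d * (2 * n + 2 - d)) : ℂ) • T := by
  have h := sum_tensAct_casimir (Finset.univ : Finset (Fr n × Fr n))
    (fun k => holProj k.1 k.2) (fun k => ((omegaH k.1 k.2, omegaE k.1 k.2) : hol n)) ?_ ?_ ?_ ?_ hT
  · rw [Fintype.sum_prod_type] at h
    exact h
  · intro α β γ δ
    rw [Fintype.sum_prod_type]
    exact sum_holProj_mul_omegaH hn α β γ δ
  · intro α β γ δ
    rw [Fintype.sum_prod_type]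
    exact sum_holProj_mul_omegaE α β γ δ
  · intro α β μ ν
    rw [Fintype.sum_prod_type]
    simp only [matH_holProj, mul_assoc, ← Finset.mul_sum, sum_omegaH_mul_omegaE, mul_zero]
  · intro α β μ ν
    rw [Fintype.sum_prod_type]
    simp only [matE_holProj, mul_left_comm _ (1 / 2 : ℂ), ← Finset.mul_sum, sum_omegaH_mul_omegaE,
      mul_zero]

theorem sum_casimirTensor (m : ℕ) :
    ∑ a, ∑ b, casimirTensor m a b b a = -(4 * m * (2 * m + 1)) := by
  have e : ∀ a b : Idx m, casimirTensor m a b b a =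
      -2 * (J (Fin m) ℂ a b * J (Fin m) ℂ a b) - 2 := fun a b => by
    rw [casimirTensor, J_swap b a]
    simp
    ring
  simp only [e, Finset.sum_sub_distrib, ← Finset.mul_sum, sum_sum_J_sq]
  simp
  ring

/-- The scalar curvature of `R^H + R^E`. -/
theorem sum_tangentCoeff_omega (hn : n ≠ 0) :
    ∑ p : Fr n, ∑ q, tangentCoeff q p ((omegaH p q, omegaE p q) : hol n) = -(8 * n * (n + 2)) := by
  have h : ((∑ p : Fr n, ∑ q, tangentCoeff q p ((omegaH p q, omegaE p q) : hol n) : ℝ) : ℂ) =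
      ∑ p : Fr n, ∑ q, (n * ((omegaH p q).1 * (holProj p q).1.1).trace +
        ((omegaE p q).1 * (holProj p q).2.1).trace) :=
    isAlgCurv_omega.sum_tangentCoeff_eq_sum_trace hn
  have e : ∀ p q : Fr n, (n * ((omegaH p q).1 * (holProj p q).1.1).trace +
      ((omegaE p q).1 * (holProj p q).2.1).trace) =
      n * (((holProj p q).1.1 * (omegaH p q).1).trace) +
        ((holProj p q).2.1 * (omegaE p q).1).trace := fun p q => by
    rw [Matrix.trace_mul_comm (omegaH p q).1, Matrix.trace_mul_comm (omegaE p q).1]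
  have tH : ∑ p : Fr n, ∑ q, ((holProj p q).1.1 * (omegaH p q).1).trace = -12 := by
    simp only [Matrix.trace, Matrix.diag, Matrix.mul_apply]
    refine (sum_pair_comm _).trans ?_
    simp only [sum_holProj_mul_omegaH hn, sum_casimirTensor]
    norm_num
  have tE : ∑ p : Fr n, ∑ q, ((holProj p q).2.1 * (omegaE p q).1).trace =
      -(4 * n * (2 * n + 1)) := by
    simp only [Matrix.trace, Matrix.diag, Matrix.mul_apply]
    refine (sum_pair_comm _).trans ?_
    simp only [sum_holProj_mul_omegaE, sum_casimirTensor]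
  simp only [e, Finset.sum_add_distrib, ← Finset.mul_sum, tH, tE] at h
  have h' : ((∑ p : Fr n, ∑ q, tangentCoeff q p ((omegaH p q, omegaE p q) : hol n) : ℝ) : ℂ) =
      ((-(8 * n * (n + 2)) : ℝ) : ℂ) := by
    rw [h]
    push_cast
    ring
  exact_mod_cast h'

namespace IsAlgCurv
variable {R : Fr n → Fr n → hol n}

theorem add_smul_omega (hR : IsAlgCurv R) (c' : ℝ) :
    IsAlgCurv (fun p q => R p q + c' • ((omegaH p q, omegaE p q) : hol n)) where
  skew a b := by
    rw [hR.skew a b, isAlgCurv_omega.skew a b]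
    module
  bianchi a b c d := by
    have h1 := hR.bianchi a b c d
    have h2 := isAlgCurv_omega.bianchi a b c d
    simp only [map_add, map_smul, smul_eq_mul] at h1 h2 ⊢
    linear_combination h1 + c' * h2

/-- The multiple of `R^H + R^E` is chosen so that the sum with `R` has vanishing scalar
curvature. -/
theorem sum_tensAct_holProj_hyper (hR : IsAlgCurv R) (hn : 2 ≤ n) {κ : ℝ}
    (hs : ∑ p, ∑ q, tangentCoeff q p (R p q) = κ) {l d : ℕ} {T : Tens n l d}
    (hT : T ∈ twist n l d) :
    ∑ p, ∑ q, tensAct (holProj p q) (tensAct (R p q + (κ / (8 * n * (n + 2)) : ℝ) •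
      ((omegaH p q, omegaE p q) : hol n)) T) = 0 := by
  have hn0 : n ≠ 0 := by omega
  have hnR : (n : ℝ) ≠ 0 := Nat.cast_ne_zero.2 hn0
  refine (hR.add_smul_omega _).sum_tensAct_holProj_eq_zero hn ?_ hT
  have h := sum_tangentCoeff_omega hn0
  simp only [map_add, map_smul, Finset.sum_add_distrib, hs, smul_eq_mul, ← Finset.mul_sum]
  rw [h]
  field_simp
  ring

end IsAlgCurv

end

/-! ### The curvature endomorphism of twisted spinors -/

section
variable {n l d : ℕ}

theorem coe_twistAct (X : hol n) (T : twist n l d) :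
    ((twistAct n l d X T : twist n l d) : Tens n l d) = tensAct X T := rfl

theorem tensAct_add (X Y : hol n) (T : Tens n l d) :
    tensAct (X + Y) T = tensAct X T + tensAct Y T := by
  have e1 : (X + Y).1.1 = X.1.1 + Y.1.1 := rfl
  have e2 : (X + Y).2.1 = X.2.1 + Y.2.1 := rfl
  ext a m
  simp only [tensAct, LinearMap.coe_mk, AddHom.coe_mk, e1, e2, Matrix.add_apply, Pi.add_apply,
    add_mul, Finset.sum_add_distrib]
  ring

theorem tensAct_real_smul (c : ℝ) (X : hol n) (T : Tens n l d) :
    tensAct (c • X) T = (c : ℂ) • tensAct X T := by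
  have e1 : (c • X).1.1 = c • X.1.1 := rfl
  have e2 : (c • X).2.1 = c • X.2.1 := rfl
  ext a m
  simp only [tensAct, LinearMap.coe_mk, AddHom.coe_mk, e1, e2, Matrix.smul_apply, Pi.smul_apply,
    Complex.real_smul, smul_eq_mul, mul_assoc, ← Finset.mul_sum, mul_add]

theorem clifford_compLeft {W : Type*} [AddCommGroup W] [Module ℂ W] (L : W →ₗ[ℂ] W) (p : Fr n)
    (ψ : Finset (Idx n) → W) :
    clifford p (L.compLeft (Finset (Idx n)) ψ) = L.compLeft (Finset (Idx n)) (clifford p ψ) := by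
  ext s
  simp only [clifford, LinearMap.sub_apply, LinearMap.smul_apply, Pi.sub_apply, Pi.smul_apply,
    LinearMap.compLeft_apply, Function.comp_apply, wedge, contract, LinearMap.coe_mk,
    AddHom.coe_mk, map_sub, map_smul]
  congr 2 <;> split_ifs <;> simp

/-- The action of `sp(1) ⊕ sp(n)` on the second factor of `S ⊗ (Sym^l H ⊗ Λ^d_∘ E)`. -/
def twistEnd (n l d : ℕ) : hol n →ₗ[ℝ] Module.End ℂ (TwSpinor n l d) where
  toFun X := (twistAct n l d X : twist n l d →ₗ[ℂ] twist n l d).compLeft (Finset (Idx n))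
  map_add' X Y := LinearMap.ext fun ψ => funext fun s => Subtype.ext (tensAct_add X Y (ψ s).1)
  map_smul' c X := LinearMap.ext fun ψ => funext fun s => Subtype.ext <|
    (tensAct_real_smul c X (ψ s).1).trans (Complex.coe_smul c (tensAct X (ψ s).1))

/-- The action of `sp(1) ⊕ sp(n)` on the first factor of `S ⊗ (Sym^l H ⊗ Λ^d_∘ E)`. -/
def spinEnd (n l d : ℕ) : hol n →ₗ[ℝ] Module.End ℂ (TwSpinor n l d) where
  toFun X := spinAct X
  map_add' X Y := by
    refine LinearMap.ext fun ψ => ?_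
    rw [LinearMap.add_apply]
    simp only [spinAct_apply, map_add, Complex.ofReal_add, add_smul, Finset.sum_add_distrib,
      smul_add]
  map_smul' c X := by
    refine LinearMap.ext fun ψ => ?_
    rw [LinearMap.smul_apply]
    simp only [spinAct_apply, map_smul, smul_eq_mul, RingHom.id_apply, Complex.ofReal_mul, mul_smul,
      ← Finset.smul_sum]
    rw [smul_comm, Complex.coe_smul]

theorem coe_real_smul (c : ℝ) (ψ : TwSpinor n l d) : (c : ℂ) • ψ = c • ψ := algebraMap_smul ℂ c ψ

/-- Clifford multiplication as an element of the algebra of endomorphisms. -/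
def cliffEnd (n l d : ℕ) (p : Fr n) : Module.End ℂ (TwSpinor n l d) := clifford p

theorem cliffEnd_anticomm (p q : Fr n) :
    cliffEnd n l d p * cliffEnd n l d q + cliffEnd n l d q * cliffEnd n l d p =
      (if p = q then (-2 : ℝ) else 0) • (1 : Module.End ℂ (TwSpinor n l d)) := by
  refine LinearMap.ext fun ψ => (clifford_anticomm p q ψ).trans ?_
  split_ifs with h
  · rw [LinearMap.smul_apply, Module.End.one_apply, ← coe_real_smul]
    push_cast
    rfl
  · simp

theorem spinEnd_eq (X : hol n) : spinEnd n l d X =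
    (1 / 4 : ℝ) • ∑ p, ∑ q, tangentCoeff p q X • (cliffEnd n l d p * cliffEnd n l d q) := by
  refine LinearMap.ext fun ψ => (spinAct_apply X ψ).trans ?_
  simp only [LinearMap.smul_apply, LinearMap.sum_apply, Module.End.mul_apply, cliffEnd,
    ← coe_real_smul]
  push_cast
  rfl

theorem twistEnd_mul_cliffEnd (X : hol n) (p : Fr n) :
    twistEnd n l d X * cliffEnd n l d p = cliffEnd n l d p * twistEnd n l d X :=
  LinearMap.ext fun ψ => (clifford_compLeft
    ((twistAct n l d X : twist n l d →ₗ[ℂ] twist n l d)) p ψ).symm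

theorem twistEnd_mul_spinEnd (X Y : hol n) :
    twistEnd n l d X * spinEnd n l d Y = spinEnd n l d Y * twistEnd n l d X := by
  have e : ∀ p q, twistEnd n l d X * (cliffEnd n l d p * cliffEnd n l d q) =
      cliffEnd n l d p * cliffEnd n l d q * twistEnd n l d X := fun p q => by
    rw [← mul_assoc, twistEnd_mul_cliffEnd, mul_assoc, twistEnd_mul_cliffEnd, mul_assoc]
  simp only [spinEnd_eq, Finset.mul_sum, Finset.sum_mul, mul_smul_comm, smul_mul_assoc, e]

theorem coe_twSpinorAct (X : hol n) :
    (twSpinorAct n l d X : TwSpinor n l d →ₗ[ℂ] TwSpinor n l d) =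
      spinEnd n l d X + twistEnd n l d X := rfl

theorem twistEnd_bracket (X Y : hol n) :
    twistEnd n l d ((spBracket X.1 Y.1, spBracket X.2 Y.2) : hol n) =
      twistEnd n l d X * twistEnd n l d Y - twistEnd n l d Y * twistEnd n l d X :=
  LinearMap.ext fun ψ => funext fun s => Subtype.ext (tensAct_bracket X Y (ψ s).1)

theorem spinEnd_bracket (X Y : hol n) :
    spinEnd n l d ((spBracket X.1 Y.1, spBracket X.2 Y.2) : hol n) =
      spinEnd n l d X * spinEnd n l d Y - spinEnd n l d Y * spinEnd n l d X :=
  LinearMap.ext fun ψ => spinAct_bracket X Y ψ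

theorem isRep_twSpinorAct (n l d : ℕ) : IsRep (twSpinorAct n l d) where
  map_add X Y := by
    apply ContinuousLinearMap.coe_injective
    rw [coe_twSpinorAct, map_add, map_add]
    change _ = (spinEnd n l d X + twistEnd n l d X) + (spinEnd n l d Y + twistEnd n l d Y)
    abel
  map_smul c X := by
    apply ContinuousLinearMap.coe_injective
    rw [coe_twSpinorAct, map_smul, map_smul, ← smul_add]
    refine LinearMap.ext fun ψ => ?_
    rw [LinearMap.smul_apply, ← coe_real_smul]
    rfl
  map_lie X Y := by
    apply ContinuousLinearMap.coe_injective
    rw [coe_twSpinorAct, spinEnd_bracket, twistEnd_bracket]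
    change _ = (spinEnd n l d X + twistEnd n l d X) * (spinEnd n l d Y + twistEnd n l d Y) -
      (spinEnd n l d Y + twistEnd n l d Y) * (spinEnd n l d X + twistEnd n l d X)
    simp only [mul_add, add_mul, twistEnd_mul_spinEnd]
    abel

theorem qCurv_twistAct_hyper {R : Fr n → Fr n → hol n} (hR : IsAlgCurv R) (hn : 2 ≤ n) {κ : ℝ}
    (hs : ∑ p, ∑ q, tangentCoeff q p (R p q) = κ) :
    qCurv (twistAct n l d) (fun p q => R p q + (κ / (8 * n * (n + 2)) : ℝ) •
      ((omegaH p q, omegaE p q) : hol n)) = 0 := by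
  refine ContinuousLinearMap.ext fun T => Subtype.ext ?_
  have h := hR.sum_tensAct_holProj_hyper hn hs T.2
  simp only [qCurv, _root_.smul_apply, _root_.sum_apply,
    ContinuousLinearMap.comp_apply, Submodule.coe_smul, Submodule.coe_sum, coe_twistAct, h,
    smul_zero]
  rfl

/-- If `S` is given by Clifford multiplication, then pairing `S` with the curvature amounts to the
Clifford contraction of the curvature. -/
theorem IsAlgCurv.sum_spin_holProj_mul {A : Type*} [Ring A] [Algebra ℝ A]
    {R : Fr n → Fr n → hol n} (hR : IsAlgCurv R) (hn : n ≠ 0) (c : Fr n → A)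
    (S : hol n →ₗ[ℝ] A) (hS : ∀ X, S X = (1 / 4 : ℝ) • ∑ p, ∑ q, tangentCoeff p q X • (c p * c q))
    (Y : hol n →ₗ[ℝ] A) :
    ∑ p, ∑ q, S (holProj p q) * Y (R p q) = (1 / 2 : ℝ) • ∑ p, ∑ q, c p * c q * Y (R p q) := by
  have h1 := hR.sum_bilin hn (V := A) ((LinearMap.mul ℝ A).compl₁₂ LinearMap.id Y)
    (fun p q => c p * c q)
  have h2 := hR.sum_bilin_symm hn (V := A) ((LinearMap.mul ℝ A).compl₁₂ S Y)
  simp only [LinearMap.compl₁₂_apply, LinearMap.mul_apply', LinearMap.id_apply] at h1 h2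
  rw [h1, h2, Finset.smul_sum]
  refine Finset.sum_congr rfl fun p _ => ?_
  rw [Finset.smul_sum]
  refine Finset.sum_congr rfl fun q _ => ?_
  rw [hS, ← smul_mul_assoc, smul_smul]
  norm_num

/-- The curvature endomorphism of a twisted spinor module, in terms of the Clifford contraction of
the curvature: `S` and `T` are the actions on the spinor module and on the twist. -/
theorem IsAlgCurv.sum_spin_add_twist {A : Type*} [Ring A] [Algebra ℝ A]
    {R : Fr n → Fr n → hol n} (hR : IsAlgCurv R) (hn : n ≠ 0) (c : Fr n → A)
    (hc : ∀ p q, c p * c q + c q * c p = (if p = q then (-2 : ℝ) else 0) • (1 : A))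
    (S T : hol n →ₗ[ℝ] A)
    (hS : ∀ X, S X = (1 / 4 : ℝ) • ∑ p, ∑ q, tangentCoeff p q X • (c p * c q))
    (hST : ∀ X Y, T X * S Y = S Y * T X) {κ t : ℝ}
    (hκ : ∑ p, ∑ q, tangentCoeff q p (R p q) = κ)
    (ht : ∑ p, ∑ q, T (holProj p q) * T (R p q) = t • (1 : A)) :
    (1 / 2 : ℝ) • ∑ p, ∑ q, (S (holProj p q) + T (holProj p q)) * (S (R p q) + T (R p q)) =
      (1 / 2 : ℝ) • ∑ p, ∑ q, c p * c q * (S (R p q) + T (R p q)) +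
        (t / 2 - κ / 8) • (1 : A) := by
  have h1 := hR.sum_spin_holProj_mul hn c S hS S
  have h2 := hR.sum_spin_holProj_mul hn c S hS T
  have h3 : ∑ p, ∑ q, T (holProj p q) * S (R p q) = ∑ p, ∑ q, S (holProj p q) * T (R p q) := by
    have h := hR.sum_bilin_symm hn (V := A) ((LinearMap.mul ℝ A).compl₁₂ S T)
    simp only [LinearMap.compl₁₂_apply, LinearMap.mul_apply'] at h
    rw [h]
    exact Finset.sum_congr rfl fun p _ => Finset.sum_congr rfl fun q _ => hST _ _
  -- the Lichnerowicz formula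
  have h4 : ∑ p, ∑ q, c p * c q * S (R p q) = (κ / 2) • (1 : A) := by
    have h := sum_clifford_curvature c hc
      (fun p q r s => tangentCoeff r s (R p q)) (fun a b c d => hR.coeff_skew b a c d)
      (fun a b c d => hR.pair_symm a b c d) (fun a b c d => hR.bianchi a b c d)
    simp only [hS, mul_smul_comm, Finset.mul_sum, ← Finset.smul_sum]
    rw [h, smul_smul, hκ]
    congr 1
    ring
  simp only [mul_add, add_mul, Finset.sum_add_distrib]
  rw [h3, h1, h2, h4, ht]
  module

/-- The twist only sees the part `-κ / (8n(n+2)) (R^H + R^E)` of the curvature, which acts on it as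
the Casimir operator. -/
theorem IsAlgCurv.sum_twistEnd {R : Fr n → Fr n → hol n} (hR : IsAlgCurv R) (hn : 2 ≤ n) {κ : ℝ}
    (hs : ∑ p, ∑ q, tangentCoeff q p (R p q) = κ) :
    ∑ p, ∑ q, twistEnd n l d (holProj p q) * twistEnd n l d (R p q) =
      (κ / (8 * n * (n + 2)) * (2 * (l * (l + 2) + d * (2 * n + 2 - d))) : ℝ) • 1 := by
  refine LinearMap.ext fun ψ => funext fun s => Subtype.ext ?_
  have h1 := hR.sum_tensAct_holProj_hyper hn hs (ψ s).2
  have h2 := sum_tensAct_holProj_omega (by omega : n ≠ 0) (ψ s).2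
  simp only [tensAct_add, tensAct_real_smul, map_add, map_smul, Finset.sum_add_distrib,
    ← Finset.smul_sum, h2] at h1
  rw [LinearMap.smul_apply, ← coe_real_smul, Module.End.one_apply]
  simp only [LinearMap.sum_apply, Finset.sum_apply, Submodule.coe_sum]
  refine (eq_neg_of_add_eq_zero_left h1).trans ?_
  rw [smul_smul, ← neg_smul]
  change _ = _ • (ψ s).1
  congr 1
  push_cast
  ring

/-- The curvature endomorphism on `S ⊗ (Sym^l H ⊗ Λ^d_∘ E)` differs from the curvature term of the
Weitzenböck formula by a scalar: half of the Casimir eigenvalue of the twist from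
`IsAlgCurv.sum_twistEnd`, minus `κ / 8` from the Lichnerowicz formula. -/
theorem IsAlgCurv.qCurv_twSpinorAct {R : Fr n → Fr n → hol n} (hR : IsAlgCurv R) (hn : 2 ≤ n)
    {κ : ℝ} (hκ : ∑ p, ∑ q, tangentCoeff q p (R p q) = κ) (ψ : TwSpinor n l d) :
    (2 : ℂ) • qCurv (twSpinorAct n l d) R ψ =
      (1 / 2 : ℝ) • ∑ p, ∑ q, clifford p (clifford q (twSpinorAct n l d (R p q) ψ)) +
        (κ / (8 * n * (n + 2)) * (l + d - n) * (l - d + n + 2) : ℝ) • ψ := by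
  have hn0 : n ≠ 0 := by omega
  have hnR : (n : ℝ) ≠ 0 := Nat.cast_ne_zero.2 hn0
  have ht := hR.sum_twistEnd (l := l) (d := d) hn hκ
  have key := hR.sum_spin_add_twist (A := Module.End ℂ (TwSpinor n l d)) hn0 (cliffEnd n l d)
    cliffEnd_anticomm (spinEnd n l d) (twistEnd n l d) spinEnd_eq
  replace key := key twistEnd_mul_spinEnd (κ := κ)
    (t := κ / (8 * n * (n + 2)) * (2 * (l * (l + 2) + d * (2 * n + 2 - d)))) hκ ht
  have e : κ / (8 * n * (n + 2)) * (2 * (l * (l + 2) + d * (2 * n + 2 - d))) / 2 - κ / 8 =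
      κ / (8 * n * (n + 2)) * (l + d - n) * (l - d + n + 2) := by
    field_simp
    ring
  rw [e] at key
  simp only [← coe_twSpinorAct] at key
  have key' := LinearMap.congr_fun key ψ
  simp only [LinearMap.add_apply (M := TwSpinor n l d), LinearMap.smul_apply (M := TwSpinor n l d),
    LinearMap.sum_apply (M := TwSpinor n l d), Module.End.mul_apply (M := TwSpinor n l d),
    Module.End.one_apply (M := TwSpinor n l d)] at key'
  have hL : (2 : ℂ) • qCurv (twSpinorAct n l d) R ψ = ((1 / 2 : ℝ) : ℂ) •
      ∑ p, ∑ q, twSpinorAct n l d (holProj p q) (twSpinorAct n l d (R p q) ψ) := by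
    simp only [qCurv, _root_.smul_apply, _root_.sum_apply, ContinuousLinearMap.comp_apply,
      smul_smul]
    congr 1
    norm_num
  rw [hL, coe_real_smul]
  exact key'

end

/-! ### Directional derivatives and Lie brackets -/

section
variable {n : ℕ} {M : Type*} [TopologicalSpace M]
    [ChartedSpace (EuclideanSpace ℝ (Fin (4 * n))) M]
    {V₁ V₂ V₃ : Type*} [NormedAddCommGroup V₁] [NormedSpace ℝ V₁] [NormedAddCommGroup V₂]
    [NormedSpace ℝ V₂] [NormedAddCommGroup V₃] [NormedSpace ℝ V₃]

theorem dirDeriv_congr {f g : M → V₁} {x : M} (h : f =ᶠ[nhds x] g)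
    (v : TangentSpace (𝓡 (4 * n)) x) : dirDeriv f x v = dirDeriv g x v :=
  congrArg (fun T : TangentSpace (𝓡 (4 * n)) x →L[ℝ] V₁ => T v) h.mfderiv_eq

theorem dirDeriv_clm (L : V₁ →L[ℝ] V₂) {f : M → V₁} {x : M}
    (hf : MDifferentiableAt (𝓡 (4 * n)) 𝓘(ℝ, V₁) f x) (v : TangentSpace (𝓡 (4 * n)) x) :
    dirDeriv (fun y => L (f y)) x v = L (dirDeriv f x v) := by
  have h := (L.hasMFDerivAt (x := f x)).comp x hf.hasMFDerivAt
  exact congrArg (fun T : TangentSpace (𝓡 (4 * n)) x →L[ℝ] V₂ => T v) h.mfderiv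

theorem dirDeriv_bilin (L : V₁ →L[ℝ] V₂ →L[ℝ] V₃) {f : M → V₁} {g : M → V₂} {x : M}
    (hf : MDifferentiableAt (𝓡 (4 * n)) 𝓘(ℝ, V₁) f x)
    (hg : MDifferentiableAt (𝓡 (4 * n)) 𝓘(ℝ, V₂) g x) (v : TangentSpace (𝓡 (4 * n)) x) :
    dirDeriv (fun y => L (f y) (g y)) x v =
      L (dirDeriv f x v) (g x) + L (f x) (dirDeriv g x v) := by
  have h1 : HasMFDerivAt (𝓡 (4 * n)) 𝓘(ℝ, V₁ × V₂) (fun y => (f y, g y)) x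
      (ContinuousLinearMap.prod (mfderiv (𝓡 (4 * n)) 𝓘(ℝ, V₁) f x :
        EuclideanSpace ℝ (Fin (4 * n)) →L[ℝ] V₁) (mfderiv (𝓡 (4 * n)) 𝓘(ℝ, V₂) g x :
        EuclideanSpace ℝ (Fin (4 * n)) →L[ℝ] V₂)) :=
    ⟨hf.hasMFDerivAt.1.prodMk hg.hasMFDerivAt.1, hf.hasMFDerivAt.2.prodMk hg.hasMFDerivAt.2⟩
  have h2 := (L.isBoundedBilinearMap.hasFDerivAt (f x, g x)).hasMFDerivAt
  have h := h2.comp x h1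
  refine (congrArg (fun T : TangentSpace (𝓡 (4 * n)) x →L[ℝ] V₃ => T v) h.mfderiv).trans ?_
  exact add_comm _ _

theorem dirDeriv_add {f g : M → V₁} {x : M}
    (hf : MDifferentiableAt (𝓡 (4 * n)) 𝓘(ℝ, V₁) f x)
    (hg : MDifferentiableAt (𝓡 (4 * n)) 𝓘(ℝ, V₁) g x) (v : TangentSpace (𝓡 (4 * n)) x) :
    dirDeriv (fun y => f y + g y) x v = dirDeriv f x v + dirDeriv g x v :=
  congrArg (fun T : TangentSpace (𝓡 (4 * n)) x →L[ℝ] V₁ => T v)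
    (hf.hasMFDerivAt.add hg.hasMFDerivAt).mfderiv

theorem dirDeriv_neg (f : M → V₁) (x : M) (v : TangentSpace (𝓡 (4 * n)) x) :
    dirDeriv (fun y => - f y) x v = - dirDeriv f x v := by
  have := mfderiv_neg (I := 𝓡 (4 * n)) (f := f) (x := x)
  exact congrArg (fun T : TangentSpace (𝓡 (4 * n)) x →L[ℝ] V₁ => T v) this

theorem dirDeriv_sub {f g : M → V₁} {x : M}
    (hf : MDifferentiableAt (𝓡 (4 * n)) 𝓘(ℝ, V₁) f x)
    (hg : MDifferentiableAt (𝓡 (4 * n)) 𝓘(ℝ, V₁) g x) (v : TangentSpace (𝓡 (4 * n)) x) :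
    dirDeriv (fun y => f y - g y) x v = dirDeriv f x v - dirDeriv g x v :=
  congrArg (fun T : TangentSpace (𝓡 (4 * n)) x →L[ℝ] V₁ => T v)
    (hf.hasMFDerivAt.sub hg.hasMFDerivAt).mfderiv

theorem dirDeriv_const (c : V₁) (x : M) (v : TangentSpace (𝓡 (4 * n)) x) :
    dirDeriv (fun _ : M => c) x v = 0 := by
  unfold dirDeriv
  rw [mfderiv_const]; rfl

theorem mdifferentiableAt_sum {κ : Type*} (s : Finset κ) {f : κ → M → V₁} {x : M}
    (hf : ∀ k ∈ s, MDifferentiableAt (𝓡 (4 * n)) 𝓘(ℝ, V₁) (f k) x) :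
    MDifferentiableAt (𝓡 (4 * n)) 𝓘(ℝ, V₁) (fun y => ∑ k ∈ s, f k y) x := by
  classical
  induction s using Finset.induction_on with
  | empty => simpa using mdifferentiableAt_const
  | insert a s ha ih =>
    simp only [Finset.sum_insert ha]
    exact (hf a (Finset.mem_insert_self a s)).add
      (ih fun k hk => hf k (Finset.mem_insert_of_mem hk))

theorem dirDeriv_sum {κ : Type*} (s : Finset κ) {f : κ → M → V₁} {x : M}
    (hf : ∀ k ∈ s, MDifferentiableAt (𝓡 (4 * n)) 𝓘(ℝ, V₁) (f k) x)
    (v : TangentSpace (𝓡 (4 * n)) x) :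
    dirDeriv (fun y => ∑ k ∈ s, f k y) x v = ∑ k ∈ s, dirDeriv (f k) x v := by
  classical
  induction s using Finset.induction_on with
  | empty => simpa using dirDeriv_const (0 : V₁) x v
  | insert a s ha ih =>
    have h1 : ∀ k ∈ s, MDifferentiableAt (𝓡 (4 * n)) 𝓘(ℝ, V₁) (f k) x := fun k hk =>
      hf k (Finset.mem_insert_of_mem hk)
    simp only [Finset.sum_insert ha]
    rw [dirDeriv_add (hf a (Finset.mem_insert_self a s)) (mdifferentiableAt_sum s h1), ih h1]

variable [IsManifold (𝓡 (4 * n)) ∞ M]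

theorem contMDiffOn_dirDeriv {f : M → V₁} {U : Set M} (hU : IsOpen U) {X : VField n M}
    (hf : ContMDiffOn (𝓡 (4 * n)) 𝓘(ℝ, V₁) ∞ f U)
    (hX : ContMDiffOn (𝓡 (4 * n)) (𝓡 (4 * n)).tangent ∞
      (fun x => (⟨x, X x⟩ : TangentBundle (𝓡 (4 * n)) M)) U) :
    ContMDiffOn (𝓡 (4 * n)) 𝓘(ℝ, V₁) ∞ (fun y => dirDeriv f y (X y)) U := by
  have h1 := hf.contMDiffOn_tangentMapWithin (m := ∞) (by simp) hU.uniqueMDiffOn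
  have h2 := (contMDiff_snd_tangentBundle_modelSpace V₁ 𝓘(ℝ, V₁) (n := ∞)).comp_contMDiffOn
    (h1.comp hX (fun x hx => hx))
  refine h2.congr fun y hy => ?_
  change _ = mfderivWithin (𝓡 (4 * n)) 𝓘(ℝ, V₁) f U y (X y)
  rw [mfderivWithin_of_isOpen hU hy]
  rfl

/-- The vector field `X` is smooth on `U`. -/
abbrev SmoothFieldOn (X : VField n M) (U : Set M) : Prop :=
  ContMDiffOn (𝓡 (4 * n)) (𝓡 (4 * n)).tangent ∞
    (fun x => (⟨x, X x⟩ : TangentBundle (𝓡 (4 * n)) M)) U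

theorem SmoothFieldOn.mdifferentiableAt {X : VField n M} {U : Set M} (hU : IsOpen U)
    (hX : SmoothFieldOn X U) {x : M} (hx : x ∈ U) :
    MDifferentiableAt (𝓡 (4 * n)) (𝓡 (4 * n)).tangent
      (fun x => (⟨x, X x⟩ : TangentBundle (𝓡 (4 * n)) M)) x :=
  (hX.contMDiffAt (hU.mem_nhds hx)).mdifferentiableAt (by simp)

theorem smoothFieldOn_mlieBracket {X Y : VField n M} {U : Set M} (hU : IsOpen U)
    (hX : SmoothFieldOn X U) (hY : SmoothFieldOn Y U) :
    SmoothFieldOn (VectorField.mlieBracket (𝓡 (4 * n)) X Y) U := fun x hx =>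
  have : IsManifold (𝓡 (4 * n)) (minSmoothness ℝ 2) M := by
    simp only [minSmoothness_of_isRCLikeNormedField]; infer_instance
  have : IsManifold (𝓡 (4 * n)) (((⊤ : ℕ∞) : WithTop ℕ∞) + 1) M := ‹IsManifold (𝓡 (4 * n)) ∞ M›
  (ContMDiffAt.mlieBracket_vectorField (m := ⊤) (n := ⊤) (hX.contMDiffAt (hU.mem_nhds hx))
    (hY.contMDiffAt (hU.mem_nhds hx)) (by simp)).contMDiffWithinAt

theorem mlieBracket_smul_dirDeriv {X Y : VField n M} {U : Set M} (hU : IsOpen U)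
    (hY : SmoothFieldOn Y U) {f : M → ℝ} (hf : ContMDiffOn (𝓡 (4 * n)) 𝓘(ℝ, ℝ) ∞ f U)
    {x : M} (hx : x ∈ U) :
    VectorField.mlieBracket (𝓡 (4 * n)) X (fun y => f y • Y y) x =
      dirDeriv f x (X x) • Y x + f x • VectorField.mlieBracket (𝓡 (4 * n)) X Y x :=
  have : IsManifold (𝓡 (4 * n)) 2 M := inferInstance
  VectorField.mlieBracket_smul_right
    ((hf.contMDiffAt (hU.mem_nhds hx)).mdifferentiableAt (by simp)) (hY.mdifferentiableAt hU hx)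

theorem leibniz_identity_of_smoothFieldOn {X Y Z : VField n M} {U : Set M} (hU : IsOpen U)
    (hX : SmoothFieldOn X U) (hY : SmoothFieldOn Y U) (hZ : SmoothFieldOn Z U) {x : M}
    (hx : x ∈ U) :
    VectorField.mlieBracket (𝓡 (4 * n)) X (VectorField.mlieBracket (𝓡 (4 * n)) Y Z) x =
      VectorField.mlieBracket (𝓡 (4 * n)) (VectorField.mlieBracket (𝓡 (4 * n)) X Y) Z x +
      VectorField.mlieBracket (𝓡 (4 * n)) Y (VectorField.mlieBracket (𝓡 (4 * n)) X Z) x := by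
  have : IsManifold (𝓡 (4 * n)) (minSmoothness ℝ 3) M := by
    simp only [minSmoothness_of_isRCLikeNormedField]; infer_instance
  have h2 : minSmoothness ℝ 2 ≤ (∞ : WithTop ℕ∞) := by
    simp only [minSmoothness_of_isRCLikeNormedField]
    exact WithTop.coe_le_coe.2 le_top
  exact VectorField.leibniz_identity_mlieBracket_apply
    ((hX.contMDiffAt (hU.mem_nhds hx)).of_le h2) ((hY.contMDiffAt (hU.mem_nhds hx)).of_le h2)
    ((hZ.contMDiffAt (hU.mem_nhds hx)).of_le h2)

open VectorField in
/-- The Lie bracket of vector fields is the commutator of the derivations they define. This is read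
off from the Leibniz identity for `X`, `Y` and `f • X`, whose `X`-component at `x` can be cancelled
since `X x ≠ 0`. -/
theorem dirDeriv_mlieBracket_scalar {f : M → ℝ} {U : Set M} (hU : IsOpen U) {X Y : VField n M}
    (hf : ContMDiffOn (𝓡 (4 * n)) 𝓘(ℝ, ℝ) ∞ f U)
    (hX : SmoothFieldOn X U) (hY : SmoothFieldOn Y U) {x : M} (hx : x ∈ U) (h0 : X x ≠ 0) :
    dirDeriv (fun y => dirDeriv f y (Y y)) x (X x) - dirDeriv (fun y => dirDeriv f y (X y)) x (Y x)
      = dirDeriv f x (mlieBracket (𝓡 (4 * n)) X Y x) := by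
  have : IsManifold (𝓡 (4 * n)) 2 M := inferInstance
  have hfX : SmoothFieldOn (fun y => f y • X y) U := hf.smul_section hX
  have hYX := smoothFieldOn_mlieBracket hU hY hX
  have hYf := contMDiffOn_dirDeriv hU hf hY
  have hXf := contMDiffOn_dirDeriv hU hf hX
  have hJ := leibniz_identity_of_smoothFieldOn hU hX hY hfX hx
  have e1 : mlieBracket (𝓡 (4 * n)) Y (fun y => f y • X y) =ᶠ[nhds x]
      (fun y => dirDeriv f y (Y y) • X y) + (fun y => f y • mlieBracket (𝓡 (4 * n)) Y X y) := by
    filter_upwards [hU.mem_nhds hx] with y hy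
    exact mlieBracket_smul_dirDeriv hU hX hf hy
  have e2 : mlieBracket (𝓡 (4 * n)) X (fun y => f y • X y) =ᶠ[nhds x]
      (fun y => dirDeriv f y (X y) • X y) := by
    filter_upwards [hU.mem_nhds hx] with y hy
    rw [mlieBracket_smul_dirDeriv hU hX hf hy, mlieBracket_self, Pi.zero_apply, smul_zero, add_zero]
  rw [(Filter.EventuallyEq.refl _ X).mlieBracket_vectorField_eq e1,
    (Filter.EventuallyEq.refl _ Y).mlieBracket_vectorField_eq e2,
    mlieBracket_add_right (V := X) (W := fun y => dirDeriv f y (Y y) • X y)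
      (W₁ := fun y => f y • mlieBracket (𝓡 (4 * n)) Y X y)
      (SmoothFieldOn.mdifferentiableAt hU (hYf.smul_section hX) hx)
      (SmoothFieldOn.mdifferentiableAt hU (hf.smul_section hYX) hx),
    mlieBracket_smul_dirDeriv hU hX hYf hx, mlieBracket_smul_dirDeriv hU hYX hf hx,
    mlieBracket_smul_dirDeriv hU hX hf hx, mlieBracket_smul_dirDeriv hU hX hXf hx] at hJ
  have hJ' := leibniz_identity_of_smoothFieldOn hU hX hY hX hx
  simp only [mlieBracket_self, Pi.zero_apply, smul_zero, add_zero, mlieBracket_zero_right] at hJ hJ'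
  rw [hJ'] at hJ
  have h2 : (dirDeriv (fun y => dirDeriv f y (Y y)) x (X x) -
      dirDeriv (fun y => dirDeriv f y (X y)) x (Y x)
      - dirDeriv f x (mlieBracket (𝓡 (4 * n)) X Y x)) • X x = 0 := by
    rw [sub_smul, sub_smul]
    linear_combination (norm := module) hJ
  exact sub_eq_zero.1 ((smul_eq_zero.1 h2).resolve_right h0)

/-- The commutator of the derivatives along `X` and `Y` is the derivative along `[X, Y]`, for vector
valued functions at points where `X` does not vanish. -/
theorem dirDeriv_mlieBracket {f : M → V₁} {U : Set M} (hU : IsOpen U) {X Y : VField n M}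
    (hf : ContMDiffOn (𝓡 (4 * n)) 𝓘(ℝ, V₁) ∞ f U)
    (hX : SmoothFieldOn X U) (hY : SmoothFieldOn Y U) {x : M} (hx : x ∈ U) (h0 : X x ≠ 0) :
    dirDeriv (fun y => dirDeriv f y (Y y)) x (X x) - dirDeriv (fun y => dirDeriv f y (X y)) x (Y x)
      = dirDeriv f x (VectorField.mlieBracket (𝓡 (4 * n)) X Y x) := by
  refine (SeparatingDual.eq_iff_forall_dual_eq (R := ℝ)).2 fun L => ?_
  have hd : ∀ {g : M → V₁}, ContMDiffOn (𝓡 (4 * n)) 𝓘(ℝ, V₁) ∞ g U → ∀ y ∈ U,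
      MDifferentiableAt (𝓡 (4 * n)) 𝓘(ℝ, V₁) g y := fun hg y hy =>
    (hg.contMDiffAt (hU.mem_nhds hy)).mdifferentiableAt (by simp)
  have key : ∀ {Z T : VField n M}, SmoothFieldOn Z U →
      dirDeriv (fun y => dirDeriv (fun z => L (f z)) y (Z y)) x (T x) =
      L (dirDeriv (fun y => dirDeriv f y (Z y)) x (T x)) := by
    intro Z T hZ
    rw [← dirDeriv_clm L (hd (contMDiffOn_dirDeriv hU hf hZ) x hx)]
    refine dirDeriv_congr ?_ _
    filter_upwards [hU.mem_nhds hx] with y hy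
    exact dirDeriv_clm L (hd hf y hy) _
  have := dirDeriv_mlieBracket_scalar hU (f := fun z => L (f z))
    (L.contMDiff.comp_contMDiffOn hf) hX hY hx h0
  rw [key hY, key hX, dirDeriv_clm L (hd hf x hx)] at this
  rw [map_sub]
  exact this
end

/-! ### Local frames and the Levi-Civita connection -/

section
variable {n : ℕ} {M : Type*} [TopologicalSpace M] [ChartedSpace (EuclideanSpace ℝ (Fin (4 * n))) M]
  {V V' : Type*} [NormedAddCommGroup V] [NormedSpace ℝ V] [NormedAddCommGroup V'] [NormedSpace ℝ V']

/-- The vector valued function `f` is smooth on `U`. -/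
abbrev SmoothFunOn (n : ℕ) {M : Type*} [TopologicalSpace M]
    [ChartedSpace (EuclideanSpace ℝ (Fin (4 * n))) M] {V : Type*} [NormedAddCommGroup V]
    [NormedSpace ℝ V] (f : M → V) (U : Set M) : Prop := ContMDiffOn (𝓡 (4 * n)) 𝓘(ℝ, V) ∞ f U

theorem SmoothFunOn.congr {f g : M → V} {U : Set M} (hf : SmoothFunOn n f U)
    (h : ∀ x ∈ U, g x = f x) : SmoothFunOn n g U := ContMDiffOn.congr hf h

theorem smoothFunOn_sum_smul {K : Type*} (s : Finset K) (f : K → M → ℝ) (v : K → V) {U : Set M}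
    (hf : ∀ k ∈ s, SmoothFunOn n (f k) U) : SmoothFunOn n (fun x => ∑ k ∈ s, f k x • v k) U := by
  exact contMDiffOn_finsetSum fun k hk => (hf k hk).smul contMDiffOn_const

theorem SmoothFunOn.linear_comp [FiniteDimensional ℝ V] {f : M → V} {U : Set M}
    (hf : SmoothFunOn n f U) (L : V →ₗ[ℝ] V') : SmoothFunOn n (fun x => L (f x)) U :=
  (LinearMap.toContinuousLinearMap L).contMDiff.comp_contMDiffOn hf

theorem SmoothFunOn.mdifferentiableAt {f : M → V} {U : Set M} (hf : SmoothFunOn n f U)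
    (hU : IsOpen U) {x : M} (hx : x ∈ U) : MDifferentiableAt (𝓡 (4 * n)) 𝓘(ℝ, V) f x :=
  (hf.contMDiffAt (hU.mem_nhds hx)).mdifferentiableAt (by simp)

theorem SmoothFunOn.dirDeriv_linear_comp [FiniteDimensional ℝ V] {f : M → V} {U : Set M}
    (hf : SmoothFunOn n f U) (hU : IsOpen U) {x : M} (hx : x ∈ U) (L : V →ₗ[ℝ] V')
    (v : TangentSpace (𝓡 (4 * n)) x) :
    dirDeriv (fun y => L (f y)) x v = L (dirDeriv f x v) :=
  dirDeriv_clm (LinearMap.toContinuousLinearMap L) (hf.mdifferentiableAt hU hx) v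

theorem finiteDimensional_sp (m : ℕ) : FiniteDimensional ℝ (sp m) :=
  FiniteDimensional.of_injective (spIncl m) fun _ _ h => Subtype.ext h

instance finiteDimensional_hol (n : ℕ) : FiniteDimensional ℝ (hol n) :=
  have := finiteDimensional_sp 1
  have := finiteDimensional_sp n
  inferInstance

end

namespace QKStructure

variable {n : ℕ} {M : Type*} [TopologicalSpace M] [ChartedSpace (EuclideanSpace ℝ (Fin (4 * n))) M]
  [IsManifold (𝓡 (4 * n)) ∞ M] [RiemannianBundle (fun x : M => TangentSpace (𝓡 (4 * n)) x)]
  {ι : Type*} (Q : QKStructure n M ι)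

/-- The structure functions `⟨[s_a, s_b], s_c⟩` of the `i`-th frame. -/
def structCoeff (i : ι) (a b c : Fr n) (x : M) : ℝ :=
  inner ℝ (VectorField.mlieBracket (𝓡 (4 * n)) (Q.frame i a) (Q.frame i b) x) (Q.frame i c x)

/-- The Christoffel symbols `⟨∇_{s_a} s_b, s_c⟩` of the `i`-th frame. -/
def christoffel (i : ι) (a b c : Fr n) (x : M) : ℝ := tangentCoeff b c (Q.conn i a x)

theorem structCoeff_swap (i : ι) (a b c : Fr n) (x : M) :
    Q.structCoeff i b a c x = -Q.structCoeff i a b c x := by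
  unfold structCoeff
  rw [VectorField.mlieBracket_swap_apply, inner_neg_left]

theorem koszul_frame_eq {i : ι} {x : M} (hx : x ∈ Q.U i) (a b c : Fr n) :
    koszul (Q.frame i a) (Q.frame i b) (Q.frame i c) x = Q.christoffel i a b c x :=
  Q.leviCivita i x hx a b c

theorem christoffel_eq {i : ι} {x : M} (hx : x ∈ Q.U i) (a b c : Fr n) :
    Q.christoffel i a b c x =
      (Q.structCoeff i a b c x - Q.structCoeff i b c a x + Q.structCoeff i c a b x) / 2 :=
  (Q.koszul_frame_eq hx a b c).symm

theorem christoffel_skew (i : ι) (a b c : Fr n) (x : M) :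
    Q.christoffel i a c b x = -Q.christoffel i a b c x := tangentCoeff_skew _ _ _

/-- The Levi-Civita connection is torsion free. -/
theorem christoffel_sub_christoffel {i : ι} {x : M} (hx : x ∈ Q.U i) (a b c : Fr n) :
    Q.christoffel i a b c x - Q.christoffel i b a c x = Q.structCoeff i a b c x := by
  rw [Q.christoffel_eq hx, Q.christoffel_eq hx]
  linarith [Q.structCoeff_swap i a b c x, Q.structCoeff_swap i b c a x,
    Q.structCoeff_swap i c a b x]

theorem frame_ne_zero {i : ι} {x : M} (hx : x ∈ Q.U i) (a : Fr n) : Q.frame i a x ≠ 0 := by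
  intro h
  have h1 := Q.orthonormal i x hx a a
  rw [h, inner_zero_left] at h1
  simp at h1

theorem eq_sum_inner_frame {i : ι} {x : M} (hx : x ∈ Q.U i) (v : TangentSpace (𝓡 (4 * n)) x) :
    v = ∑ c, inner ℝ v (Q.frame i c x) • Q.frame i c x := by
  have ho : Orthonormal ℝ (fun c => Q.frame i c x) := by
    rw [orthonormal_iff_ite]
    exact Q.orthonormal i x hx
  have : FiniteDimensional ℝ (TangentSpace (𝓡 (4 * n)) x) :=
    inferInstanceAs (FiniteDimensional ℝ (EuclideanSpace ℝ (Fin (4 * n))))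
  have hcard : Fintype.card (Fr n) = Module.finrank ℝ (TangentSpace (𝓡 (4 * n)) x) := by
    have h : Module.finrank ℝ (TangentSpace (𝓡 (4 * n)) x) = 4 * n :=
      (finrank_euclideanSpace_fin (𝕜 := ℝ) (n := 4 * n))
    rw [h]
    simp
    ring
  have hspan : ⊤ ≤ Submodule.span ℝ (Set.range fun c => Q.frame i c x) := by
    rw [ho.linearIndependent.span_eq_top_of_card_eq_finrank' hcard]
  have h := (OrthonormalBasis.mk ho hspan).sum_repr' v
  simp only [OrthonormalBasis.coe_mk] at h
  conv_lhs => rw [← h]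
  exact Finset.sum_congr rfl fun c _ => by rw [real_inner_comm]

theorem mlieBracket_frame {i : ι} {x : M} (hx : x ∈ Q.U i) (a b : Fr n) :
    VectorField.mlieBracket (𝓡 (4 * n)) (Q.frame i a) (Q.frame i b) x =
      ∑ c, Q.structCoeff i a b c x • Q.frame i c x :=
  Q.eq_sum_inner_frame hx _

variable {V : Type*} [NormedAddCommGroup V] [NormedSpace ℝ V]

/-- The derivative of a function in the direction of a vector of the `i`-th frame. -/
def frameDeriv (i : ι) (a : Fr n) (f : M → V) (x : M) : V := dirDeriv f x (Q.frame i a x)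

theorem smoothFunOn_frameDeriv {i : ι} {f : M → V}
    (hf : SmoothFunOn n f (Q.U i)) (a : Fr n) :
    SmoothFunOn n (Q.frameDeriv i a f) (Q.U i) :=
  contMDiffOn_dirDeriv (Q.isOpen i) hf (Q.smooth i a)

theorem frameDeriv_congr {i : ι} {f g : M → V} (h : ∀ y ∈ Q.U i, f y = g y) {x : M}
    (hx : x ∈ Q.U i) (a : Fr n) : Q.frameDeriv i a f x = Q.frameDeriv i a g x :=
  dirDeriv_congr (Filter.eventuallyEq_of_mem ((Q.isOpen i).mem_nhds hx) h) _

theorem frameDeriv_comm {i : ι} {f : M → V}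
    (hf : SmoothFunOn n f (Q.U i)) {x : M} (hx : x ∈ Q.U i) (a b : Fr n) :
    Q.frameDeriv i a (Q.frameDeriv i b f) x - Q.frameDeriv i b (Q.frameDeriv i a f) x =
      ∑ c, Q.structCoeff i a b c x • Q.frameDeriv i c f x := by
  refine (dirDeriv_mlieBracket (Q.isOpen i) hf (Q.smooth i a) (Q.smooth i b) hx
    (Q.frame_ne_zero hx a)).trans ?_
  rw [Q.mlieBracket_frame hx]
  unfold dirDeriv frameDeriv
  rw [map_sum]
  exact Finset.sum_congr rfl fun c _ => map_smul _ _ _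

variable [IsContMDiffRiemannianBundle (𝓡 (4 * n)) ∞ (EuclideanSpace ℝ (Fin (4 * n)))
      (fun x : M => TangentSpace (𝓡 (4 * n)) x)]

theorem smoothFunOn_structCoeff (i : ι) (a b c : Fr n) :
    SmoothFunOn n (Q.structCoeff i a b c) (Q.U i) :=
  ContMDiffOn.inner_bundle
    (smoothFieldOn_mlieBracket (Q.isOpen i) (Q.smooth i a) (Q.smooth i b)) (Q.smooth i c)

/-- The connection form is smooth, because its coefficients are given by the structure functions of
the frame and `sp(1) ⊕ sp(n) ⊂ so(4n)` is faithful. -/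
theorem smoothFunOn_conn (hn : n ≠ 0) (i : ι) (a : Fr n) : SmoothFunOn n (Q.conn i a) (Q.U i) := by
  refine SmoothFunOn.congr (smoothFunOn_sum_smul Finset.univ
    (fun k : Fr n × Fr n => fun x => (1 / 4 : ℝ) * (Q.structCoeff i a k.1 k.2 x -
      Q.structCoeff i k.1 k.2 a x + Q.structCoeff i k.2 a k.1 x))
    (fun k => holProj k.1 k.2) fun k _ => ?_) fun x hx => ?_
  · exact contMDiffOn_const.mul (((Q.smoothFunOn_structCoeff i a k.1 k.2).sub
      (Q.smoothFunOn_structCoeff i k.1 k.2 a)).add (Q.smoothFunOn_structCoeff i k.2 a k.1))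
  · refine (eq_sum_coord_smul_holProj hn (Q.conn i a x)).trans ?_
    have e : ∀ r s, (1 / 2 : ℝ) • (coord s (tangentAct (Q.conn i a x) (frameVec r)) • holProj r s) =
        ((1 / 4 : ℝ) * (Q.structCoeff i a r s x - Q.structCoeff i r s a x +
          Q.structCoeff i s a r x)) • holProj r s := fun r s => by
      have h := Q.christoffel_eq hx a r s
      rw [christoffel, tangentCoeff_apply] at h
      rw [h, smul_smul]
      congr 1
      ring
    simp only [Finset.smul_sum, e]
    exact (Fintype.sum_prod_type' (fun r s => ((1 / 4 : ℝ) * (Q.structCoeff i a r s x -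
      Q.structCoeff i r s a x + Q.structCoeff i s a r x)) • (holProj r s : hol n))).symm

end QKStructure

/-! ### The first Bianchi identity -/

section
variable {n : ℕ} {M : Type*} [TopologicalSpace M] [ChartedSpace (EuclideanSpace ℝ (Fin (4 * n))) M]
  [IsManifold (𝓡 (4 * n)) ∞ M]

theorem mlieBracket_sum_smul {K : Type*} (s : Finset K) {U : Set M} (hU : IsOpen U) {X : VField n M}
    {Y : K → VField n M} {f : K → M → ℝ} (hY : ∀ k, SmoothFieldOn (Y k) U)
    (hf : ∀ k, SmoothFunOn n (f k) U) {x : M} (hx : x ∈ U) :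
    VectorField.mlieBracket (𝓡 (4 * n)) X (fun y => ∑ k ∈ s, f k y • Y k y) x =
      ∑ k ∈ s, (dirDeriv (f k) x (X x) • Y k x +
        f k x • VectorField.mlieBracket (𝓡 (4 * n)) X (Y k) x) := by
  classical
  have : IsManifold (𝓡 (4 * n)) 2 M := inferInstance
  have hs : ∀ s : Finset K, SmoothFieldOn (fun y => ∑ k ∈ s, f k y • Y k y) U := fun s =>
    ContMDiffOn.sum_section fun k _ => (hf k).smul_section (hY k)
  induction s using Finset.induction_on with
  | empty =>
    simp only [Finset.sum_empty]
    exact congrFun VectorField.mlieBracket_zero_right x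
  | insert k s hk ih =>
    have e : (fun y => ∑ k ∈ insert k s, f k y • Y k y) =
        (fun y => f k y • Y k y) + fun y => ∑ k ∈ s, f k y • Y k y := by
      ext y
      simp only [Finset.sum_insert hk, Pi.add_apply]
    rw [e, Finset.sum_insert hk, ← ih, ← mlieBracket_smul_dirDeriv hU (hY k) (hf k) hx]
    exact VectorField.mlieBracket_add_right
      (SmoothFieldOn.mdifferentiableAt hU ((hf k).smul_section (hY k)) hx)
      (SmoothFieldOn.mdifferentiableAt hU (hs s) hx)

end

namespace QKStructure

variable {n : ℕ} {M : Type*} [TopologicalSpace M] [ChartedSpace (EuclideanSpace ℝ (Fin (4 * n))) M]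
  [IsManifold (𝓡 (4 * n)) ∞ M] [RiemannianBundle (fun x : M => TangentSpace (𝓡 (4 * n)) x)]
  {ι : Type*} (Q : QKStructure n M ι)
  [IsContMDiffRiemannianBundle (𝓡 (4 * n)) ∞ (EuclideanSpace ℝ (Fin (4 * n)))
      (fun x : M => TangentSpace (𝓡 (4 * n)) x)]

theorem inner_mlieBracket_mlieBracket {i : ι} {x : M} (hx : x ∈ Q.U i) (a b c d : Fr n) :
    inner ℝ (VectorField.mlieBracket (𝓡 (4 * n)) (Q.frame i a)
      (VectorField.mlieBracket (𝓡 (4 * n)) (Q.frame i b) (Q.frame i c)) x) (Q.frame i d x) =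
    Q.frameDeriv i a (Q.structCoeff i b c d) x +
      ∑ k, Q.structCoeff i b c k x * Q.structCoeff i a k d x := by
  have h : VectorField.mlieBracket (𝓡 (4 * n)) (Q.frame i b) (Q.frame i c) =ᶠ[nhds x]
      fun y => ∑ k, Q.structCoeff i b c k y • Q.frame i k y := by
    filter_upwards [(Q.isOpen i).mem_nhds hx] with y hy
    exact Q.mlieBracket_frame hy b c
  have h1 : VectorField.mlieBracket (𝓡 (4 * n)) (Q.frame i a)
      (VectorField.mlieBracket (𝓡 (4 * n)) (Q.frame i b) (Q.frame i c)) x =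
      ∑ k, (Q.frameDeriv i a (Q.structCoeff i b c k) x • Q.frame i k x +
        Q.structCoeff i b c k x •
          VectorField.mlieBracket (𝓡 (4 * n)) (Q.frame i a) (Q.frame i k) x) :=
    ((Filter.EventuallyEq.refl _ (Q.frame i a)).mlieBracket_vectorField_eq h).trans
      (mlieBracket_sum_smul Finset.univ (Q.isOpen i) (fun k => Q.smooth i k)
        (fun k => Q.smoothFunOn_structCoeff i b c k) hx)
  rw [h1, sum_inner]
  simp only [inner_add_left, real_inner_smul_left, Q.orthonormal i x hx, Finset.sum_add_distrib,
    mul_ite, mul_one, mul_zero, Finset.sum_ite_eq', Finset.mem_univ, if_true]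
  rfl

/-- The Jacobi identity in terms of the structure functions. -/
theorem structCoeff_jacobi {i : ι} {x : M} (hx : x ∈ Q.U i) (a b c d : Fr n) :
    (Q.frameDeriv i a (Q.structCoeff i b c d) x +
      ∑ k, Q.structCoeff i b c k x * Q.structCoeff i a k d x) +
    (Q.frameDeriv i b (Q.structCoeff i c a d) x +
      ∑ k, Q.structCoeff i c a k x * Q.structCoeff i b k d x) +
    (Q.frameDeriv i c (Q.structCoeff i a b d) x +
      ∑ k, Q.structCoeff i a b k x * Q.structCoeff i c k d x) = 0 := by
  have h := congrArg (fun v => inner ℝ v (Q.frame i d x)) (leibniz_identity_of_smoothFieldOn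
    (Q.isOpen i) (Q.smooth i a) (Q.smooth i b) (Q.smooth i c) hx)
  have e : inner ℝ (VectorField.mlieBracket (𝓡 (4 * n))
      (VectorField.mlieBracket (𝓡 (4 * n)) (Q.frame i a) (Q.frame i b)) (Q.frame i c) x)
      (Q.frame i d x) = -inner ℝ (VectorField.mlieBracket (𝓡 (4 * n)) (Q.frame i c)
        (VectorField.mlieBracket (𝓡 (4 * n)) (Q.frame i a) (Q.frame i b)) x) (Q.frame i d x) := by
    rw [VectorField.mlieBracket_swap_apply]
    exact inner_neg_left _ _
  have h' := (h.trans (inner_add_left _ _ _)).trans (congrArg (· + _) e)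
  rw [Q.inner_mlieBracket_mlieBracket hx, Q.inner_mlieBracket_mlieBracket hx,
    Q.inner_mlieBracket_mlieBracket hx] at h'
  have e1 : Q.frameDeriv i b (Q.structCoeff i a c d) x =
      -Q.frameDeriv i b (Q.structCoeff i c a d) x := by
    rw [show Q.structCoeff i a c d = fun y => -Q.structCoeff i c a d y from
      funext fun y => Q.structCoeff_swap i c a d y]
    exact dirDeriv_neg _ _ _
  have e2 : ∑ k, Q.structCoeff i a c k x * Q.structCoeff i b k d x =
      -∑ k, Q.structCoeff i c a k x * Q.structCoeff i b k d x := by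
    rw [← Finset.sum_neg_distrib]
    exact Finset.sum_congr rfl fun k _ => by rw [Q.structCoeff_swap i c a k]; ring
  rw [e1, e2] at h'
  linear_combination h'

/-- The curvature tensor in terms of the Christoffel symbols. -/
theorem tangentCoeff_curv {i : ι} {x : M} (hn : n ≠ 0) (hx : x ∈ Q.U i) (a b c d : Fr n) :
    tangentCoeff c d (Q.curv i x a b) =
      Q.frameDeriv i a (Q.christoffel i b c d) x - Q.frameDeriv i b (Q.christoffel i a c d) x +
      ∑ k, (Q.christoffel i b c k x * Q.christoffel i a k d x -
        Q.christoffel i a c k x * Q.christoffel i b k d x) -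
      ∑ k, Q.structCoeff i a b k x * Q.christoffel i k c d x := by
  have h : ∀ a b, Q.frameDeriv i a (Q.christoffel i b c d) x =
      tangentCoeff c d (dirDeriv (Q.conn i b) x (Q.frame i a x)) := fun a b =>
    (Q.smoothFunOn_conn hn i b).dirDeriv_linear_comp (Q.isOpen i) hx (tangentCoeff c d) _
  rw [h, h]
  unfold curv
  simp only [map_sub, map_add, map_sum, map_smul, tangentCoeff_bracket]
  rfl

/-- The curvature satisfies the first Bianchi identity, which is the Jacobi identity for the frame
vector fields combined with the vanishing of the torsion. -/
theorem isAlgCurv_curv {i : ι} {x : M} (hn : n ≠ 0) (hx : x ∈ Q.U i) :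
    IsAlgCurv (Q.curv i x) where
  skew a b := by
    unfold curv
    have e : (spBracket (Q.conn i b x).1 (Q.conn i a x).1,
        spBracket (Q.conn i b x).2 (Q.conn i a x).2) =
        -((spBracket (Q.conn i a x).1 (Q.conn i b x).1,
          spBracket (Q.conn i a x).2 (Q.conn i b x).2) : hol n) := by
      refine Prod.ext (Subtype.ext ?_) (Subtype.ext ?_) <;> exact (neg_sub _ _).symm
    have e2 : ∀ c, (inner ℝ (VectorField.mlieBracket (𝓡 (4 * n)) (Q.frame i b) (Q.frame i a) x)
        (Q.frame i c x) : ℝ) = -inner ℝ (VectorField.mlieBracket (𝓡 (4 * n)) (Q.frame i a)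
          (Q.frame i b) x) (Q.frame i c x) := fun c => Q.structCoeff_swap i a b c x
    rw [e]
    simp only [e2, neg_smul, Finset.sum_neg_distrib]
    abel
  bianchi a b c d := by
    simp only [Q.tangentCoeff_curv hn hx]
    have hD : ∀ a b c, Q.frameDeriv i a (Q.christoffel i b c d) x -
        Q.frameDeriv i a (Q.christoffel i c b d) x = Q.frameDeriv i a (Q.structCoeff i b c d) x :=
      fun a b c => by
        have hs : ∀ b c, SmoothFunOn n (Q.christoffel i b c d) (Q.U i) := fun b c =>
          (Q.smoothFunOn_conn hn i b).linear_comp (tangentCoeff c d)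
        rw [Q.frameDeriv_congr (fun y hy => (Q.christoffel_sub_christoffel hy b c d).symm) hx a]
        exact (dirDeriv_sub ((hs b c).mdifferentiableAt (Q.isOpen i) hx)
          ((hs c b).mdifferentiableAt (Q.isOpen i) hx) _).symm
    have hS : ∀ a b c, ∑ k, Q.structCoeff i b c k x * Q.structCoeff i a k d x =
        ∑ k, Q.christoffel i b c k x * Q.christoffel i a k d x -
        ∑ k, Q.christoffel i c b k x * Q.christoffel i a k d x -
        ∑ k, Q.structCoeff i b c k x * Q.christoffel i k a d x := fun a b c => by
      rw [← Finset.sum_sub_distrib, ← Finset.sum_sub_distrib]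
      refine Finset.sum_congr rfl fun k _ => ?_
      rw [← Q.christoffel_sub_christoffel hx a k d, ← Q.christoffel_sub_christoffel hx b c k]
      ring
    have hJ := Q.structCoeff_jacobi hx a b c d
    rw [hS, hS, hS, ← hD, ← hD, ← hD] at hJ
    simp only [Finset.sum_sub_distrib]
    linear_combination hJ

end QKStructure

/-! ### Second covariant derivatives and the Ricci identity -/

section
variable {n : ℕ} {M : Type*} [TopologicalSpace M] [ChartedSpace (EuclideanSpace ℝ (Fin (4 * n))) M]
  {W W' : Type*} [NormedAddCommGroup W] [NormedSpace ℂ W] [NormedAddCommGroup W'] [NormedSpace ℂ W']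

/-- A representation as a real linear map. -/
def IsRep.lin {act : hol n → W →L[ℂ] W} (hrep : IsRep act) : hol n →ₗ[ℝ] (W →L[ℂ] W) where
  toFun := act
  map_add' := hrep.map_add
  map_smul' c X := (hrep.map_smul c X).trans (Complex.coe_smul c (act X))

theorem SmoothFunOn.clm_apply {A : M → W →L[ℂ] W'} {φ : M → W} {U : Set M}
    (hA : SmoothFunOn n A U) (hφ : SmoothFunOn n φ U) : SmoothFunOn n (fun x => A x (φ x)) U :=
  ContMDiffOn.clm_apply (g := fun x => ContinuousLinearMap.restrictScalarsL ℂ W W' ℝ ℝ (A x))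
    ((ContinuousLinearMap.restrictScalarsL ℂ W W' ℝ ℝ).contMDiff.comp_contMDiffOn hA) hφ

theorem dirDeriv_clm_apply {A : M → W →L[ℂ] W'} {φ : M → W} {x : M}
    (hA : MDifferentiableAt (𝓡 (4 * n)) 𝓘(ℝ, W →L[ℂ] W') A x)
    (hφ : MDifferentiableAt (𝓡 (4 * n)) 𝓘(ℝ, W) φ x) (v : TangentSpace (𝓡 (4 * n)) x) :
    dirDeriv (fun y => A y (φ y)) x v = dirDeriv A x v (φ x) + A x (dirDeriv φ x v) :=
  dirDeriv_bilin (ContinuousLinearMap.restrictScalarsL ℂ W W' ℝ ℝ) hA hφ v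

end

namespace QKStructure

variable {n : ℕ} {M : Type*} [TopologicalSpace M] [ChartedSpace (EuclideanSpace ℝ (Fin (4 * n))) M]
  [IsManifold (𝓡 (4 * n)) ∞ M] [RiemannianBundle (fun x : M => TangentSpace (𝓡 (4 * n)) x)]
  {ι : Type*} (Q : QKStructure n M ι)
  {W W' : Type*} [NormedAddCommGroup W] [NormedSpace ℂ W] [NormedAddCommGroup W'] [NormedSpace ℂ W']

theorem covDeriv_congr (act : hol n → W →L[ℂ] W) {i : ι} {φ χ : M → W}
    (h : ∀ y ∈ Q.U i, φ y = χ y) {x : M} (hx : x ∈ Q.U i) (a : Fr n) :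
    Q.covDeriv act i a φ x = Q.covDeriv act i a χ x := by
  have e := Q.frameDeriv_congr h hx a
  unfold frameDeriv at e
  rw [covDeriv, covDeriv, e, h x hx]

/-- The second covariant derivative `∇²_{s_a, s_b} φ`. -/
def secondCovDeriv (act : hol n → W →L[ℂ] W) (i : ι) (a b : Fr n) (φ : M → W) (x : M) : W :=
  Q.covDeriv act i a (Q.covDeriv act i b φ) x -
    ∑ c, Q.christoffel i a b c x • Q.covDeriv act i c φ x

theorem roughLaplacian_eq (act : hol n → W →L[ℂ] W) {i : ι} {x : M} (hx : x ∈ Q.U i) (φ : M → W) :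
    Q.roughLaplacian act i φ x = -∑ a, Q.secondCovDeriv act i a a φ x := by
  simp only [roughLaplacian, secondCovDeriv, Q.koszul_frame_eq hx]

variable [IsContMDiffRiemannianBundle (𝓡 (4 * n)) ∞ (EuclideanSpace ℝ (Fin (4 * n)))
      (fun x : M => TangentSpace (𝓡 (4 * n)) x)]

theorem smoothFunOn_act_conn {act : hol n → W →L[ℂ] W} (hrep : IsRep act) (hn : n ≠ 0) (i : ι)
    (a : Fr n) : SmoothFunOn n (fun x => act (Q.conn i a x)) (Q.U i) :=
  (Q.smoothFunOn_conn hn i a).linear_comp hrep.lin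

theorem smoothFunOn_covDeriv {act : hol n → W →L[ℂ] W} (hrep : IsRep act) (hn : n ≠ 0) {i : ι}
    {φ : M → W} (hφ : SmoothFunOn n φ (Q.U i)) (a : Fr n) :
    SmoothFunOn n (Q.covDeriv act i a φ) (Q.U i) :=
  (Q.smoothFunOn_frameDeriv hφ a).add ((Q.smoothFunOn_act_conn hrep hn i a).clm_apply hφ)

theorem covDeriv_covDeriv {act : hol n → W →L[ℂ] W} (hrep : IsRep act) (hn : n ≠ 0) {i : ι}
    {φ : M → W} (hφ : SmoothFunOn n φ (Q.U i)) {x : M} (hx : x ∈ Q.U i) (a b : Fr n) :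
    Q.covDeriv act i a (Q.covDeriv act i b φ) x =
      Q.frameDeriv i a (Q.frameDeriv i b φ) x +
        act (dirDeriv (Q.conn i b) x (Q.frame i a x)) (φ x) +
        act (Q.conn i b x) (Q.frameDeriv i a φ x) + act (Q.conn i a x) (Q.frameDeriv i b φ x) +
        act (Q.conn i a x) (act (Q.conn i b x) (φ x)) := by
  have hA := Q.smoothFunOn_act_conn hrep hn i b
  have h1 : dirDeriv (fun y => act (Q.conn i b y)) x (Q.frame i a x) =
      act (dirDeriv (Q.conn i b) x (Q.frame i a x)) :=
    (Q.smoothFunOn_conn hn i b).dirDeriv_linear_comp (Q.isOpen i) hx hrep.lin _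
  have h2 : dirDeriv (Q.covDeriv act i b φ) x (Q.frame i a x) =
      dirDeriv (Q.frameDeriv i b φ) x (Q.frame i a x) +
        dirDeriv (fun y => act (Q.conn i b y) (φ y)) x (Q.frame i a x) :=
    dirDeriv_add ((Q.smoothFunOn_frameDeriv hφ b).mdifferentiableAt (Q.isOpen i) hx)
      ((hA.clm_apply hφ).mdifferentiableAt (Q.isOpen i) hx) _
  rw [dirDeriv_clm_apply (hA.mdifferentiableAt (Q.isOpen i) hx)
    (hφ.mdifferentiableAt (Q.isOpen i) hx), h1] at h2
  rw [covDeriv, h2, covDeriv, map_add]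
  unfold frameDeriv
  abel

/-- The Ricci identity. -/
theorem secondCovDeriv_sub {act : hol n → W →L[ℂ] W} (hrep : IsRep act) (hn : n ≠ 0) {i : ι}
    {φ : M → W} (hφ : SmoothFunOn n φ (Q.U i)) {x : M} (hx : x ∈ Q.U i) (a b : Fr n) :
    Q.secondCovDeriv act i a b φ x - Q.secondCovDeriv act i b a φ x =
      act (Q.curv i x a b) (φ x) := by
  have h1 : ∑ c, Q.christoffel i a b c x • Q.covDeriv act i c φ x -
      ∑ c, Q.christoffel i b a c x • Q.covDeriv act i c φ x =
      (Q.frameDeriv i a (Q.frameDeriv i b φ) x - Q.frameDeriv i b (Q.frameDeriv i a φ) x) +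
      ∑ c, Q.structCoeff i a b c x • act (Q.conn i c x) (φ x) := by
    rw [Q.frameDeriv_comm hφ hx, ← Finset.sum_add_distrib, ← Finset.sum_sub_distrib]
    refine Finset.sum_congr rfl fun c _ => ?_
    rw [← sub_smul, Q.christoffel_sub_christoffel hx, covDeriv, smul_add]
    rfl
  have h2 : act (Q.curv i x a b) = act (dirDeriv (Q.conn i b) x (Q.frame i a x)) -
      act (dirDeriv (Q.conn i a) x (Q.frame i b x)) +
      (act (Q.conn i a x) ∘L act (Q.conn i b x) - act (Q.conn i b x) ∘L act (Q.conn i a x)) -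
      ∑ c, Q.structCoeff i a b c x • act (Q.conn i c x) := by
    rw [← hrep.map_lie]
    change hrep.lin _ = hrep.lin _ - hrep.lin _ + hrep.lin _ -
      ∑ c, Q.structCoeff i a b c x • hrep.lin _
    simp only [← map_sub, ← map_add, ← map_smul, ← map_sum]
    rfl
  rw [h2]
  simp only [secondCovDeriv, Q.covDeriv_covDeriv hrep hn hφ hx, _root_.sub_apply, _root_.add_apply,
    _root_.sum_apply, _root_.smul_apply, ContinuousLinearMap.comp_apply]
  linear_combination (norm := module) -h1

end QKStructure

/-! ### Parallel homomorphisms -/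

namespace QKStructure

variable {n : ℕ} {M : Type*} [TopologicalSpace M] [ChartedSpace (EuclideanSpace ℝ (Fin (4 * n))) M]
  [IsManifold (𝓡 (4 * n)) ∞ M] [RiemannianBundle (fun x : M => TangentSpace (𝓡 (4 * n)) x)]
  {ι : Type*} (Q : QKStructure n M ι)
  {W W' : Type*} [NormedAddCommGroup W] [NormedSpace ℂ W] [NormedAddCommGroup W'] [NormedSpace ℂ W']
  {act₁ : hol n → W →L[ℂ] W} {h₁ : ι → ι → M → W →L[ℂ] W}
  {act₂ : hol n → W' →L[ℂ] W'} {h₂ : ι → ι → M → W' →L[ℂ] W'} {F : ι → M → W →L[ℂ] W'}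

namespace IsParallelHom
variable {Q}

theorem covDeriv_apply (hF : Q.IsParallelHom act₁ h₁ act₂ h₂ F) {i : ι} {φ : M → W}
    (hφ : SmoothFunOn n φ (Q.U i)) {x : M} (hx : x ∈ Q.U i) (a : Fr n) :
    Q.covDeriv act₂ i a (fun y => F i y (φ y)) x = F i x (Q.covDeriv act₁ i a φ x) := by
  have h := congrArg (fun L : W →L[ℂ] W' => L (φ x)) (hF.parallel i x hx a)
  simp only [_root_.sub_apply, _root_.add_apply, ContinuousLinearMap.comp_apply,
    _root_.zero_apply] at h
  rw [covDeriv, covDeriv, dirDeriv_clm_apply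
    (SmoothFunOn.mdifferentiableAt (hF.smooth i) (Q.isOpen i) hx)
    (hφ.mdifferentiableAt (Q.isOpen i) hx), map_add]
  linear_combination (norm := module) h

variable [IsContMDiffRiemannianBundle (𝓡 (4 * n)) ∞ (EuclideanSpace ℝ (Fin (4 * n)))
      (fun x : M => TangentSpace (𝓡 (4 * n)) x)]

theorem secondCovDeriv_apply (hF : Q.IsParallelHom act₁ h₁ act₂ h₂ F) (hrep₁ : IsRep act₁)
    (hn : n ≠ 0) {i : ι} {φ : M → W} (hφ : SmoothFunOn n φ (Q.U i)) {x : M} (hx : x ∈ Q.U i)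
    (a b : Fr n) :
    Q.secondCovDeriv act₂ i a b (fun y => F i y (φ y)) x =
      F i x (Q.secondCovDeriv act₁ i a b φ x) := by
  rw [secondCovDeriv, secondCovDeriv,
    Q.covDeriv_congr act₂ (fun y hy => hF.covDeriv_apply hφ hy b) hx a,
    hF.covDeriv_apply (Q.smoothFunOn_covDeriv hrep₁ hn hφ b) hx a, map_sub, map_sum]
  congr 1
  refine Finset.sum_congr rfl fun c _ => ?_
  rw [hF.covDeriv_apply hφ hx, ← Complex.coe_smul, ← Complex.coe_smul, map_smul]

theorem roughLaplacian_apply (hF : Q.IsParallelHom act₁ h₁ act₂ h₂ F) (hrep₁ : IsRep act₁)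
    (hn : n ≠ 0) {i : ι} {φ : M → W} (hφ : SmoothFunOn n φ (Q.U i)) {x : M} (hx : x ∈ Q.U i) :
    Q.roughLaplacian act₂ i (fun y => F i y (φ y)) x = F i x (Q.roughLaplacian act₁ i φ x) := by
  simp only [Q.roughLaplacian_eq _ hx, hF.secondCovDeriv_apply hrep₁ hn hφ hx, map_neg, map_sum]

/-- A parallel homomorphism is equivariant under the curvature endomorphisms, by the Ricci
identity. -/
theorem apply_act_curv (hF : Q.IsParallelHom act₁ h₁ act₂ h₂ F) (hrep₁ : IsRep act₁)
    (hrep₂ : IsRep act₂) (hn : n ≠ 0) {i : ι} {x : M} (hx : x ∈ Q.U i) (a b : Fr n) (w : W) :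
    F i x (act₁ (Q.curv i x a b) w) = act₂ (Q.curv i x a b) (F i x w) := by
  have hw : SmoothFunOn n (fun _ : M => w) (Q.U i) := contMDiffOn_const
  have hFw : SmoothFunOn n (fun y : M => F i y w) (Q.U i) := SmoothFunOn.clm_apply (hF.smooth i) hw
  have e1 := Q.secondCovDeriv_sub hrep₁ hn hw hx a b
  have e2 := Q.secondCovDeriv_sub hrep₂ hn hFw hx a b
  rw [← e1, ← e2, map_sub, hF.secondCovDeriv_apply hrep₁ hn hw hx,
    hF.secondCovDeriv_apply hrep₁ hn hw hx]

/-- The endomorphism `q(R)` commutes with parallel homomorphisms. Only values of `R` are known to be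
intertwined with `F`, so the factors of `∑ (e_a ∧ e_b) R(e_a ∧ e_b)` are moved past `F` one at a
time, exchanging their roles by the symmetry of `R`. -/
theorem apply_qCurv_curv (hF : Q.IsParallelHom act₁ h₁ act₂ h₂ F) (hrep₁ : IsRep act₁)
    (hrep₂ : IsRep act₂) (hn : n ≠ 0) {i : ι} {x : M} (hx : x ∈ Q.U i) (w : W) :
    F i x (qCurv act₁ (Q.curv i x) w) = qCurv act₂ (Q.curv i x) (F i x w) := by
  have hR := Q.isAlgCurv_curv hn hx
  -- the bilinear maps `(X, Y) ↦ F X Y w` and `(X, Y) ↦ X F Y w`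
  let B₁ : hol n →ₗ[ℝ] hol n →ₗ[ℝ] W' := LinearMap.mk₂ ℝ
    (fun X Y => F i x (hrep₁.lin X (hrep₁.lin Y w)))
    (fun X X' Y => by simp) (fun c X Y => by simp) (fun X Y Y' => by simp) (fun c X Y => by simp)
  let B₂ : hol n →ₗ[ℝ] hol n →ₗ[ℝ] W' := LinearMap.mk₂ ℝ
    (fun X Y => hrep₂.lin X (F i x (hrep₁.lin Y w)))
    (fun X X' Y => by simp) (fun c X Y => by simp) (fun X Y Y' => by simp) (fun c X Y => by simp)
  have s1 : ∑ p, ∑ q, F i x (act₁ (holProj p q) (act₁ (Q.curv i x p q) w)) =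
      ∑ p, ∑ q, F i x (act₁ (Q.curv i x p q) (act₁ (holProj p q) w)) := hR.sum_bilin_symm hn B₁
  have s2 : ∑ p, ∑ q, act₂ (holProj p q) (F i x (act₁ (Q.curv i x p q) w)) =
      ∑ p, ∑ q, act₂ (Q.curv i x p q) (F i x (act₁ (holProj p q) w)) := hR.sum_bilin_symm hn B₂
  simp only [qCurv, _root_.smul_apply, _root_.sum_apply, ContinuousLinearMap.comp_apply, map_smul,
    map_sum]
  rw [s1]
  simp only [hF.apply_act_curv hrep₁ hrep₂ hn hx] at s2 ⊢
  rw [s2]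

/-- The operator `∇*∇ + 2 q(R)` commutes with parallel homomorphisms. -/
theorem laplace_apply (hF : Q.IsParallelHom act₁ h₁ act₂ h₂ F) (hrep₁ : IsRep act₁)
    (hrep₂ : IsRep act₂) (hn : n ≠ 0) {i : ι} {φ : M → W} (hφ : SmoothFunOn n φ (Q.U i)) {x : M}
    (hx : x ∈ Q.U i) :
    F i x (Q.laplace act₁ i φ x) = Q.laplace act₂ i (fun y => F i y (φ y)) x := by
  rw [laplace, laplace, map_add, map_smul, hF.apply_qCurv_curv hrep₁ hrep₂ hn hx,
    hF.roughLaplacian_apply hrep₁ hn hφ hx]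

end IsParallelHom
end QKStructure

/-! ### Dirac operators -/

namespace QKStructure

variable {n : ℕ} {M : Type*} [TopologicalSpace M] [ChartedSpace (EuclideanSpace ℝ (Fin (4 * n))) M]
  [IsManifold (𝓡 (4 * n)) ∞ M] [RiemannianBundle (fun x : M => TangentSpace (𝓡 (4 * n)) x)]
  {ι : Type*} (Q : QKStructure n M ι)
  {W : Type*} [NormedAddCommGroup W] [NormedSpace ℂ W] {act : hol n → W →L[ℂ] W}

/-- Clifford multiplication is parallel: the covariant derivative of `s_b ⋆ φ` is given by the
Leibniz rule. -/
theorem covDeriv_clifford {c : Fr n → W →L[ℂ] W}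
    (hact : ∀ X p w, act X (c p w) = c p (act X w) + ∑ q, (tangentCoeff p q X : ℂ) • c q w)
    {i : ι} {φ : M → W} (hφ : SmoothFunOn n φ (Q.U i)) {x : M} (hx : x ∈ Q.U i) (a b : Fr n) :
    Q.covDeriv act i a (fun y => c b (φ y)) x =
      c b (Q.covDeriv act i a φ x) + ∑ q, (Q.christoffel i a b q x : ℂ) • c q (φ x) := by
  have h : dirDeriv (fun y => c b (φ y)) x (Q.frame i a x) = c b (dirDeriv φ x (Q.frame i a x)) :=
    dirDeriv_clm ((c b).restrictScalars ℝ) (hφ.mdifferentiableAt (Q.isOpen i) hx) _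
  rw [covDeriv, covDeriv, h, hact, map_add, add_assoc]
  rfl

variable [IsContMDiffRiemannianBundle (𝓡 (4 * n)) ∞ (EuclideanSpace ℝ (Fin (4 * n)))
      (fun x : M => TangentSpace (𝓡 (4 * n)) x)]

/-- The Weitzenböck formula for the square of a Dirac operator, for any representation with an
equivariant Clifford multiplication `c`. -/
theorem sum_clifford_covDeriv_sum (hrep : IsRep act) (hn : n ≠ 0) {c : Fr n → W →L[ℂ] W}
    (hc : ∀ p q w, c p (c q w) + c q (c p w) = (if p = q then (-2 : ℂ) else 0) • w)
    (hact : ∀ X p w, act X (c p w) = c p (act X w) + ∑ q, (tangentCoeff p q X : ℂ) • c q w)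
    {i : ι} {φ : M → W} (hφ : SmoothFunOn n φ (Q.U i)) {x : M} (hx : x ∈ Q.U i) :
    ∑ a, c a (Q.covDeriv act i a (fun y => ∑ b, c b (Q.covDeriv act i b φ y)) x) =
      Q.roughLaplacian act i φ x +
        (1 / 2 : ℂ) • ∑ a, ∑ b, c a (c b (act (Q.curv i x a b) (φ x))) := by
  have hs : ∀ b, SmoothFunOn n (fun y => c b (Q.covDeriv act i b φ y)) (Q.U i) := fun b =>
    ((c b).restrictScalars ℝ).contMDiff.comp_contMDiffOn (Q.smoothFunOn_covDeriv hrep hn hφ b)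
  have h1 : ∀ a, Q.covDeriv act i a (fun y => ∑ b, c b (Q.covDeriv act i b φ y)) x =
      ∑ b, c b (Q.secondCovDeriv act i a b φ x) := by
    intro a
    have e1 : Q.covDeriv act i a (fun y => ∑ b, c b (Q.covDeriv act i b φ y)) x =
        ∑ b, Q.covDeriv act i a (fun y => c b (Q.covDeriv act i b φ y)) x := by
      simp only [covDeriv, Finset.sum_add_distrib]
      rw [map_sum]
      congr 1
      exact dirDeriv_sum Finset.univ
        (fun b _ => SmoothFunOn.mdifferentiableAt (hs b) (Q.isOpen i) hx) _
    have e2 : ∑ b, ∑ q, (Q.christoffel i a b q x : ℂ) • c q (Q.covDeriv act i b φ x) =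
        -∑ b, c b (∑ q, Q.christoffel i a b q x • Q.covDeriv act i q φ x) := by
      rw [Finset.sum_comm, ← Finset.sum_neg_distrib]
      refine Finset.sum_congr rfl fun b _ => ?_
      rw [map_sum, ← Finset.sum_neg_distrib]
      refine Finset.sum_congr rfl fun q _ => ?_
      rw [← Complex.coe_smul, map_smul, Q.christoffel_skew i a b q]
      push_cast
      rw [neg_smul]
    rw [e1]
    simp only [Q.covDeriv_clifford hact (Q.smoothFunOn_covDeriv hrep hn hφ _) hx,
      Finset.sum_add_distrib, e2, secondCovDeriv, map_sub, Finset.sum_sub_distrib]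
    abel
  simp only [h1, map_sum]
  have h2 : ∑ a, ∑ b, c a (c b (Q.secondCovDeriv act i a b φ x)) =
      ∑ a, ∑ b, c b (c a (Q.secondCovDeriv act i b a φ x)) := Finset.sum_comm
  have h3 : ∀ a b, c a (c b (Q.secondCovDeriv act i a b φ x)) +
      c b (c a (Q.secondCovDeriv act i b a φ x)) =
      c a (c b (act (Q.curv i x a b) (φ x))) +
        (if a = b then (-2 : ℂ) else 0) • Q.secondCovDeriv act i b a φ x := by
    intro a b
    rw [← hc, ← Q.secondCovDeriv_sub hrep hn hφ hx, map_sub, map_sub]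
    abel
  have h4 : (2 : ℂ) • ∑ a, ∑ b, c a (c b (Q.secondCovDeriv act i a b φ x)) =
      ∑ a, ∑ b, c a (c b (act (Q.curv i x a b) (φ x))) +
        (-2 : ℂ) • ∑ a, Q.secondCovDeriv act i a a φ x := by
    rw [two_smul]
    nth_rewrite 2 [h2]
    simp only [← Finset.sum_add_distrib, h3]
    simp only [Finset.sum_add_distrib, ite_smul, zero_smul, Finset.sum_ite_eq, Finset.mem_univ,
      if_true, Finset.smul_sum]
  rw [Q.roughLaplacian_eq _ hx]
  linear_combination (norm := module) (1 / 2 : ℂ) • h4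

theorem twSpinorAct_clifford {l d : ℕ} (X : hol n) (p : Fr n) (ψ : TwSpinor n l d) :
    twSpinorAct n l d X (clifford p ψ) = clifford p (twSpinorAct n l d X ψ) +
      ∑ q, (tangentCoeff p q X : ℂ) • clifford q ψ := by
  have h1 := spinAct_clifford X p ψ
  have h2 := clifford_compLeft (twistAct n l d X : twist n l d →ₗ[ℂ] twist n l d) p ψ
  change spinAct X (clifford p ψ) + (twistAct n l d X : twist n l d →ₗ[ℂ] twist n l d).compLeft
    (Finset (Idx n)) (clifford p ψ) = clifford p (spinAct X ψ + (twistAct n l d X :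
      twist n l d →ₗ[ℂ] twist n l d).compLeft (Finset (Idx n)) ψ) + _
  rw [h1, ← h2, map_add]
  abel

/-- On twisted spinors `∇*∇ + 2 q(R)` and the square of the Dirac operator differ by a scalar
function: both are `∇*∇` plus a curvature term. -/
theorem laplace_twSpinorAct (hn : 2 ≤ n) {l d : ℕ} {i : ι} {φ : M → TwSpinor n l d}
    (hφ : SmoothFunOn n φ (Q.U i)) {x : M} (hx : x ∈ Q.U i) :
    Q.laplace (twSpinorAct n l d) i φ x = Q.dirac i (Q.dirac i φ) x +
      (Q.scal i x / (8 * n * (n + 2)) * (l + d - n) * (l - d + n + 2) : ℝ) • φ x := by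
  have hn0 : n ≠ 0 := by omega
  have h1 := Q.sum_clifford_covDeriv_sum (isRep_twSpinorAct n l d) hn0
    (c := fun p => LinearMap.toContinuousLinearMap (clifford p))
    (fun p q w => clifford_anticomm p q w) (fun X p w => twSpinorAct_clifford X p w) hφ hx
  have h2 := (Q.isAlgCurv_curv hn0 hx).qCurv_twSpinorAct (l := l) (d := d) hn
    (κ := Q.scal i x) rfl (φ x)
  have h3 : Q.dirac i (Q.dirac i φ) x = Q.roughLaplacian (twSpinorAct n l d) i φ x +
      ((1 / 2 : ℝ) : ℂ) • ∑ a, ∑ b,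
        clifford a (clifford b (twSpinorAct n l d (Q.curv i x a b) (φ x))) := by
    push_cast
    exact h1
  rw [coe_real_smul] at h3
  rw [h3, laplace, h2]
  abel

end QKStructure

end QK

theorem mainTheorem7 {n : ℕ} (hn : 2 ≤ n)
    {M : Type*} [TopologicalSpace M] [ChartedSpace (EuclideanSpace ℝ (Fin (4 * n))) M]
    [IsManifold (𝓡 (4 * n)) ∞ M] [RiemannianBundle (fun x : M => TangentSpace (𝓡 (4 * n)) x)]
    [IsContMDiffRiemannianBundle (𝓡 (4 * n)) ∞ (EuclideanSpace ℝ (Fin (4 * n)))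
      (fun x : M => TangentSpace (𝓡 (4 * n)) x)]
    {ι : Type*} (Q : QK.QKStructure n M ι)
    (l d : ℕ) (hd : d ≤ n)
    (h : ι → ι → M → QK.TwSpinor n l d →L[ℂ] QK.TwSpinor n l d)
    (hh : Q.IsAssociated (QK.twSpinorAct n l d) h)
    {W : Type*} [NormedAddCommGroup W] [NormedSpace ℂ W] [FiniteDimensional ℂ W]
    (act : QK.hol n → W →L[ℂ] W) (hrep : QK.IsRep act)
    (k : ι → ι → M → W →L[ℂ] W) (hk : Q.IsAssociated act k) :
    (∀ F : ι → M → W →L[ℂ] QK.TwSpinor n l d,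
      Q.IsParallelHom act k (QK.twSpinorAct n l d) h F →
      ∀ ψ : ι → M → W, Q.IsSection k ψ → ∀ i, ∀ x ∈ Q.U i,
        F i x (Q.laplace act i (ψ i) x) =
          Q.dirac i (Q.dirac i (fun y => F i y (ψ i y))) x
            + (Q.scal i x / (8 * n * (n + 2)) * (l + d - n) * (l - d + n + 2) : ℝ) •
              F i x (ψ i x)) ∧
    (∀ F F' : ι → M → W →L[ℂ] QK.TwSpinor n l d,
      Q.IsParallelHom act k (QK.twSpinorAct n l d) h F →
      Q.IsParallelHom act k (QK.twSpinorAct n l d) h F' →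
      (∀ i, ∀ x ∈ Q.U i, Function.Injective (F i x)) →
      (∀ i, ∀ x ∈ Q.U i, Function.Injective (F' i x)) →
      ∀ ψ χ : ι → M → W, Q.IsSection k ψ → Q.IsSection k χ →
        ((∀ i, ∀ x ∈ Q.U i,
            Q.dirac i (Q.dirac i (fun y => F i y (ψ i y))) x = F i x (χ i x)) ↔
          (∀ i, ∀ x ∈ Q.U i,
            Q.dirac i (Q.dirac i (fun y => F' i y (ψ i y))) x = F' i x (χ i x)))) ∧
    (∀ i, ∀ x ∈ Q.U i, QK.qCurv (QK.twistAct n l d) (Q.curvHyper i x) = 0) := by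
  have hn0 : n ≠ 0 := by omega
  have h1 : ∀ F : ι → M → W →L[ℂ] QK.TwSpinor n l d,
      Q.IsParallelHom act k (QK.twSpinorAct n l d) h F →
      ∀ ψ : ι → M → W, Q.IsSection k ψ → ∀ i, ∀ x ∈ Q.U i,
        F i x (Q.laplace act i (ψ i) x) =
          Q.dirac i (Q.dirac i (fun y => F i y (ψ i y))) x
            + (Q.scal i x / (8 * n * (n + 2)) * (l + d - n) * (l - d + n + 2) : ℝ) •
              F i x (ψ i x) := fun F hF ψ hψ i x hx =>
    (hF.laplace_apply hrep (QK.isRep_twSpinorAct n l d) hn0 (hψ.smooth i) hx).trans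
      (Q.laplace_twSpinorAct hn (QK.SmoothFunOn.clm_apply (hF.smooth i) (hψ.smooth i)) hx)
  refine ⟨h1, fun F F' hF hF' hinj hinj' ψ χ hψ _ => ?_, fun i x hx =>
    QK.qCurv_twistAct_hyper (Q.isAlgCurv_curv hn0 hx) hn rfl⟩
  -- both conditions say that `Δ ψ - c ψ = χ`, where `c` is the scalar function of the first part
  have key : ∀ F : ι → M → W →L[ℂ] QK.TwSpinor n l d,
      Q.IsParallelHom act k (QK.twSpinorAct n l d) h F →
      (∀ i, ∀ x ∈ Q.U i, Function.Injective (F i x)) → ∀ i, ∀ x ∈ Q.U i,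
      (Q.dirac i (Q.dirac i (fun y => F i y (ψ i y))) x = F i x (χ i x) ↔
        Q.laplace act i (ψ i) x - ((Q.scal i x / (8 * n * (n + 2)) * (l + d - n) *
          (l - d + n + 2) : ℝ) : ℂ) • ψ i x = χ i x) := fun F hF hinj i x hx => by
    rw [← (hinj i x hx).eq_iff, map_sub, map_smul, h1 F hF ψ hψ i x hx, QK.coe_real_smul,
      add_sub_cancel_right]
  exact forall_congr' fun i => forall_congr' fun x => forall_congr' fun hx =>
    (key F hF hinj i x hx).trans (key F' hF' hinj' i x hx).symm
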